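/- Let $M$ be a compact smooth three-dimensional manifold (without boundary) and let $\kappa\in\mathbb{R}$. For a smooth Riemannian metric $g$ on $M$ with Levi-Civita connection $\nabla^g$, let $\mathcal{R}^g_{u,v}w=\nabla^g_u\nabla^g_v w-\nabla^g_v\nabla^g_u w-\nabla^g_{[u,v]}w$ be its Riemann tensor, $\mathcal{R}^g_{u,v}(w,z)=g(\mathcal{R}^g_{u,v}w,z)$, and, for local orthonormal frames $(e_i)$, set $$\mathrm{Ric}^g(u,v)=\sum_i\mathcal{R}^g_{e_i,u}(v,e_i),\qquad (\mathcal{R}^g\circ_g\mathcal{R}^g)(u,v)=\tfrac12\sum_{i,j,k}\mathcal{R}^g_{u,e_i}(e_j,e_k)\,\mathcal{R}^g_{v,e_i}(e_j,e_k),\qquad |\mathcal{R}^g|_g^2=\tfrac14\sum_{i,j,k,l}\mathcal{R}^g_{e_i,e_j}(e_k,e_l)^2,$$ $$(\mathrm{d}_{\nabla^g}^*\mathcal{R}^g)(u,v,w)=-\sum_i(\nabla^g_{e_i}\mathcal{R}^g)(e_i,u,v,w),\qquad \delta^g\mathrm{d}\phi=-\mathrm{tr}_g\nabla^g\mathrm{d}\phi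 .$$ A torsionless Heterotic soliton on $M$ is a pair $(g,\phi)$ of a smooth Riemannian metric $g$ and $\phi\in C^\infty(M)$ such that the three expressions $$\mathcal{E}_{\mathrm E}(g,\phi)=\mathrm{Ric}^g+\nabla^g\mathrm{d}\phi-\tfrac12e^{2\phi}g+\kappa\,\mathcal{R}^g\circ_g\mathcal{R}^g,\qquad \mathcal{E}_{\mathrm{YM}}(g,\phi)=\mathrm{d}_{\nabla^g}^*\mathcal{R}^g+\mathcal{R}^g(\mathrm{d}\phi),\qquad \mathcal{E}_{\mathrm D}(g,\phi)=\delta^g\mathrm{d}\phi+|\mathrm{d}\phi|_g^2-e^{2\phi}+\kappa|\mathcal{R}^g|_g^2$$ all vanish, where $\mathcal{R}^g(\mathrm{d}\phi)(u,v,w)=\mathcal{R}^g_{\mathrm{grad}_g\phi,\,u}(v,w)$. Its space of essential deformations $\mathbb{E}_{(g,\phi)}$ is the vector space of all pairs $(h,\xi)$ of a smooth symmetric $2$-tensor $h$ and $\xi\in C^\infty(M)$ such that (a) $(h,\xi)$ is an infinitesimal deformation: $\frac{\mathrm d}{\mathrm dt}\big|_{t=0}\mathcal{E}(g+th,\phi+t\xi)=0$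 for each of $\mathcal{E}=\mathcal{E}_{\mathrm E},\mathcal{E}_{\mathrm{YM}},\mathcal{E}_{\mathrm D}$; and (b) $(h,\xi)$ lies in the kernel of the formal $L^2$-adjoint of the infinitesimal action $v\mapsto(\mathcal{L}_vg,\mathrm{d}\phi(v))$ of the diffeomorphism group (that is, it is $L^2$-orthogonal to the tangent space of the orbit of $(g,\phi)$): $2\nabla^{g*}h+\xi\,\mathrm{d}\phi=0$, where $(\nabla^{g*}h)(v)=-\sum_i(\nabla^g_{e_i}h)(e_i,v)$. **Theorem.** Let $(g,\phi)$ be a torsionless Heterotic soliton on $M$ such that $g$ is not flat (i.e. $\mathcal{R}^g$ does not vanish identically) and has harmonic curvature (i.e. $\mathrm{d}_{\nabla^g}^*\mathcal{R}^g=0$). Then $\mathbb{E}_{(g,\phi)}=\{0\}$. -/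

import Mathlib

open Bundle
open scoped Manifold ContDiff

noncomputable section

namespace HeteroticSoliton

/-- The model space of a three-dimensional manifold. -/
abbrev E3 : Type := EuclideanSpace ℝ (Fin 3)

/-! ### Tensor calculus in local coordinates

In this part `G : E3 → Matrix (Fin 3) (Fin 3) ℝ` is the matrix `(g_ij)` of the components of a metric
in local coordinates, `f : E3 → ℝ` is a function in these coordinates, and `y : E3` is a point. -/

/-- The partial derivative `∂_i f` at `y`. -/
def pd (i : Fin 3) (f : E3 → ℝ) (y : E3) : ℝ :=
  fderiv ℝ f y (EuclideanSpace.single i 1)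

/-- The Christoffel symbol `Γ^k_ij = ½ g^kl (∂_i g_jl + ∂_j g_il - ∂_l g_ij)` of the Levi-Civita
connection, so that `∇_{∂_i} ∂_j = Γ^k_ij ∂_k`. -/
def christoffel (G : E3 → Matrix (Fin 3) (Fin 3) ℝ) (y : E3) (k i j : Fin 3) : ℝ :=
  (1 / 2) * ∑ l, (G y)⁻¹ k l *
    (pd i (fun z => G z j l) y + pd j (fun z => G z i l) y - pd l (fun z => G z i j) y)

/-- The component `R_ij^l_k` of the Riemann tensor: `R_{∂_i,∂_j} ∂_k = (riemannUp G y i j k l) ∂_l`,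
where `R_{u,v} w = ∇_u ∇_v w - ∇_v ∇_u w - ∇_{[u,v]} w`. -/
def riemannUp (G : E3 → Matrix (Fin 3) (Fin 3) ℝ) (y : E3) (i j k l : Fin 3) : ℝ :=
  pd i (fun z => christoffel G z l j k) y - pd j (fun z => christoffel G z l i k) y
    + ∑ m, (christoffel G y l i m * christoffel G y m j k
        - christoffel G y l j m * christoffel G y m i k)

/-- The Riemann tensor as a section of `Λ² ⊗ Λ²`:
`riemann G y i j k l = R_{∂_i,∂_j}(∂_k,∂_l) = g(R_{∂_i,∂_j} ∂_k, ∂_l)`. -/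
def riemann (G : E3 → Matrix (Fin 3) (Fin 3) ℝ) (y : E3) (i j k l : Fin 3) : ℝ :=
  ∑ m, riemannUp G y i j k m * G y m l

/-- The Ricci tensor `Ric(u,v) = ∑ R_{e_i,u}(v,e_i)` for an orthonormal frame `(e_i)`. -/
def ricci (G : E3 → Matrix (Fin 3) (Fin 3) ℝ) (y : E3) (i j : Fin 3) : ℝ :=
  ∑ p, ∑ q, (G y)⁻¹ p q * riemann G y p i j q

/-- The Hessian `(∇ df)(∂_i,∂_j)`. -/
def hessian (G : E3 → Matrix (Fin 3) (Fin 3) ℝ) (f : E3 → ℝ) (y : E3) (i j : Fin 3) : ℝ :=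
  pd i (fun z => pd j f z) y - ∑ k, christoffel G y k i j * pd k f y

/-- The codifferential `δ df = - tr_g ∇ df` of the differential of a function. -/
def codiffGrad (G : E3 → Matrix (Fin 3) (Fin 3) ℝ) (f : E3 → ℝ) (y : E3) : ℝ :=
  -∑ i, ∑ j, (G y)⁻¹ i j * hessian G f y i j

/-- The squared norm `|df|²`. -/
def normSqGrad (G : E3 → Matrix (Fin 3) (Fin 3) ℝ) (f : E3 → ℝ) (y : E3) : ℝ :=
  ∑ i, ∑ j, (G y)⁻¹ i j * pd i f y * pd j f y

/-- `(R ∘ R)(u,v) = ½ ∑ R_{u,e_i}(e_j,e_k) R_{v,e_i}(e_j,e_k)` for an orthonormal frame `(e_i)`. -/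
def riemannCirc (G : E3 → Matrix (Fin 3) (Fin 3) ℝ) (y : E3) (a b : Fin 3) : ℝ :=
  (1 / 2) * ∑ i, ∑ i', ∑ j, ∑ j', ∑ k, ∑ k',
    (G y)⁻¹ i i' * (G y)⁻¹ j j' * (G y)⁻¹ k k' * riemann G y a i j k * riemann G y b i' j' k'

/-- `|R|² = ¼ ∑ R_{e_i,e_j}(e_k,e_l) R_{e_i,e_j}(e_k,e_l)` for an orthonormal frame `(e_i)`. -/
def riemannNormSq (G : E3 → Matrix (Fin 3) (Fin 3) ℝ) (y : E3) : ℝ :=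
  (1 / 4) * ∑ i, ∑ i', ∑ j, ∑ j', ∑ k, ∑ k', ∑ l, ∑ l',
    (G y)⁻¹ i i' * (G y)⁻¹ j j' * (G y)⁻¹ k k' * (G y)⁻¹ l l'
      * riemann G y i j k l * riemann G y i' j' k' l'

/-- The covariant derivative `(∇_{∂_p} R)(∂_i,∂_j,∂_k,∂_l)` of the Riemann tensor. -/
def covRiemann (G : E3 → Matrix (Fin 3) (Fin 3) ℝ) (y : E3) (p i j k l : Fin 3) : ℝ :=
  pd p (fun z => riemann G z i j k l) y
    - ∑ m, (christoffel G y m p i * riemann G y m j k l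
        + christoffel G y m p j * riemann G y i m k l
        + christoffel G y m p k * riemann G y i j m l
        + christoffel G y m p l * riemann G y i j k m)

/-- The divergence `(d_∇^* R)(u,v,w) = - ∑ (∇_{e_i} R)(e_i,u,v,w)` of the Riemann tensor. -/
def divRiemann (G : E3 → Matrix (Fin 3) (Fin 3) ℝ) (y : E3) (i j k : Fin 3) : ℝ :=
  -∑ p, ∑ q, (G y)⁻¹ p q * covRiemann G y p q i j k

/-- The contraction `R(df)(u,v,w) = R_{grad f,u}(v,w)`. -/
def riemannGrad (G : E3 → Matrix (Fin 3) (Fin 3) ℝ) (f : E3 → ℝ) (y : E3) (i j k : Fin 3) : ℝ :=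
  ∑ p, ∑ q, (G y)⁻¹ p q * pd p f y * riemann G y q i j k

/-- The covariant derivative `(∇_{∂_p} h)(∂_i,∂_j)` of a field `h` of bilinear forms. -/
def covBilin (G H : E3 → Matrix (Fin 3) (Fin 3) ℝ) (y : E3) (p i j : Fin 3) : ℝ :=
  pd p (fun z => H z i j) y
    - ∑ m, (christoffel G y m p i * H y m j + christoffel G y m p j * H y i m)

/-- The formal adjoint of `∇`, `(∇^* h)(v) = - ∑ (∇_{e_i} h)(e_i,v)`, on symmetric bilinear
forms. -/
def divBilin (G H : E3 → Matrix (Fin 3) (Fin 3) ℝ) (y : E3) (j : Fin 3) : ℝ :=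
  -∑ p, ∑ q, (G y)⁻¹ p q * covBilin G H y p q j

/-- The Einstein operator `Ric + ∇ df - ½ e^{2f} g + κ R ∘ R`. -/
def einsteinOp (κ : ℝ) (G : E3 → Matrix (Fin 3) (Fin 3) ℝ) (f : E3 → ℝ) (y : E3)
    (i j : Fin 3) : ℝ :=
  ricci G y i j + hessian G f y i j - (1 / 2) * Real.exp (2 * f y) * G y i j
    + κ * riemannCirc G y i j

/-- The Yang-Mills operator `d_∇^* R + R(df)`. -/
def yangMillsOp (G : E3 → Matrix (Fin 3) (Fin 3) ℝ) (f : E3 → ℝ) (y : E3) (i j k : Fin 3) : ℝ :=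
  divRiemann G y i j k + riemannGrad G f y i j k

/-- The dilaton operator `δ df + |df|² - e^{2f} + κ |R|²`. -/
def dilatonOp (κ : ℝ) (G : E3 → Matrix (Fin 3) (Fin 3) ℝ) (f : E3 → ℝ) (y : E3) : ℝ :=
  codiffGrad G f y + normSqGrad G f y - Real.exp (2 * f y) + κ * riemannNormSq G y

/-! ### Tensors on a three-manifold -/

section Manifold

variable {M : Type*} [TopologicalSpace M] [ChartedSpace E3 M]

/-- The coordinate vector field `∂_i` of the chart `e`, at the point with coordinates `y`. -/
def coordVec (e : OpenPartialHomeomorph M E3) (y : E3) (i : Fin 3) :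
    TangentSpace (𝓡 3) (e.symm y) :=
  mfderiv 𝓘(ℝ, E3) (𝓡 3) e.symm y (EuclideanSpace.single i (1 : ℝ) : E3)

/-- The components `B(∂_i,∂_j)` in the chart `e` of a field `B` of bilinear forms on `M`. -/
def chartBilin (e : OpenPartialHomeomorph M E3)
    (B : (x : M) → TangentSpace (𝓡 3) x →L[ℝ] TangentSpace (𝓡 3) x →L[ℝ] ℝ) (y : E3) :
    Matrix (Fin 3) (Fin 3) ℝ :=
  Matrix.of fun i j => B (e.symm y) (coordVec e y i) (coordVec e y j)

/-- The expression of a function on `M` in the chart `e`. -/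
def chartFun (e : OpenPartialHomeomorph M E3) (f : M → ℝ) (y : E3) : ℝ := f (e.symm y)

variable [IsManifold (𝓡 3) ∞ M]

variable (M) in
/-- Smooth Riemannian metrics on `M`. -/
abbrev Metric : Type _ :=
  ContMDiffRiemannianMetric (𝓡 3) ∞ E3 (fun x : M => TangentSpace (𝓡 3) x)

variable (M) in
/-- Smooth fields of bilinear forms on `M`, i.e. smooth sections of `T^*M ⊗ T^*M`. -/
abbrev BilinField : Type _ :=
  ContMDiffSection (𝓡 3) (E3 →L[ℝ] E3 →L[ℝ] ℝ) ∞
    (fun x : M => TangentSpace (𝓡 3) x →L[ℝ] TangentSpace (𝓡 3) x →L[ℝ] ℝ)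

set_option synthInstance.maxHeartbeats 400000 in
/-- The zero section; a shortcut to the zero of the additive group of sections. -/
instance instZeroBilinField : Zero (BilinField M) :=
  ⟨(inferInstance : AddCommGroup (BilinField M)).zero⟩

/-- `g` is flat: its Riemann tensor vanishes identically. -/
def IsFlat (g : Metric M) : Prop :=
  ∀ e ∈ atlas E3 M, ∀ y ∈ e.target, ∀ i j k l, riemann (chartBilin e g.inner) y i j k l = 0

/-- `g` has harmonic curvature: its Riemann tensor is divergence-free. -/
def HasHarmonicCurvature (g : Metric M) : Prop :=
  ∀ e ∈ atlas E3 M, ∀ y ∈ e.target, ∀ i j k, divRiemann (chartBilin e g.inner) y i j k = 0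

/-- `(g, φ)` is a torsionless Heterotic soliton with parameter `κ`. -/
structure IsTorsionlessSoliton (κ : ℝ) (g : Metric M) (φ : C^∞⟮𝓡 3, M; 𝓘(ℝ, ℝ), ℝ⟯) :
    Prop where
  einstein : ∀ e ∈ atlas E3 M, ∀ y ∈ e.target, ∀ i j,
    einsteinOp κ (chartBilin e g.inner) (chartFun e φ) y i j = 0
  yangMills : ∀ e ∈ atlas E3 M, ∀ y ∈ e.target, ∀ i j k,
    yangMillsOp (chartBilin e g.inner) (chartFun e φ) y i j k = 0
  dilaton : ∀ e ∈ atlas E3 M, ∀ y ∈ e.target,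
    dilatonOp κ (chartBilin e g.inner) (chartFun e φ) y = 0

/-- `(h, ξ)` lies in the kernel of the differential at `(g, φ)` of the three soliton operators:
the derivative at `t = 0` of their values at `(g + t h, φ + t ξ)` vanishes. -/
structure IsInfinitesimalDeformation (κ : ℝ) (g : Metric M) (φ : C^∞⟮𝓡 3, M; 𝓘(ℝ, ℝ), ℝ⟯)
    (h : BilinField M) (ξ : C^∞⟮𝓡 3, M; 𝓘(ℝ, ℝ), ℝ⟯) : Prop where
  symm : ∀ (x : M) (v w : TangentSpace (𝓡 3) x), h x v w = h x w v
  einstein : ∀ e ∈ atlas E3 M, ∀ y ∈ e.target, ∀ i j,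
    HasDerivAt (fun t : ℝ => einsteinOp κ (chartBilin e fun x => g.inner x + t • h x)
      (chartFun e fun x => φ x + t * ξ x) y i j) 0 0
  yangMills : ∀ e ∈ atlas E3 M, ∀ y ∈ e.target, ∀ i j k,
    HasDerivAt (fun t : ℝ => yangMillsOp (chartBilin e fun x => g.inner x + t • h x)
      (chartFun e fun x => φ x + t * ξ x) y i j k) 0 0
  dilaton : ∀ e ∈ atlas E3 M, ∀ y ∈ e.target,
    HasDerivAt (fun t : ℝ => dilatonOp κ (chartBilin e fun x => g.inner x + t • h x)
      (chartFun e fun x => φ x + t * ξ x) y) 0 0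

/-- `(h, ξ)` lies in the kernel of `(h, ξ) ↦ 2 ∇^* h + ξ dφ`, the formal `L²`-adjoint of the
infinitesimal action `v ↦ (L_v g, dφ(v))` of the diffeomorphism group at `(g, φ)`. -/
def IsOrthogonalToOrbit (g : Metric M) (φ : C^∞⟮𝓡 3, M; 𝓘(ℝ, ℝ), ℝ⟯)
    (h : BilinField M) (ξ : C^∞⟮𝓡 3, M; 𝓘(ℝ, ℝ), ℝ⟯) : Prop :=
  ∀ e ∈ atlas E3 M, ∀ y ∈ e.target, ∀ j,
    2 * divBilin (chartBilin e g.inner) (chartBilin e h) y j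
      + chartFun e ξ y * pd j (chartFun e φ) y = 0

/-- The space of essential deformations of `(g, φ)`. -/
def essentialDeformations (κ : ℝ) (g : Metric M) (φ : C^∞⟮𝓡 3, M; 𝓘(ℝ, ℝ), ℝ⟯) :
    Set (BilinField M × C^∞⟮𝓡 3, M; 𝓘(ℝ, ℝ), ℝ⟯) :=
  {p | IsInfinitesimalDeformation κ g φ p.1 p.2 ∧ IsOrthogonalToOrbit g φ p.1 p.2}

end Manifold

end HeteroticSoliton

end

/-!
A torsionless Heterotic soliton with harmonic curvature on a compact three-manifold turns out to be
hyperbolic with constant dilaton, and a Bochner argument excludes its essential deformations.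

*The background.* In dimension three the curvature tensor is encoded by a self-adjoint endomorphism
`T` of the tangent space (`crv`): `Ric = g(tr T - T)`, `R ∘ R = g(tr T² - T²)`, `|R|² = tr T²`, and
the divergence of `R` is the curl of `T`. Harmonicity and the Yang-Mills equation give `R(dφ) = 0`,
so the Einstein equation contracted with `dφ` makes `|dφ|² - ½ e^{2φ}` locally constant
(`pd_energy_eq_zero`); comparing with a maximum of `φ` on a connected component, `φ` is locally
constant (`IsTorsionlessSoliton.eventually_eq`). The remaining equations become
`T + κ T² = ¼ e^{2φ}` and `e^{2φ} = κ tr T²`, so that `κ > 0` and `(T + 1/(2κ))²` is a positive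
constant. Hence each `∇_X T` anticommutes with `T + 1/(2κ)`, while harmonicity makes the trilinear
form `∇T` totally symmetric; these two facts force `∇T = 0` (`dcrv_eq_zero`). Then `T` commutes with
the curvature endomorphisms, which span all skew endomorphisms since `T (1 + κ T)` is invertible.
Therefore `T = -4/κ` and `e^{2φ} = 48/κ` (`crv_eq_smul_one`).

*The deformation.* On this background the linearized Einstein and dilaton equations express the
variation `T'` of the curvature operator through `ξ` and its Hessian, and the linearized Yang-Mills
equation makes `∇T' - dξ ⊗ T` totally symmetric. Commuting covariant derivatives of `ξ` then gives
`dξ = 0`, whence `ξ = 0` and `T' = 0` (`variation_eq_zero`): the curvature remains `-4/κ` to first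
order (`dgam_curl`). Orthogonality to the orbit now says that `h` is divergence-free. With `k = -4/κ`
and `u = tr h`, the field `½ u grad u` has divergence at least `-k u²` (`le_divg_trField`). Once
`u = 0`, the field `h^{jk} (∇^i h_jk - ∇_j h^i_k)` has divergence at least `-k |h|²`
(`le_divg_curlField`). As `-k > 0` and the integral of a divergence over the compact manifold
vanishes (`exists_divg_eq_zero`), first `u = 0` and then `h = 0`.

*Encoding.* Tensors are treated as functions of a chart with values in `3 × 3` matrices; only the
fields entering the divergence theorem need their transformation laws. The path `g + t h` is a
single family of metrics on `ℝ × E3` (`fam`), so the variation of a quantity is its derivative in the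
direction `tt`, which commutes with the coordinate derivatives. For this reason the operators
`dd`, `ddm`, `gam` and `crv` are defined over an arbitrary normed space with three chosen directions.
-/

namespace HeteroticSoliton

/-! ### Directional derivatives of functions and of matrix-valued functions -/

section DirectionalDerivative

variable {X : Type*} [NormedAddCommGroup X] [NormedSpace ℝ X]

/-- The directional derivative of `f` at `x` along the constant vector field `v`. -/
noncomputable def dd (v : X) (f : X → ℝ) (x : X) : ℝ := fderiv ℝ f x v

/-- Smoothness at a point, for scalar functions on a normed space. -/
abbrev Smooth (f : X → ℝ) (x : X) : Prop := ContDiffAt ℝ ∞ f x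

/-- Smoothness at a point of all entries of a matrix-valued function. -/
def SmoothMat (F : X → Matrix (Fin 3) (Fin 3) ℝ) (x : X) : Prop :=
  ∀ a b, Smooth (fun z => F z a b) x

/-- The entrywise directional derivative of a matrix-valued function. -/
noncomputable def ddm (v : X) (F : X → Matrix (Fin 3) (Fin 3) ℝ) (x : X) :
    Matrix (Fin 3) (Fin 3) ℝ :=
  Matrix.of fun a b => dd v (fun z => F z a b) x

variable {v w : X} {f g : X → ℝ} {F K : X → Matrix (Fin 3) (Fin 3) ℝ} {x : X}

@[simp] theorem ddm_apply (a b : Fin 3) : ddm v F x a b = dd v (fun z => F z a b) x := rfl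

theorem Smooth.diff (hf : Smooth f x) : DifferentiableAt ℝ f x :=
  hf.differentiableAt (by simp)

theorem dd_congr (h : f =ᶠ[nhds x] g) : dd v f x = dd v g x := by
  unfold dd; rw [h.fderiv_eq]

theorem dd_const (c : ℝ) : dd v (fun _ => c) x = 0 := by simp [dd]

theorem dd_add (hf : Smooth f x) (hg : Smooth g x) :
    dd v (fun z => f z + g z) x = dd v f x + dd v g x := by
  simp [dd, fderiv_fun_add hf.diff hg.diff]

theorem dd_sub (hf : Smooth f x) (hg : Smooth g x) :
    dd v (fun z => f z - g z) x = dd v f x - dd v g x := by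
  simp [dd, fderiv_fun_sub hf.diff hg.diff]

theorem dd_neg : dd v (fun z => -f z) x = -dd v f x := by
  simp [dd, fderiv_fun_neg]

theorem dd_mul (hf : Smooth f x) (hg : Smooth g x) :
    dd v (fun z => f z * g z) x = dd v f x * g x + f x * dd v g x := by
  simp [dd, fderiv_fun_mul hf.diff hg.diff]; ring

theorem dd_const_mul (c : ℝ) (hf : Smooth f x) :
    dd v (fun z => c * f z) x = c * dd v f x := by
  simp [dd, fderiv_const_mul hf.diff]

theorem dd_sum {ι : Type*} {s : Finset ι} {f : ι → X → ℝ} (hf : ∀ i ∈ s, Smooth (f i) x) :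
    dd v (fun z => ∑ i ∈ s, f i z) x = ∑ i ∈ s, dd v (f i) x := by
  unfold dd
  rw [fderiv_fun_sum fun i hi => (hf i hi).diff]
  simp

theorem Smooth.dd (hf : Smooth f x) : Smooth (dd v f) x := by
  have : ContDiffAt ℝ ∞ (fderiv ℝ f) x := hf.fderiv_right (by simp)
  exact this.clm_apply contDiffAt_const

theorem dd_comm (hf : Smooth f x) : dd v (dd w f) x = dd w (dd v f) x := by
  have hs : IsSymmSndFDerivAt ℝ f x := hf.isSymmSndFDerivAt (by simpa using ENat.LEInfty.out)
  have hd : DifferentiableAt ℝ (fderiv ℝ f) x :=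
    (hf.fderiv_right (m := ∞) (by simp)).differentiableAt (by simp)
  have key : ∀ a b : X, HeteroticSoliton.dd a (HeteroticSoliton.dd b f) x
      = fderiv ℝ (fderiv ℝ f) x a b := by
    intro a b
    have : HeteroticSoliton.dd b f = fun z => fderiv ℝ f z b := rfl
    rw [this]
    simp only [HeteroticSoliton.dd]
    rw [fderiv_clm_apply hd (differentiableAt_const _)]
    simp
  rw [key, key]
  exact hs v w

theorem Smooth.sum' {ι : Type*} {s : Finset ι} {f : ι → X → ℝ}
    (hf : ∀ i ∈ s, Smooth (f i) x) : Smooth (fun z => ∑ i ∈ s, f i z) x :=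
  ContDiffAt.sum hf

theorem Smooth.inv' (hf : Smooth f x) (h0 : f x ≠ 0) : Smooth (fun z => (f z)⁻¹) x :=
  ContDiffAt.inv hf h0

theorem SmoothMat.const (A : Matrix (Fin 3) (Fin 3) ℝ) : SmoothMat (fun _ : X => A) x :=
  fun _ _ => contDiffAt_const

theorem SmoothMat.add (hF : SmoothMat F x) (hK : SmoothMat K x) :
    SmoothMat (fun z => F z + K z) x := fun a b => ContDiffAt.add (hF a b) (hK a b)

theorem SmoothMat.sub (hF : SmoothMat F x) (hK : SmoothMat K x) :
    SmoothMat (fun z => F z - K z) x := fun a b => ContDiffAt.sub (hF a b) (hK a b)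

theorem SmoothMat.smul (hf : Smooth f x) (hK : SmoothMat K x) :
    SmoothMat (fun z => f z • K z) x := fun a b => ContDiffAt.mul hf (hK a b)

theorem SmoothMat.mul (hF : SmoothMat F x) (hK : SmoothMat K x) :
    SmoothMat (fun z => F z * K z) x := by
  intro a b
  simp only [Matrix.mul_apply]
  exact Smooth.sum' fun c _ => ContDiffAt.mul (hF a c) (hK c b)

theorem SmoothMat.transpose (hF : SmoothMat F x) : SmoothMat (fun z => (F z).transpose) x :=
  fun a b => hF b a

theorem SmoothMat.ddm (hF : SmoothMat F x) : SmoothMat (ddm v F) x :=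
  fun a b => Smooth.dd (hF a b)

theorem SmoothMat.trace (hF : SmoothMat F x) : Smooth (fun z => (F z).trace) x := by
  simp only [Matrix.trace, Matrix.diag]
  exact Smooth.sum' fun c _ => hF c c

theorem SmoothMat.det (hF : SmoothMat F x) : Smooth (fun z => (F z).det) x := by
  simp only [Matrix.det_fin_three]
  have h := fun a b => hF a b
  unfold Smooth at *
  have := h 0 0; have := h 0 1; have := h 0 2
  have := h 1 0; have := h 1 1; have := h 1 2
  have := h 2 0; have := h 2 1; have := h 2 2
  fun_prop

theorem SmoothMat.adjugate (hF : SmoothMat F x) : SmoothMat (fun z => (F z).adjugate) x := by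
  have h := fun a b => hF a b
  have := h 0 0; have := h 0 1; have := h 0 2
  have := h 1 0; have := h 1 1; have := h 1 2
  have := h 2 0; have := h 2 1; have := h 2 2
  unfold Smooth at *
  intro a b
  unfold Smooth
  simp only [Matrix.adjugate_fin_three]
  fin_cases a <;> fin_cases b <;> simp <;> fun_prop

theorem SmoothMat.inv (hF : SmoothMat F x) (h0 : (F x).det ≠ 0) :
    SmoothMat (fun z => (F z)⁻¹) x := by
  simp only [Matrix.inv_def, Ring.inverse_eq_inv']
  exact SmoothMat.smul (Smooth.inv' hF.det h0) hF.adjugate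

theorem SmoothMat.eventually_det_ne_zero (hF : SmoothMat F x) (h0 : (F x).det ≠ 0) :
    ∀ᶠ z in nhds x, (F z).det ≠ 0 :=
  (ContDiffAt.continuousAt hF.det).eventually_ne h0

theorem ddm_congr (h : F =ᶠ[nhds x] K) : ddm v F x = ddm v K x := by
  ext a b
  exact dd_congr (h.mono fun z hz => by simp [hz])

theorem ddm_const (A : Matrix (Fin 3) (Fin 3) ℝ) : ddm v (fun _ => A) x = 0 := by
  ext a b; exact dd_const _

theorem ddm_add (hF : SmoothMat F x) (hK : SmoothMat K x) :
    ddm v (fun z => F z + K z) x = ddm v F x + ddm v K x := by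
  ext a b; exact dd_add (hF a b) (hK a b)

theorem ddm_sub (hF : SmoothMat F x) (hK : SmoothMat K x) :
    ddm v (fun z => F z - K z) x = ddm v F x - ddm v K x := by
  ext a b; exact dd_sub (hF a b) (hK a b)

theorem ddm_smul (hf : Smooth f x) (hK : SmoothMat K x) :
    ddm v (fun z => f z • K z) x = dd v f x • K x + f x • ddm v K x := by
  ext a b; exact dd_mul hf (hK a b)

theorem ddm_const_smul (c : ℝ) (hK : SmoothMat K x) :
    ddm v (fun z => c • K z) x = c • ddm v K x := by
  ext a b; exact dd_const_mul c (hK a b)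

theorem ddm_mul (hF : SmoothMat F x) (hK : SmoothMat K x) :
    ddm v (fun z => F z * K z) x = ddm v F x * K x + F x * ddm v K x := by
  ext a b
  simp only [ddm_apply, Matrix.mul_apply, Matrix.add_apply]
  rw [dd_sum fun c _ => ContDiffAt.mul (hF a c) (hK c b), ← Finset.sum_add_distrib]
  exact Finset.sum_congr rfl fun c _ => dd_mul (hF a c) (hK c b)

theorem ddm_transpose : ddm v (fun z => (F z).transpose) x = (ddm v F x).transpose := rfl

theorem ddm_comm (hF : SmoothMat F x) : ddm v (ddm w F) x = ddm w (ddm v F) x := by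
  ext a b; exact dd_comm (hF a b)

theorem dd_trace (hF : SmoothMat F x) :
    dd v (fun z => (F z).trace) x = (ddm v F x).trace := by
  simp only [Matrix.trace, Matrix.diag]
  exact dd_sum fun c _ => hF c c

theorem ddm_inv (hF : SmoothMat F x) (h0 : (F x).det ≠ 0) :
    ddm v (fun z => (F z)⁻¹) x = -((F x)⁻¹ * ddm v F x * (F x)⁻¹) := by
  have h1 : ddm v (fun z => F z * (F z)⁻¹) x = 0 := by
    rw [ddm_congr (K := fun _ => 1), ddm_const]
    filter_upwards [hF.eventually_det_ne_zero h0] with z hz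
    exact Matrix.mul_nonsing_inv _ hz.isUnit
  rw [ddm_mul hF (hF.inv h0)] at h1
  have h2 : (F x)⁻¹ * (ddm v F x * (F x)⁻¹ + F x * ddm v (fun z => (F z)⁻¹) x) = 0 := by
    rw [h1, mul_zero]
  rw [mul_add, ← mul_assoc, ← mul_assoc, Matrix.nonsing_inv_mul _ h0.isUnit, one_mul] at h2
  exact eq_neg_of_add_eq_zero_right h2

theorem dd_det (hF : SmoothMat F x) :
    dd v (fun z => (F z).det) x = ((F x).adjugate * ddm v F x).trace := by
  have h00 := hF 0 0; have h01 := hF 0 1; have h02 := hF 0 2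
  have h10 := hF 1 0; have h11 := hF 1 1; have h12 := hF 1 2
  have h20 := hF 2 0; have h21 := hF 2 1; have h22 := hF 2 2
  have e : (fun z => (F z).det) = fun z => F z 0 0 * (F z 1 1 * F z 2 2 - F z 1 2 * F z 2 1)
      - F z 0 1 * (F z 1 0 * F z 2 2 - F z 1 2 * F z 2 0)
      + F z 0 2 * (F z 1 0 * F z 2 1 - F z 1 1 * F z 2 0) := by
    funext z; rw [Matrix.det_fin_three]; ring
  rw [e, dd_add (ContDiffAt.sub (ContDiffAt.mul h00 (ContDiffAt.sub (h11.mul h22) (h12.mul h21)))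
      (ContDiffAt.mul h01 (ContDiffAt.sub (h10.mul h22) (h12.mul h20))))
      (ContDiffAt.mul h02 (ContDiffAt.sub (h10.mul h21) (h11.mul h20))),
    dd_sub (ContDiffAt.mul h00 (ContDiffAt.sub (h11.mul h22) (h12.mul h21)))
      (ContDiffAt.mul h01 (ContDiffAt.sub (h10.mul h22) (h12.mul h20))),
    dd_mul h00 (ContDiffAt.sub (h11.mul h22) (h12.mul h21)),
    dd_mul h01 (ContDiffAt.sub (h10.mul h22) (h12.mul h20)),
    dd_mul h02 (ContDiffAt.sub (h10.mul h21) (h11.mul h20)),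
    dd_sub (h11.mul h22) (h12.mul h21), dd_sub (h10.mul h22) (h12.mul h20),
    dd_sub (h10.mul h21) (h11.mul h20), dd_mul h11 h22, dd_mul h12 h21, dd_mul h10 h22,
    dd_mul h12 h20, dd_mul h10 h21, dd_mul h11 h20]
  rw [Matrix.trace_fin_three, Matrix.mul_apply, Matrix.mul_apply, Matrix.mul_apply,
    Fin.sum_univ_three, Fin.sum_univ_three, Fin.sum_univ_three, Matrix.adjugate_fin_three]
  simp only [Matrix.of_apply, Matrix.cons_val, ddm_apply]
  ring

end DirectionalDerivative

/-! ### The Levi-Civita connection and its curvature as matrices -/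

section LeviCivita

variable {X : Type*} [NormedAddCommGroup X] [NormedSpace ℝ X]

/-- `G` is a field of nondegenerate symmetric matrices that is smooth on the open set `U`.
Symmetry is asked for everywhere since the component matrices of bilinear forms have it. -/
structure MetricOn (G : X → Matrix (Fin 3) (Fin 3) ℝ) (U : Set X) : Prop where
  isOpen : IsOpen U
  symm : ∀ z, (G z).transpose = G z
  smooth : ∀ z ∈ U, SmoothMat G z
  det_ne_zero : ∀ z ∈ U, (G z).det ≠ 0

/-- The connection matrix `(Γ^l_pj)_{lj}` in the direction `p`, where `v i` plays the role of the
`i`-th coordinate vector. For a family of metrics, `X` is the product of the parameter line with the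
chart. -/
noncomputable def gam (v : Fin 3 → X) (G : X → Matrix (Fin 3) (Fin 3) ℝ) (x : X) (p : Fin 3) :
    Matrix (Fin 3) (Fin 3) ℝ :=
  Matrix.of fun l j => (1 / 2) * ∑ m, (G x)⁻¹ l m *
    (dd (v p) (fun z => G z j m) x + dd (v j) (fun z => G z p m) x
      - dd (v m) (fun z => G z p j) x)

/-- The curvature endomorphism `R_{∂_i,∂_j}` as a matrix. -/
noncomputable def Om (v : Fin 3 → X) (G : X → Matrix (Fin 3) (Fin 3) ℝ) (x : X) (i j : Fin 3) :
    Matrix (Fin 3) (Fin 3) ℝ :=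
  ddm (v i) (fun z => gam v G z j) x - ddm (v j) (fun z => gam v G z i) x
    + (gam v G x i * gam v G x j - gam v G x j * gam v G x i)

/-- The curvature tensor `g(R_{∂_i,∂_j} ∂_k, ∂_l)`. -/
noncomputable def Rm (v : Fin 3 → X) (G : X → Matrix (Fin 3) (Fin 3) ℝ) (x : X)
    (i j k l : Fin 3) : ℝ := (G x * Om v G x i j) l k

/-- Koszul's formula: a symmetric connection is determined by the derivative of the metric. -/
theorem koszul {S : Matrix (Fin 3) (Fin 3) ℝ} (hS : S.transpose = S)
    {Λ D : Fin 3 → Matrix (Fin 3) (Fin 3) ℝ} (hΛ : ∀ p l j, Λ p l j = Λ j l p)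
    (hD : ∀ p, D p = (Λ p).transpose * S + S * Λ p) (p l j : Fin 3) :
    (S * Λ p) l j = (1 / 2) * (D p j l + D j p l - D l p j) := by
  have key : ∀ p l j, (S * Λ p) l j = (S * Λ j) l p := by
    intro p l j
    simp only [Matrix.mul_apply]
    exact Finset.sum_congr rfl fun m _ => by rw [hΛ]
  have hD' : ∀ p a b, D p a b = (S * Λ p) b a + (S * Λ p) a b := by
    intro p a b
    have : (Λ p).transpose * S = (S * Λ p).transpose := by rw [Matrix.transpose_mul, hS]
    rw [hD, this]; rfl
  rw [hD', hD', hD', key j l p, key l j p, key l p j]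
  ring

variable {v : Fin 3 → X} {G : X → Matrix (Fin 3) (Fin 3) ℝ} {U : Set X} {x : X}

theorem MetricOn.mul_inv (hG : MetricOn G U) (hx : x ∈ U) : G x * (G x)⁻¹ = 1 :=
  Matrix.mul_nonsing_inv _ (hG.det_ne_zero x hx).isUnit

theorem MetricOn.inv_mul (hG : MetricOn G U) (hx : x ∈ U) : (G x)⁻¹ * G x = 1 :=
  Matrix.nonsing_inv_mul _ (hG.det_ne_zero x hx).isUnit

theorem MetricOn.apply_comm (hG : MetricOn G U) (z : X) (a b : Fin 3) : G z a b = G z b a := by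
  conv_lhs => rw [← hG.symm z]
  rfl

theorem MetricOn.inv_transpose (hG : MetricOn G U) (z : X) : ((G z)⁻¹).transpose = (G z)⁻¹ := by
  rw [Matrix.transpose_nonsing_inv, hG.symm]

theorem MetricOn.eventually (hG : MetricOn G U) (hx : x ∈ U) : ∀ᶠ z in nhds x, z ∈ U :=
  hG.isOpen.mem_nhds hx

theorem mul_gam (hG : MetricOn G U) (hx : x ∈ U) (p l j : Fin 3) :
    (G x * gam v G x p) l j = (1 / 2) * (ddm (v p) G x j l + ddm (v j) G x p l
      - ddm (v l) G x p j) := by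
  have e : gam v G x p = (G x)⁻¹ * Matrix.of fun l j => (1 / 2) * (ddm (v p) G x j l
      + ddm (v j) G x p l - ddm (v l) G x p j) := by
    ext l j
    simp only [gam, Matrix.mul_apply, Matrix.of_apply, Finset.mul_sum, ddm_apply]
    exact Finset.sum_congr rfl fun m _ => by ring
  rw [e, ← mul_assoc, hG.mul_inv hx, one_mul]
  rfl

theorem gam_symm (hG : MetricOn G U) (x : X) (p l j : Fin 3) :
    gam v G x p l j = gam v G x j l p := by
  simp only [gam, Matrix.of_apply]
  congr 1
  refine Finset.sum_congr rfl fun m _ => ?_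
  have : (fun z => G z p j) = fun z => G z j p := funext fun z => hG.apply_comm z p j
  rw [this]; ring

theorem ddm_symm (hG : ∀ z, (G z).transpose = G z) (w : X) (a b : Fin 3) :
    ddm w G x a b = ddm w G x b a := by
  have : (fun z => G z a b) = fun z => G z b a := funext fun z => by
    conv_lhs => rw [← hG z]
    rfl
  simp only [ddm_apply, this]

/-- The Levi-Civita connection is metric. -/
theorem ddm_metric (hG : MetricOn G U) (hx : x ∈ U) (p : Fin 3) :
    ddm (v p) G x = (gam v G x p).transpose * G x + G x * gam v G x p := by
  have : (gam v G x p).transpose * G x = (G x * gam v G x p).transpose := by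
    rw [Matrix.transpose_mul, hG.symm]
  ext a b
  rw [this, Matrix.add_apply, Matrix.transpose_apply, mul_gam hG hx, mul_gam hG hx,
    ddm_symm hG.symm _ b a, ddm_symm hG.symm (v a) p b]
  rw [ddm_symm hG.symm (v b) p a]
  ring

/-- Uniqueness of the Levi-Civita connection: it is the only torsion-free metric connection. -/
theorem eq_gam (hG : MetricOn G U) (hx : x ∈ U) {Λ : Fin 3 → Matrix (Fin 3) (Fin 3) ℝ}
    (hΛ : ∀ p l j, Λ p l j = Λ j l p)
    (hD : ∀ p, ddm (v p) G x = (Λ p).transpose * G x + G x * Λ p) (p : Fin 3) :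
    Λ p = gam v G x p := by
  have h : G x * Λ p = G x * gam v G x p := by
    ext l j
    rw [koszul (hG.symm x) hΛ hD, mul_gam hG hx]
  have h2 := congrArg (fun M => (G x)⁻¹ * M) h
  simpa only [← mul_assoc, hG.inv_mul hx, one_mul] using h2

theorem smooth_gam (hG : MetricOn G U) (hx : x ∈ U) (p : Fin 3) :
    SmoothMat (fun z => gam v G z p) x := by
  intro l j
  simp only [gam, Matrix.of_apply]
  refine ContDiffAt.mul contDiffAt_const (Smooth.sum' fun m _ => ?_)
  have h := hG.smooth x hx
  exact ContDiffAt.mul (h.inv (hG.det_ne_zero x hx) l m)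
    (ContDiffAt.sub (ContDiffAt.add (h j m).dd (h p m).dd) (h p j).dd)

theorem smooth_Om (hG : MetricOn G U) (hx : x ∈ U) (i j : Fin 3) :
    SmoothMat (fun z => Om v G z i j) x := by
  have h := fun p => smooth_gam (v := v) hG hx p
  exact (((h j).ddm).sub ((h i).ddm)).add (((h i).mul (h j)).sub ((h j).mul (h i)))

theorem Om_antisymm (i j : Fin 3) : Om v G x i j = -Om v G x j i := by
  simp only [Om]; abel

/-- The curvature of a metric connection is skew. -/
theorem Om_skew (hG : MetricOn G U) (hx : x ∈ U) (i j : Fin 3) :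
    (Om v G x i j).transpose * G x + G x * Om v G x i j = 0 := by
  have hs := hG.smooth x hx
  have hg := fun p => smooth_gam (v := v) hG hx p
  have key : ∀ i j, ddm (v i) (ddm (v j) G) x
      = (ddm (v i) (fun z => gam v G z j) x).transpose * G x
        + (gam v G x j).transpose * ((gam v G x i).transpose * G x + G x * gam v G x i)
        + (((gam v G x i).transpose * G x + G x * gam v G x i) * gam v G x j
          + G x * ddm (v i) (fun z => gam v G z j) x) := by
    intro i j
    have e : ddm (v j) G =ᶠ[nhds x]
        fun z => (gam v G z j).transpose * G z + G z * gam v G z j :=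
      (hG.eventually hx).mono fun z hz => ddm_metric hG hz j
    rw [ddm_congr e, ddm_add ((hg j).transpose.mul hs) (hs.mul (hg j)),
      ddm_mul (hg j).transpose hs, ddm_mul hs (hg j), ddm_transpose, ddm_metric hG hx i]
  have h := ddm_comm (v := v i) (w := v j) hs
  rw [key i j, key j i, ← sub_eq_zero] at h
  rw [← h, Om]
  simp only [Matrix.transpose_add, Matrix.transpose_sub, Matrix.transpose_mul]
  noncomm_ring

/-- The first Bianchi identity. -/
theorem Om_bianchi (hG : MetricOn G U) (i j k l : Fin 3) :
    Om v G x i j l k + Om v G x j k l i + Om v G x k i l j = 0 := by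
  have hg := fun x p l j => gam_symm (v := v) hG x p l j
  have e : ∀ w p l j, ddm w (fun z => gam v G z p) x l j = ddm w (fun z => gam v G z j) x l p := by
    intro w p l j
    simp only [ddm_apply, hg _ p l j]
  have e2 : ∀ p q r, (gam v G x p * gam v G x q) l r = (gam v G x p * gam v G x r) l q := by
    intro p q r
    simp only [Matrix.mul_apply]
    exact Finset.sum_congr rfl fun m _ => by rw [hg x q m r]
  simp only [Om, Matrix.add_apply, Matrix.sub_apply]
  rw [e (v i) j l k, e (v j) k l i, e (v k) i l j, e2 i j k, e2 j k i, e2 k i j]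
  ring

theorem Rm_antisymm_left (i j k l : Fin 3) : Rm v G x i j k l = -Rm v G x j i k l := by
  simp only [Rm, Om_antisymm i j, mul_neg, Matrix.neg_apply]

theorem Rm_antisymm_right (hG : MetricOn G U) (hx : x ∈ U) (i j k l : Fin 3) :
    Rm v G x i j k l = -Rm v G x i j l k := by
  have h := congrFun (congrFun (Om_skew (v := v) hG hx i j) l) k
  have e : (Om v G x i j).transpose * G x = (G x * Om v G x i j).transpose := by
    rw [Matrix.transpose_mul, hG.symm]
  rw [e] at h
  simp only [Rm]
  simp only [Matrix.add_apply, Matrix.transpose_apply, Matrix.zero_apply] at h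
  linarith

theorem Rm_bianchi (hG : MetricOn G U) (i j k l : Fin 3) :
    Rm v G x i j k l + Rm v G x j k i l + Rm v G x k i j l = 0 := by
  simp only [Rm, Matrix.mul_apply, ← Finset.sum_add_distrib]
  refine Finset.sum_eq_zero fun m _ => ?_
  rw [← mul_add, ← mul_add, Om_bianchi hG, mul_zero]

/-- The pair symmetry of a tensor with the symmetries of a curvature tensor. -/
theorem pair_symm {R : Fin 3 → Fin 3 → Fin 3 → Fin 3 → ℝ}
    (h1 : ∀ i j k l, R i j k l = -R j i k l) (h2 : ∀ i j k l, R i j k l = -R i j l k)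
    (h3 : ∀ i j k l, R i j k l + R j k i l + R k i j l = 0) (i j k l : Fin 3) :
    R i j k l = R k l i j := by
  have a1 := h3 i j k l
  have a2 := h3 j k l i
  have a3 := h3 k l i j
  have a4 := h3 l i j k
  have b1 := h2 j k i l
  have b2 := h1 j k l i
  have b3 := h2 k l j i
  have b4 := h2 l j k i
  have b5 := h1 l j k i
  have b6 := h1 l j i k
  have b7 := h2 l i k j
  have b8 := h1 l i k j
  have b9 := h2 i k l j
  have b10 := h1 i k l j
  have b11 := h2 i j l k
  have b12 := h1 k i j l
  have b13 := h2 k i j l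
  have b14 := h1 i k j l
  have b15 := h2 j l i k
  have b16 := h1 j l i k
  linarith

theorem Rm_pair_symm (hG : MetricOn G U) (hx : x ∈ U) (i j k l : Fin 3) :
    Rm v G x i j k l = Rm v G x k l i j :=
  pair_symm (R := Rm v G x) Rm_antisymm_left (Rm_antisymm_right hG hx) (Rm_bianchi hG) i j k l

end LeviCivita

/-! ### The curvature operator of a three-dimensional metric -/

/-- The Levi-Civita symbol. -/
def eps (i j k : Fin 3) : ℝ :=
  ![![![0, 0, 0], ![0, 0, 1], ![0, -1, 0]], ![![0, 0, -1], ![0, 0, 0], ![1, 0, 0]],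
    ![![0, 1, 0], ![-1, 0, 0], ![0, 0, 0]]] i j k

theorem eps_swap (i j k : Fin 3) : eps j i k = -eps i j k := by
  fin_cases i <;> fin_cases j <;> fin_cases k <;> simp [eps]

/-- An alternating array in two indices is dual to a vector. -/
theorem eq_sum_eps {f : Fin 3 → Fin 3 → ℝ} (hf : ∀ i j, f i j = -f j i) (i j : Fin 3) :
    f i j = ∑ a, eps i j a * f (a + 1) (a + 2) := by
  have h0 := hf 0 0
  have h1 := hf 1 1
  have h2 := hf 2 2
  have h3 := hf 0 1
  have h4 := hf 0 2
  have h5 := hf 1 2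
  fin_cases i <;> fin_cases j <;> simp [eps, Fin.sum_univ_three] <;> linarith

theorem sum_eps_det (M : Matrix (Fin 3) (Fin 3) ℝ) (i j k : Fin 3) :
    ∑ a, ∑ b, ∑ c, eps a b c * M i a * M j b * M k c = M.det * eps i j k := by
  rw [Matrix.det_fin_three]
  fin_cases i <;> fin_cases j <;> fin_cases k <;> simp [eps, Fin.sum_univ_three] <;> ring

theorem sum_eps_eps_adjugate (M : Matrix (Fin 3) (Fin 3) ℝ) (j p k q : Fin 3) :
    ∑ a, ∑ b, M.adjugate a b * eps a j p * eps b k q = M k j * M q p - M k p * M q j := by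
  rw [Matrix.adjugate_fin_three]
  fin_cases j <;> fin_cases k <;> fin_cases p <;> fin_cases q <;>
    simp [eps, Fin.sum_univ_three] <;> ring

theorem sum_eps_eps_mul_mul (M : Matrix (Fin 3) (Fin 3) ℝ) (w w' : Fin 3 → ℝ) :
    ∑ j, ∑ j', ∑ k, ∑ k', M j j' * M k k' * (∑ q, eps j k q * w q) * (∑ q, eps j' k' q * w' q)
      = 2 * ∑ q, ∑ q', M.adjugate q' q * w q * w' q' := by
  rw [Matrix.adjugate_fin_three]
  simp [eps, Fin.sum_univ_three]
  ring

/-- A linear map acts on the Levi-Civita symbol as a derivation, through its trace. -/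
theorem sum_eps_derivation (W : Matrix (Fin 3) (Fin 3) ℝ) (i j a : Fin 3) :
    ∑ m, (W m i * eps m j a + W m j * eps i m a + W m a * eps i j m) = W.trace * eps i j a := by
  rw [Matrix.trace_fin_three]
  fin_cases i <;> fin_cases j <;> fin_cases a <;> simp [eps, Fin.sum_univ_three] <;> try ring

section Curvature

variable {X : Type*} [NormedAddCommGroup X] [NormedSpace ℝ X]

/-- The matrix of the curvature form on `Λ²`, identified with the tangent space through the
Levi-Civita symbol: the index `p : Fin 3` stands for the pair `(p + 1, p + 2)`, cyclically. The order
of the last pair makes it positive on the round sphere. -/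
noncomputable def crvA (v : Fin 3 → X) (G : X → Matrix (Fin 3) (Fin 3) ℝ) (x : X) :
    Matrix (Fin 3) (Fin 3) ℝ :=
  Matrix.of fun p q => Rm v G x (p + 1) (p + 2) (q + 2) (q + 1)

/-- The curvature operator as an endomorphism of the tangent space: on a unit vector normal to a
plane it measures the sectional curvature of that plane. -/
noncomputable def crv (v : Fin 3 → X) (G : X → Matrix (Fin 3) (Fin 3) ℝ) (x : X) :
    Matrix (Fin 3) (Fin 3) ℝ :=
  (G x).det⁻¹ • (crvA v G x * G x)

variable {v : Fin 3 → X} {G : X → Matrix (Fin 3) (Fin 3) ℝ} {U : Set X} {x : X}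

theorem crvA_symm (hG : MetricOn G U) (hx : x ∈ U) : (crvA v G x).transpose = crvA v G x := by
  ext p q
  simp only [Matrix.transpose_apply, crvA, Matrix.of_apply]
  rw [Rm_pair_symm hG hx, Rm_antisymm_left, Rm_antisymm_right hG hx, neg_neg]

theorem Rm_eq_sum_eps (hG : MetricOn G U) (hx : x ∈ U) (i j k l : Fin 3) :
    Rm v G x i j k l = -∑ b, eps k l b * ∑ a, eps i j a * crvA v G x a b := by
  rw [eq_sum_eps (f := Rm v G x i j) (Rm_antisymm_right hG hx i j) k l, ← Finset.sum_neg_distrib]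
  refine Finset.sum_congr rfl fun b _ => ?_
  rw [eq_sum_eps (f := fun i j => Rm v G x i j (b + 1) (b + 2))
    (fun i j => Rm_antisymm_left i j _ _) i j, ← mul_neg, ← Finset.sum_neg_distrib]
  congr 1
  refine Finset.sum_congr rfl fun a _ => ?_
  rw [Rm_antisymm_right hG hx]
  simp [crvA]

theorem crvA_eq (hG : MetricOn G U) (hx : x ∈ U) :
    crvA v G x = (G x).det • (crv v G x * (G x)⁻¹) := by
  rw [crv, Matrix.smul_mul, smul_smul, mul_inv_cancel₀ (hG.det_ne_zero x hx), one_smul, mul_assoc,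
    hG.mul_inv hx, mul_one]

/-- In dimension three the curvature operator determines the curvature tensor. -/
theorem Om_eq_sum_eps (hG : MetricOn G U) (hx : x ∈ U) (i j l k : Fin 3) :
    Om v G x i j l k
      = ∑ a, ∑ c, ∑ d, eps i j a * eps l c d * crv v G x a d * G x c k := by
  set Q : Matrix (Fin 3) (Fin 3) ℝ :=
    Matrix.of fun l k => ∑ a, ∑ c, ∑ d, eps i j a * eps l c d * crv v G x a d * G x c k with hQ
  have hd := hG.det_ne_zero x hx
  have key : G x * Om v G x i j = G x * Q := by
    ext l k
    have e1 : (G x * Om v G x i j) l k = Rm v G x i j k l := rfl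
    rw [e1, Rm_eq_sum_eps hG hx]
    have e2 : ∀ e, ∑ m, ∑ c, ∑ d, eps m c d * G x l m * G x k c * G x e d
        = (G x).det * eps l k e := fun e => sum_eps_det (G x) l k e
    have e3 : (G x * Q) l k = ∑ a, ∑ e, eps i j a * (G x).det⁻¹ * crvA v G x a e *
        ∑ m, ∑ c, ∑ d, eps m c d * G x l m * G x k c * G x e d := by
      simp only [hQ, Matrix.mul_apply, crv, Matrix.of_apply, Matrix.smul_apply, smul_eq_mul]
      simp only [Fin.sum_univ_three, hG.apply_comm x k]
      ring
    rw [e3]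
    simp only [e2]
    rw [Finset.sum_comm, ← Finset.sum_neg_distrib]
    refine Finset.sum_congr rfl fun b _ => ?_
    rw [Finset.mul_sum, ← Finset.sum_neg_distrib]
    refine Finset.sum_congr rfl fun a _ => ?_
    rw [eps_swap k l b]
    field_simp
  have h2 := congrArg (fun M => (G x)⁻¹ * M) key
  simp only [← mul_assoc, hG.inv_mul hx, one_mul] at h2
  rw [h2]; rfl

theorem smooth_Rm (hG : MetricOn G U) (hx : x ∈ U) (i j k l : Fin 3) :
    Smooth (fun z => Rm v G z i j k l) x :=
  ((hG.smooth x hx).mul (smooth_Om hG hx i j)) l k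

theorem smooth_crvA (hG : MetricOn G U) (hx : x ∈ U) : SmoothMat (crvA v G) x :=
  fun _ _ => smooth_Rm hG hx _ _ _ _

theorem smooth_crv (hG : MetricOn G U) (hx : x ∈ U) : SmoothMat (crv v G) x :=
  SmoothMat.smul (Smooth.inv' (hG.smooth x hx).det (hG.det_ne_zero x hx))
    ((smooth_crvA hG hx).mul (hG.smooth x hx))

/-- The covariant derivative of the curvature operator in the direction `p`. -/
noncomputable def dcrv (v : Fin 3 → X) (G : X → Matrix (Fin 3) (Fin 3) ℝ) (x : X) (p : Fin 3) :
    Matrix (Fin 3) (Fin 3) ℝ :=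
  ddm (v p) (crv v G) x + (gam v G x p * crv v G x - crv v G x * gam v G x p)

theorem dd_det_metric (hG : MetricOn G U) (hx : x ∈ U) (p : Fin 3) :
    dd (v p) (fun z => (G z).det) x = 2 * (gam v G x p).trace * (G x).det := by
  have hd := hG.det_ne_zero x hx
  have e : (G x).adjugate = (G x).det • (G x)⁻¹ := by
    rw [Matrix.inv_def, smul_smul, Ring.inverse_eq_inv', mul_inv_cancel₀ hd, one_smul]
  rw [dd_det (hG.smooth x hx), ddm_metric hG hx, e, Matrix.smul_mul, Matrix.trace_smul, mul_add,
    Matrix.trace_add, ← mul_assoc _ (G x), hG.inv_mul hx, one_mul, ← mul_assoc,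
    Matrix.trace_mul_comm, ← mul_assoc, hG.mul_inv hx, one_mul, Matrix.trace_transpose]
  simp; ring

theorem ddm_inv_metric (hG : MetricOn G U) (hx : x ∈ U) (p : Fin 3) :
    ddm (v p) (fun z => (G z)⁻¹) x
      = -((G x)⁻¹ * (gam v G x p).transpose + gam v G x p * (G x)⁻¹) := by
  rw [ddm_inv (hG.smooth x hx) (hG.det_ne_zero x hx), ddm_metric hG hx, mul_add, add_mul,
    ← mul_assoc, mul_assoc (_ * _) (G x), hG.mul_inv hx, mul_one, ← mul_assoc, hG.inv_mul hx,
    one_mul]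

/-- The derivative of `crvA`, which is a contravariant tensor density of weight two, in terms of the
covariant derivative of the curvature operator. -/
theorem ddm_crvA (hG : MetricOn G U) (hx : x ∈ U) (p : Fin 3) :
    ddm (v p) (crvA v G) x = (2 * (gam v G x p).trace) • crvA v G x
      - gam v G x p * crvA v G x - crvA v G x * (gam v G x p).transpose
      + (G x).det • (dcrv v G x p * (G x)⁻¹) := by
  have hs := hG.smooth x hx
  have hi := hs.inv (hG.det_ne_zero x hx)
  have hT := smooth_crv (v := v) hG hx
  have e : crvA v G =ᶠ[nhds x] fun z => (G z).det • (crv v G z * (G z)⁻¹) :=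
    (hG.eventually hx).mono fun z hz => crvA_eq hG hz
  rw [ddm_congr e, ddm_smul hs.det (hT.mul hi), ddm_mul hT hi, dd_det_metric hG hx,
    ddm_inv_metric hG hx, crvA_eq hG hx, dcrv]
  simp only [Matrix.smul_mul, Matrix.mul_smul, smul_smul, mul_add, add_mul, sub_mul, mul_neg,
    smul_add, smul_sub, smul_neg, mul_assoc]
  abel

end Curvature

/-! ### The soliton operators in terms of the curvature operator -/

/-- The coordinate vectors of the chart. -/
noncomputable def ee (i : Fin 3) : E3 := EuclideanSpace.single i 1

section Operators

variable {G : E3 → Matrix (Fin 3) (Fin 3) ℝ} {U : Set E3} {y : E3} {f : E3 → ℝ}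

theorem gam_apply (p l j : Fin 3) : gam ee G y p l j = christoffel G y l p j := rfl

theorem riemannUp_eq (i j k l : Fin 3) : riemannUp G y i j k l = Om ee G y i j l k := by
  simp only [riemannUp, Om, Matrix.add_apply, Matrix.sub_apply, Matrix.mul_apply,
    Finset.sum_sub_distrib]
  rfl

theorem riemann_eq (hG : MetricOn G U) (i j k l : Fin 3) :
    riemann G y i j k l = Rm ee G y i j k l := by
  simp only [riemann, Rm, riemannUp_eq, Matrix.mul_apply]
  exact Finset.sum_congr rfl fun m _ => by rw [hG.apply_comm y m l, mul_comm]

theorem inv_apply_eq (a b : Fin 3) :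
    (G y)⁻¹ a b = (G y).det⁻¹ * (G y).adjugate a b := by
  rw [Matrix.inv_def, Ring.inverse_eq_inv', Matrix.smul_apply, smul_eq_mul]

theorem MetricOn.adjugate_inv (hG : MetricOn G U) (hy : y ∈ U) :
    ((G y)⁻¹).adjugate = (G y).det⁻¹ • G y := by
  have hd := hG.det_ne_zero y hy
  have h : (G y)⁻¹ * ((G y)⁻¹).adjugate = (G y).det⁻¹ • 1 := by
    rw [Matrix.mul_adjugate, Matrix.det_nonsing_inv, Ring.inverse_eq_inv']
  have h2 := congrArg (fun M => G y * M) h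
  simpa only [← mul_assoc, hG.mul_inv hy, one_mul, Matrix.mul_smul, mul_one] using h2

theorem ricci_eq (hG : MetricOn G U) (hy : y ∈ U) (i j : Fin 3) :
    ricci G y i j
      = (G y * ((crv ee G y).trace • (1 : Matrix (Fin 3) (Fin 3) ℝ) - crv ee G y)) i j := by
  have h1 : ricci G y i j = (G y).det⁻¹ * ∑ a, ∑ b, crvA ee G y a b *
      ∑ p, ∑ q, (G y).adjugate p q * eps p i a * eps q j b := by
    simp only [ricci, riemann_eq hG, Rm_eq_sum_eps hG hy, inv_apply_eq]
    simp only [fun q b => eps_swap q j b, Fin.sum_univ_three]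
    ring
  rw [h1]
  simp only [sum_eps_eps_adjugate]
  rw [crv, mul_sub, Matrix.mul_smul, mul_one, Matrix.sub_apply, Matrix.smul_apply,
    Matrix.trace_smul, Matrix.mul_smul, Matrix.smul_apply]
  simp only [Matrix.trace, Matrix.diag, Matrix.mul_apply, Fin.sum_univ_three, smul_eq_mul]
  simp only [hG.apply_comm y 1 0, hG.apply_comm y 2 0, hG.apply_comm y 2 1, hG.apply_comm y i 0,
    hG.apply_comm y i 1, hG.apply_comm y i 2, hG.apply_comm y j 0, hG.apply_comm y j 1,
    hG.apply_comm y j 2, hG.apply_comm y j i]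
  have hA : ∀ a b, crvA ee G y a b = crvA ee G y b a := fun a b =>
    congrFun (congrFun (crvA_symm hG hy) b) a
  rw [hA 1 0, hA 2 0, hA 2 1]
  ring

theorem riemann_contract (hG : MetricOn G U) (hy : y ∈ U) (a i b i' : Fin 3) :
    ∑ j, ∑ j', ∑ k, ∑ k', (G y)⁻¹ j j' * (G y)⁻¹ k k' * riemann G y a i j k
        * riemann G y b i' j' k'
      = 2 * (G y).det⁻¹ * ∑ q, ∑ q', G y q' q * (∑ p, eps a i p * crvA ee G y p q)
          * (∑ p, eps b i' p * crvA ee G y p q') := by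
  simp only [riemann_eq hG, Rm_eq_sum_eps hG hy]
  have := sum_eps_eps_mul_mul (G y)⁻¹ (fun q => ∑ p, eps a i p * crvA ee G y p q)
    (fun q => ∑ p, eps b i' p * crvA ee G y p q)
  simp only [mul_neg, neg_mul, neg_neg]
  rw [this, hG.adjugate_inv hy]
  simp only [Matrix.smul_apply, smul_eq_mul]
  rw [mul_assoc 2]
  congr 1
  rw [Finset.mul_sum]
  refine Finset.sum_congr rfl fun q _ => ?_
  rw [Finset.mul_sum]
  exact Finset.sum_congr rfl fun q' _ => by ring

theorem riemannCirc_eq (hG : MetricOn G U) (hy : y ∈ U) (a b : Fin 3) :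
    riemannCirc G y a b = (G y * ((crv ee G y * crv ee G y).trace •
      (1 : Matrix (Fin 3) (Fin 3) ℝ) - crv ee G y * crv ee G y)) a b := by
  have h1 : riemannCirc G y a b = (1 / 2) * ∑ i, ∑ i', (G y)⁻¹ i i' *
      ∑ j, ∑ j', ∑ k, ∑ k', (G y)⁻¹ j j' * (G y)⁻¹ k k' * riemann G y a i j k
        * riemann G y b i' j' k' := by
    simp only [riemannCirc, Finset.mul_sum, mul_assoc]
  simp only [riemann_contract hG hy] at h1
  have h2 : riemannCirc G y a b = (G y).det⁻¹ * (G y).det⁻¹ *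
      ∑ p, ∑ p', (crvA ee G y * G y * (crvA ee G y).transpose) p p' *
        ∑ i, ∑ i', (G y).adjugate i i' * eps i a p * eps i' b p' := by
    rw [h1]
    simp only [inv_apply_eq, fun i p => eps_swap a i p, fun i p => eps_swap b i p]
    simp only [Matrix.mul_apply, Matrix.transpose_apply, Fin.sum_univ_three, hG.apply_comm y 1 0,
      hG.apply_comm y 2 0, hG.apply_comm y 2 1]
    ring
  rw [h2, crvA_symm hG hy]
  simp only [sum_eps_eps_adjugate]
  set Q := crvA ee G y * G y * crvA ee G y with hQ
  have hQs : ∀ p p', Q p p' = Q p' p := by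
    intro p p'
    have : Q.transpose = Q := by
      rw [hQ, Matrix.transpose_mul, Matrix.transpose_mul, crvA_symm hG hy, hG.symm, mul_assoc]
    exact congrFun (congrFun this p') p
  have e : crv ee G y * crv ee G y = ((G y).det⁻¹ * (G y).det⁻¹) • (Q * G y) := by
    rw [crv, Matrix.smul_mul, Matrix.mul_smul, smul_smul, hQ]
    simp only [mul_assoc]
  rw [e, mul_sub, Matrix.mul_smul, mul_one, Matrix.sub_apply, Matrix.smul_apply,
    Matrix.trace_smul, Matrix.mul_smul, Matrix.smul_apply]
  simp only [Matrix.trace, Matrix.diag, Matrix.mul_apply, Fin.sum_univ_three, smul_eq_mul]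
  rw [hQs 1 0, hQs 2 0, hQs 2 1]
  simp only [hG.apply_comm y 1 0, hG.apply_comm y 2 0, hG.apply_comm y 2 1, hG.apply_comm y a 0,
    hG.apply_comm y a 1, hG.apply_comm y a 2, hG.apply_comm y b 0, hG.apply_comm y b 1,
    hG.apply_comm y b 2, hG.apply_comm y b a]
  ring

theorem riemannNormSq_eq (hG : MetricOn G U) (hy : y ∈ U) :
    riemannNormSq G y = (crv ee G y * crv ee G y).trace := by
  have h1 : riemannNormSq G y = (1 / 4) * ∑ i, ∑ i', ∑ j, ∑ j', (G y)⁻¹ i i' * (G y)⁻¹ j j' *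
      ∑ k, ∑ k', ∑ l, ∑ l', (G y)⁻¹ k k' * (G y)⁻¹ l l' * riemann G y i j k l
        * riemann G y i' j' k' l' := by
    simp only [riemannNormSq, Finset.mul_sum, mul_assoc]
  simp only [riemann_contract hG hy] at h1
  have h2 : riemannNormSq G y = (1 / 2) * (G y).det⁻¹ * ∑ q, ∑ q', G y q' q *
      ∑ i, ∑ i', ∑ j, ∑ j', (G y)⁻¹ i i' * (G y)⁻¹ j j' * (∑ p, eps i j p * crvA ee G y p q)
        * (∑ p, eps i' j' p * crvA ee G y p q') := by
    rw [h1]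
    have comm : ∀ F : Fin 3 → Fin 3 → Fin 3 → Fin 3 → Fin 3 → Fin 3 → ℝ,
        ∑ i, ∑ i', ∑ j, ∑ j', ∑ q, ∑ q', F i i' j j' q q'
          = ∑ q, ∑ q', ∑ i, ∑ i', ∑ j, ∑ j', F i i' j j' q q' := by
      intro F
      have s1 : ∀ H : Fin 3 → Fin 3 → Fin 3 → Fin 3 → Fin 3 → ℝ,
          ∑ i, ∑ i', ∑ j, ∑ j', ∑ q, H i i' j j' q = ∑ q, ∑ i, ∑ i', ∑ j, ∑ j', H i i' j j' q := by
        intro H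
        have t1 : ∀ i i' j, ∑ j', ∑ q, H i i' j j' q = ∑ q, ∑ j', H i i' j j' q :=
          fun _ _ _ => Finset.sum_comm
        have t2 : ∀ i i', ∑ j, ∑ q, ∑ j', H i i' j j' q = ∑ q, ∑ j, ∑ j', H i i' j j' q :=
          fun _ _ => Finset.sum_comm
        have t3 : ∀ i, ∑ i', ∑ q, ∑ j, ∑ j', H i i' j j' q = ∑ q, ∑ i', ∑ j, ∑ j', H i i' j j' q :=
          fun _ => Finset.sum_comm
        simp only [t1, t2, t3]
        exact Finset.sum_comm
      rw [s1]
      exact Finset.sum_congr rfl fun q _ => s1 _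
    have pull : ∀ (c : ℝ) (H : Fin 3 → Fin 3 → ℝ), c * ∑ q, ∑ q', H q q' = ∑ q, ∑ q', c * H q q' :=
      fun c H => by simp only [Finset.mul_sum]
    have pull4 : ∀ (c : ℝ) (H : Fin 3 → Fin 3 → Fin 3 → Fin 3 → ℝ),
        c * ∑ i, ∑ i', ∑ j, ∑ j', H i i' j j' = ∑ i, ∑ i', ∑ j, ∑ j', c * H i i' j j' :=
      fun c H => by simp only [Finset.mul_sum]
    simp only [pull4, pull]
    rw [comm]
    refine Finset.sum_congr rfl fun q _ => Finset.sum_congr rfl fun q' _ => ?_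
    refine Finset.sum_congr rfl fun i _ => Finset.sum_congr rfl fun i' _ =>
      Finset.sum_congr rfl fun j _ => Finset.sum_congr rfl fun j' _ => ?_
    ring
  simp only [sum_eps_eps_mul_mul] at h2
  rw [h2, hG.adjugate_inv hy, crv, Matrix.smul_mul, Matrix.mul_smul, smul_smul, Matrix.trace_smul]
  have hA : ∀ a b, crvA ee G y a b = crvA ee G y b a := fun a b =>
    congrFun (congrFun (crvA_symm hG hy) b) a
  simp only [Matrix.trace, Matrix.diag, Matrix.mul_apply, Fin.sum_univ_three, smul_eq_mul,
    Matrix.smul_apply, hA 1 0, hA 2 0, hA 2 1, hG.apply_comm y 1 0, hG.apply_comm y 2 0,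
    hG.apply_comm y 2 1]
  ring

end Operators

section Operators

variable {G : E3 → Matrix (Fin 3) (Fin 3) ℝ} {U : Set E3} {y : E3} {f : E3 → ℝ}

theorem covRiemann_eq (hG : MetricOn G U) (hy : y ∈ U) (p i j k l : Fin 3) :
    covRiemann G y p i j k l = -((G y).det * ∑ b, eps k l b * ∑ a, eps i j a *
      (dcrv ee G y p * (G y)⁻¹) a b) := by
  have hA := smooth_crvA (v := ee) hG hy
  have h1 : pd p (fun z => riemann G z i j k l) y
      = -∑ b, eps k l b * ∑ a, eps i j a * ddm (ee p) (crvA ee G) y a b := by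
    have e : (fun z => riemann G z i j k l) =ᶠ[nhds y]
        fun z => -∑ b, eps k l b * ∑ a, eps i j a * crvA ee G z a b :=
      (hG.eventually hy).mono fun z hz => by
        simp only [riemann_eq hG, Rm_eq_sum_eps hG hz]
    change dd (ee p) _ y = _
    have hs : ∀ b, Smooth (fun z => ∑ a, eps i j a * crvA ee G z a b) y := fun b =>
      Smooth.sum' fun a _ => ContDiffAt.mul contDiffAt_const (hA a b)
    rw [dd_congr e, dd_neg, dd_sum fun b _ => ContDiffAt.mul contDiffAt_const (hs b)]
    congr 1
    refine Finset.sum_congr rfl fun b _ => ?_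
    rw [dd_const_mul _ (hs b), dd_sum fun a _ => ContDiffAt.mul contDiffAt_const (hA a b)]
    congr 1
    exact Finset.sum_congr rfl fun a _ => dd_const_mul _ (hA a b)
  have D := sum_eps_derivation (gam ee G y p) i j
  have E := sum_eps_derivation (gam ee G y p) k l
  have D0 := D 0; have D1 := D 1; have D2 := D 2
  have E0 := E 0; have E1 := E 1; have E2 := E 2
  rw [covRiemann, h1, ddm_crvA hG hy]
  simp only [← gam_apply, riemann_eq hG, Rm_eq_sum_eps hG hy]
  set W := gam ee G y p
  set A := crvA ee G y
  set M := dcrv ee G y p * (G y)⁻¹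
  generalize (G y).det = d
  simp only [Matrix.add_apply, Matrix.sub_apply, Matrix.smul_apply, smul_eq_mul, Matrix.mul_apply,
    Matrix.transpose_apply, Fin.sum_univ_three] at *
  linear_combination
    (A 0 0 * eps k l 0 + A 0 1 * eps k l 1 + A 0 2 * eps k l 2) * D0
    + (A 1 0 * eps k l 0 + A 1 1 * eps k l 1 + A 1 2 * eps k l 2) * D1
    + (A 2 0 * eps k l 0 + A 2 1 * eps k l 1 + A 2 2 * eps k l 2) * D2
    + (A 0 0 * eps i j 0 + A 1 0 * eps i j 1 + A 2 0 * eps i j 2) * E0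
    + (A 0 1 * eps i j 0 + A 1 1 * eps i j 1 + A 2 1 * eps i j 2) * E1
    + (A 0 2 * eps i j 0 + A 1 2 * eps i j 1 + A 2 2 * eps i j 2) * E2

/-- The divergence of the curvature tensor is the curl of the curvature operator. -/
theorem divRiemann_eq (hG : MetricOn G U) (hy : y ∈ U) (i j k : Fin 3) :
    divRiemann G y i j k = (G y).det * ∑ b, eps j k b * ∑ p, ∑ q, ∑ a, (G y)⁻¹ p q * eps q i a *
      (dcrv ee G y p * (G y)⁻¹) a b := by
  simp only [divRiemann, covRiemann_eq hG hy, Fin.sum_univ_three]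
  ring

theorem riemannGrad_eq (hG : MetricOn G U) (hy : y ∈ U) (i j k : Fin 3) :
    riemannGrad G f y i j k = -((G y).det * ∑ b, eps j k b * ∑ p, ∑ q, ∑ a, (G y)⁻¹ p q *
      eps q i a * (pd p f y • (crv ee G y * (G y)⁻¹)) a b) := by
  simp only [riemannGrad, riemann_eq hG, Rm_eq_sum_eps hG hy, crvA_eq hG hy, Matrix.smul_apply,
    smul_eq_mul]
  simp only [Fin.sum_univ_three]
  ring

/-- A curl vanishes precisely when the array is symmetric. -/
theorem symm_of_sum_eps {S : Matrix (Fin 3) (Fin 3) ℝ} {c : ℝ} (hc : c ≠ 0)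
    {M : Fin 3 → Matrix (Fin 3) (Fin 3) ℝ}
    (h : ∀ i j k, c * ∑ b, eps j k b * ∑ p, ∑ q, ∑ a, S p q * eps q i a * M p a b = 0)
    (q a b : Fin 3) : ∑ p, S p q * M p a b = ∑ p, S p a * M p q b := by
  have h1 : ∀ i b, ∑ p, ∑ q, ∑ a, S p q * eps q i a * M p a b = 0 := by
    intro i b
    have h2 := h i (b + 1) (b + 2)
    rw [mul_eq_zero, or_iff_right hc] at h2
    fin_cases b <;> simpa [eps, Fin.sum_univ_three] using h2
  have h0 := h1 0 b
  have h1' := h1 1 b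
  have h2 := h1 2 b
  simp [eps, Fin.sum_univ_three] at h0 h1' h2
  fin_cases q <;> fin_cases a <;> simp only [Fin.sum_univ_three, Fin.zero_eta, Fin.mk_one,
    Fin.reduceFinMk] <;> linarith

end Operators

/-- A totally symmetric trilinear form, each of whose slices anticommutes with an invertible
operator, vanishes: the operator changes sign when it moves from one argument to another, and an odd
number of moves brings it back. -/
theorem eq_zero_of_symm_of_anticomm {c : Fin 3 → Fin 3 → Fin 3 → ℝ}
    (h12 : ∀ i j k, c i j k = c j i k) (h23 : ∀ i j k, c i j k = c i k j)
    {T : Matrix (Fin 3) (Fin 3) ℝ} {r : ℝ} (hr : r ≠ 0) (hT : T * T = r • 1)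
    (h : ∀ i j k, ∑ m, T j m * c i m k + ∑ m, T k m * c i j m = 0) (i j k : Fin 3) :
    c i j k = 0 := by
  have a1 : ∀ i j k, ∑ m, T j m * c i m k = -∑ m, T k m * c i j m := fun i j k => by
    linarith [h i j k]
  have key : ∀ i j k, ∑ m, T j m * c i m k = 0 := by
    intro i j k
    have e1 : ∑ m, T j m * c i m k = -∑ m, T k m * c i j m := a1 i j k
    have e2 : ∑ m, T k m * c i j m = ∑ m, T k m * c j m i :=
      Finset.sum_congr rfl fun m _ => by rw [h12, h23]
    have e3 : ∑ m, T k m * c j m i = -∑ m, T i m * c j k m := a1 j k i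
    have e4 : ∑ m, T i m * c j k m = ∑ m, T i m * c k m j :=
      Finset.sum_congr rfl fun m _ => by rw [h12, h23]
    have e5 : ∑ m, T i m * c k m j = -∑ m, T j m * c k i m := a1 k i j
    have e6 : ∑ m, T j m * c k i m = ∑ m, T j m * c i m k :=
      Finset.sum_congr rfl fun m _ => by rw [h12, h23]
    linarith
  have h2 : ∑ n, T j n * ∑ m, T n m * c i m k = r * c i j k := by
    have : ∑ n, T j n * ∑ m, T n m * c i m k = ∑ m, (T * T) j m * c i m k := by
      simp only [Matrix.mul_apply, Fin.sum_univ_three]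
      ring
    rw [this, hT]
    simp [Matrix.one_apply]
  simp only [key, mul_zero, Finset.sum_const_zero] at h2
  exact (mul_eq_zero.1 h2.symm).resolve_left hr

/-- An endomorphism that commutes with all skew endomorphisms is scalar. -/
theorem eq_smul_one_of_comm_skew {T : Matrix (Fin 3) (Fin 3) ℝ}
    (h : ∀ a l k : Fin 3, ∑ m, T m l * eps m k a = ∑ m, eps l m a * T m k) :
    T = T 0 0 • 1 := by
  have h' := fun a l k => h a l k
  have e1 := h' 2 0 0
  have e2 := h' 2 0 1
  have e3 := h' 2 1 1
  have e4 := h' 1 0 0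
  have e5 := h' 1 0 2
  have e6 := h' 1 2 2
  have e7 := h' 0 1 1
  have e8 := h' 0 2 2
  have e9 := h' 0 1 2
  simp [eps, Fin.sum_univ_three] at e1 e2 e3 e4 e5 e6 e7 e8 e9
  ext i j
  fin_cases i <;> fin_cases j <;> simp <;> linarith

/-! ### Local consequences of the soliton equations -/

section Soliton

variable {G : E3 → Matrix (Fin 3) (Fin 3) ℝ} {U : Set E3} {y : E3} {f : E3 → ℝ} {κ : ℝ}

theorem pd_eq_dd (i : Fin 3) (f : E3 → ℝ) (y : E3) : pd i f y = dd (ee i) f y := rfl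

theorem hessian_symm (hG : MetricOn G U) (hf : Smooth f y) (i j : Fin 3) :
    hessian G f y i j = hessian G f y j i := by
  simp only [hessian, ← gam_apply]
  have h : pd i (fun z => pd j f z) y = pd j (fun z => pd i f z) y :=
    dd_comm (v := ee i) (w := ee j) hf
  rw [h]
  congr 1
  exact Finset.sum_congr rfl fun k _ => by rw [gam_symm hG]

theorem pd_normSqGrad (hG : MetricOn G U) (hy : y ∈ U) (hf : Smooth f y) (j : Fin 3) :
    pd j (normSqGrad G f) y
      = 2 * ∑ i, (∑ p, (G y)⁻¹ p i * pd p f y) * hessian G f y i j := by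
  have hN := (hG.smooth y hy).inv (hG.det_ne_zero y hy)
  have hp : ∀ i, Smooth (pd i f) y := fun i => hf.dd
  have hs : ∀ p q, Smooth (fun z => (G z)⁻¹ p q * pd p f z) y := fun p q =>
    ContDiffAt.mul (hN p q) (hp p)
  have hst : ∀ p q, Smooth (fun z => (G z)⁻¹ p q * pd p f z * pd q f z) y := fun p q =>
    ContDiffAt.mul (hs p q) (hp q)
  have e : pd j (normSqGrad G f) y = ∑ p, ∑ q,
      ((ddm (ee j) (fun z => (G z)⁻¹) y p q * pd p f y + (G y)⁻¹ p q * dd (ee j) (pd p f) y)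
        * pd q f y + (G y)⁻¹ p q * pd p f y * dd (ee j) (pd q f) y) := by
    rw [pd_eq_dd]
    unfold normSqGrad
    rw [dd_sum fun p _ => Smooth.sum' fun q _ => hst p q]
    refine Finset.sum_congr rfl fun p _ => ?_
    rw [dd_sum fun q _ => hst p q]
    refine Finset.sum_congr rfl fun q _ => ?_
    rw [dd_mul (hs p q) (hp q), dd_mul (hN p q) (hp p)]
    rfl
  have hNs : ∀ a b, (G y)⁻¹ a b = (G y)⁻¹ b a := fun a b =>
    congrFun (congrFun (hG.inv_transpose y) b) a
  have hdN : ∀ p q, ddm (ee j) (fun z => (G z)⁻¹) y p q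
      = -(∑ m, (G y)⁻¹ p m * gam ee G y j q m + ∑ m, gam ee G y j p m * (G y)⁻¹ m q) := by
    intro p q
    rw [ddm_inv_metric hG hy]
    rfl
  have hh : ∀ i, hessian G f y i j
      = dd (ee j) (pd i f) y - ∑ k, gam ee G y j k i * pd k f y := by
    intro i
    rw [hessian_symm hG hf i j]
    rfl
  rw [e]
  simp only [hdN, hh, Fin.sum_univ_three, hNs 1 0, hNs 2 0, hNs 2 1]
  ring

/-- If the curvature annihilates the gradient of `f`, the Einstein equation makes
`|df|² - ½ e^{2f}` locally constant. -/
theorem pd_energy_eq_zero (hG : MetricOn G U) (hf : ∀ z ∈ U, Smooth f z)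
    (hE : ∀ z ∈ U, ∀ i j, einsteinOp κ G f z i j = 0)
    (hR : ∀ z ∈ U, ∀ i j k, riemannGrad G f z i j k = 0) (hy : y ∈ U) (j : Fin 3) :
    pd j (fun z => normSqGrad G f z - (1 / 2) * Real.exp (2 * f z)) y = 0 := by
  have hfy := hf y hy
  have hN := (hG.smooth y hy).inv (hG.det_ne_zero y hy)
  -- the gradient `v` annihilates the Riemann tensor, hence `Ric` and `R ∘ R`
  set v : Fin 3 → ℝ := fun i => ∑ p, (G y)⁻¹ p i * pd p f y with hv
  have hvR : ∀ a b c, ∑ i, v i * riemann G y i a b c = 0 := by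
    intro a b c
    rw [← hR y hy a b c, riemannGrad, Finset.sum_comm]
    simp only [hv, Finset.sum_mul]
  have hric : ∑ i, v i * ricci G y i j = 0 := by
    simp only [ricci, Finset.mul_sum]
    rw [Finset.sum_comm]
    refine Finset.sum_eq_zero fun p _ => ?_
    rw [Finset.sum_comm]
    refine Finset.sum_eq_zero fun q _ => ?_
    have := hvR p j q
    have e : ∀ i, riemann G y p i j q = -riemann G y i p j q := fun i => by
      rw [riemann_eq hG, riemann_eq hG, Rm_antisymm_left]
    simp only [e]
    calc ∑ i, v i * ((G y)⁻¹ p q * -riemann G y i p j q)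
        = -(G y)⁻¹ p q * ∑ i, v i * riemann G y i p j q := by
          rw [Finset.mul_sum]; exact Finset.sum_congr rfl fun i _ => by ring
      _ = 0 := by rw [this, mul_zero]
  have hcirc : ∑ a, v a * riemannCirc G y a j = 0 := by
    simp only [riemannCirc, Finset.mul_sum]
    rw [Finset.sum_comm]
    refine Finset.sum_eq_zero fun i _ => ?_
    rw [Finset.sum_comm]
    refine Finset.sum_eq_zero fun i' _ => ?_
    rw [Finset.sum_comm]
    refine Finset.sum_eq_zero fun k _ => ?_
    rw [Finset.sum_comm]
    refine Finset.sum_eq_zero fun k' _ => ?_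
    rw [Finset.sum_comm]
    refine Finset.sum_eq_zero fun l _ => ?_
    rw [Finset.sum_comm]
    refine Finset.sum_eq_zero fun l' _ => ?_
    calc _ = (1 / 2) * ((G y)⁻¹ i i' * (G y)⁻¹ k k' * (G y)⁻¹ l l' * riemann G y j i' k' l')
          * ∑ a, v a * riemann G y a i k l := by
          rw [Finset.mul_sum]; exact Finset.sum_congr rfl fun i _ => by ring
      _ = 0 := by rw [hvR, mul_zero]
  have hGv : ∑ i, v i * G y i j = pd j f y := by
    have : ∑ i, v i * G y i j = ∑ p, pd p f y * ((G y)⁻¹ * G y) p j := by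
      simp only [hv, Matrix.mul_apply, Fin.sum_univ_three]
      ring
    rw [this, hG.inv_mul hy]
    simp [Matrix.one_apply]
  have hes : Smooth (fun z => Real.exp (2 * f z)) y :=
    Real.contDiff_exp.contDiffAt.comp y (ContDiffAt.mul contDiffAt_const hfy)
  have hexp : dd (ee j) (fun z => Real.exp (2 * f z)) y = Real.exp (2 * f y) * (2 * pd j f y) := by
    have h1 : HasFDerivAt (fun z => 2 * f z) ((2 : ℝ) • fderiv ℝ f y) y :=
      hfy.diff.hasFDerivAt.const_mul 2
    rw [dd, h1.exp.fderiv]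
    simp [pd_eq_dd, dd]
  have hns : Smooth (normSqGrad G f) y := by
    unfold normSqGrad
    exact Smooth.sum' fun p _ => Smooth.sum' fun q _ =>
      ContDiffAt.mul (ContDiffAt.mul (hN p q) hfy.dd) hfy.dd
  have hsum : ∑ i, v i * einsteinOp κ G f y i j = 0 :=
    Finset.sum_eq_zero fun i _ => by rw [hE y hy, mul_zero]
  have hexpand : ∑ i, v i * einsteinOp κ G f y i j = ∑ i, v i * ricci G y i j
      + ∑ i, v i * hessian G f y i j - (1 / 2) * Real.exp (2 * f y) * ∑ i, v i * G y i j
      + κ * ∑ i, v i * riemannCirc G y i j := by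
    simp only [einsteinOp, Fin.sum_univ_three]; ring
  rw [hric, hcirc, hGv, hsum] at hexpand
  have hmain := pd_normSqGrad hG hy hfy j
  rw [pd_eq_dd] at hmain
  rw [pd_eq_dd, dd_sub hns (ContDiffAt.mul contDiffAt_const hes), dd_const_mul _ hes, hexp, hmain]
  simp only [hv] at hexpand
  linarith

open scoped MatrixOrder Matrix.Norms.L2Operator in
theorem exists_eq_transpose_mul_self {g : Matrix (Fin 3) (Fin 3) ℝ} (hg : g.PosDef) :
    ∃ L : Matrix (Fin 3) (Fin 3) ℝ, g = L.transpose * L := by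
  obtain ⟨L, hL⟩ := CStarAlgebra.nonneg_iff_eq_star_mul_self.mp hg.posSemidef.nonneg
  exact ⟨L, hL⟩

/-- `tr S²` is nonnegative for an endomorphism `S = B G` that is self-adjoint for the metric `G`. -/
theorem trace_mul_self_nonneg {S B g : Matrix (Fin 3) (Fin 3) ℝ} (hg : g.PosDef)
    (hB : B.transpose = B) (hS : S = B * g) : 0 ≤ (S * S).trace := by
  obtain ⟨L, hL'⟩ := exists_eq_transpose_mul_self hg
  have e : (S * S).trace = ((L * B * L.transpose).transpose * (L * B * L.transpose)).trace := by
    rw [hS, hL', Matrix.transpose_mul, Matrix.transpose_mul, Matrix.transpose_transpose, hB]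
    calc (B * (L.transpose * L) * (B * (L.transpose * L))).trace
        = ((B * (L.transpose * L) * B * L.transpose) * L).trace := by simp only [mul_assoc]
      _ = (L * (B * (L.transpose * L) * B * L.transpose)).trace := Matrix.trace_mul_comm _ _
      _ = _ := by simp only [mul_assoc]
  rw [e]
  simp only [Matrix.trace, Matrix.diag, Matrix.mul_apply, Matrix.transpose_apply]
  exact Finset.sum_nonneg fun i _ => Finset.sum_nonneg fun j _ => mul_self_nonneg _

theorem crv_mul_inv_symm (hG : MetricOn G U) (hy : y ∈ U) :
    (crv ee G y * (G y)⁻¹).transpose = crv ee G y * (G y)⁻¹ := by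
  have e : crv ee G y * (G y)⁻¹ = (G y).det⁻¹ • crvA ee G y := by
    rw [crv, Matrix.smul_mul, mul_assoc, hG.mul_inv hy, mul_one]
  rw [e, Matrix.transpose_smul, crvA_symm hG hy]

theorem trace_crv_sq_nonneg (hG : MetricOn G U) (hpos : (G y).PosDef) (hy : y ∈ U) :
    0 ≤ (crv ee G y * crv ee G y).trace :=
  trace_mul_self_nonneg hpos (crv_mul_inv_symm hG hy)
    (by rw [mul_assoc, hG.inv_mul hy, mul_one])

theorem dcrv_mul_inv_symm (hG : MetricOn G U) (hy : y ∈ U) (p : Fin 3) :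
    (dcrv ee G y p * (G y)⁻¹).transpose = dcrv ee G y p * (G y)⁻¹ := by
  have hd := hG.det_ne_zero y hy
  have h := ddm_crvA (v := ee) hG hy p
  have hA := crvA_symm (v := ee) hG hy
  have e : dcrv ee G y p * (G y)⁻¹ = (G y).det⁻¹ • (ddm (ee p) (crvA ee G) y
      - (2 * (gam ee G y p).trace) • crvA ee G y
      + gam ee G y p * crvA ee G y + crvA ee G y * (gam ee G y p).transpose) := by
    rw [h]
    have : ∀ a b c d : Matrix (Fin 3) (Fin 3) ℝ, a - b - c + d - a + b + c = d := by
      intros; abel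
    rw [this, smul_smul, inv_mul_cancel₀ hd, one_smul]
  have hdA : (ddm (ee p) (crvA ee G) y).transpose = ddm (ee p) (crvA ee G) y := by
    rw [← ddm_transpose]
    exact ddm_congr ((hG.eventually hy).mono fun z hz => crvA_symm hG hz)
  rw [e, Matrix.transpose_smul, Matrix.transpose_add, Matrix.transpose_add, Matrix.transpose_sub,
    Matrix.transpose_smul, Matrix.transpose_mul, Matrix.transpose_mul, hA, hdA,
    Matrix.transpose_transpose]
  congr 1
  abel

/-- A parallel curvature operator commutes with the curvature endomorphisms. -/
theorem Om_comm_crv (hG : MetricOn G U) (hD : ∀ z ∈ U, ∀ p, dcrv ee G z p = 0) (hy : y ∈ U)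
    (i j : Fin 3) : Om ee G y i j * crv ee G y = crv ee G y * Om ee G y i j := by
  have hT := smooth_crv (v := ee) hG hy
  have hg := fun p => smooth_gam (v := ee) hG hy p
  have hd : ∀ z ∈ U, ∀ p, ddm (ee p) (crv ee G) z
      = crv ee G z * gam ee G z p - gam ee G z p * crv ee G z := by
    intro z hz p
    have := hD z hz p
    rw [dcrv] at this
    rw [eq_neg_of_add_eq_zero_left this, neg_sub]
  have key : ∀ i j, ddm (ee i) (ddm (ee j) (crv ee G)) y
      = (crv ee G y * gam ee G y i - gam ee G y i * crv ee G y) * gam ee G y j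
        + crv ee G y * ddm (ee i) (fun z => gam ee G z j) y
        - (ddm (ee i) (fun z => gam ee G z j) y * crv ee G y
          + gam ee G y j * (crv ee G y * gam ee G y i - gam ee G y i * crv ee G y)) := by
    intro i j
    have e : ddm (ee j) (crv ee G) =ᶠ[nhds y]
        fun z => crv ee G z * gam ee G z j - gam ee G z j * crv ee G z :=
      (hG.eventually hy).mono fun z hz => hd z hz j
    rw [ddm_congr e, ddm_sub (hT.mul (hg j)) ((hg j).mul hT), ddm_mul hT (hg j),
      ddm_mul (hg j) hT, hd y hy i]
  have h := ddm_comm (v := ee i) (w := ee j) hT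
  rw [key i j, key j i, ← sub_eq_zero] at h
  rw [← sub_eq_zero, ← neg_eq_zero, ← h, Om]
  noncomm_ring

end Soliton

/-! ### Constant dilaton and harmonic curvature imply hyperbolicity -/

section SolitonConst

variable {G : E3 → Matrix (Fin 3) (Fin 3) ℝ} {U : Set E3} {y : E3} {f : E3 → ℝ} {κ : ℝ}

theorem hessian_eq_zero (hG : MetricOn G U) (hdf : ∀ z ∈ U, ∀ i, pd i f z = 0) (hy : y ∈ U)
    (i j : Fin 3) : hessian G f y i j = 0 := by
  have h : pd i (fun z => pd j f z) y = 0 := by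
    rw [pd_eq_dd, dd_congr (g := fun _ => (0 : ℝ)) ((hG.eventually hy).mono fun z hz => hdf z hz j),
      dd_const]
  simp [hessian, h, hdf y hy]

/-- With a constant dilaton, the curvature operator satisfies a quadratic equation. -/
theorem crv_quadratic (hG : MetricOn G U) (hdf : ∀ z ∈ U, ∀ i, pd i f z = 0)
    (hE : ∀ z ∈ U, ∀ i j, einsteinOp κ G f z i j = 0)
    (hD : ∀ z ∈ U, dilatonOp κ G f z = 0) (hy : y ∈ U) :
    Real.exp (2 * f y) = κ * (crv ee G y * crv ee G y).trace ∧
    crv ee G y + κ • (crv ee G y * crv ee G y) = (Real.exp (2 * f y) / 4) • 1 := by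
  have hD' := hD y hy
  have hc : codiffGrad G f y = 0 := by simp [codiffGrad, hessian_eq_zero hG hdf hy]
  have hn : normSqGrad G f y = 0 := by simp [normSqGrad, hdf y hy]
  rw [dilatonOp, hc, hn, riemannNormSq_eq hG hy] at hD'
  refine ⟨by linarith, ?_⟩
  set T := crv ee G y with hT
  set s := Real.exp (2 * f y)
  have h1 : G y * (T.trace • (1 : Matrix (Fin 3) (Fin 3) ℝ) - T
      - ((1 / 2) * s) • (1 : Matrix (Fin 3) (Fin 3) ℝ)
      + κ • ((T * T).trace • (1 : Matrix (Fin 3) (Fin 3) ℝ) - T * T)) = 0 := by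
    ext i j
    have := hE y hy i j
    rw [einsteinOp, ricci_eq hG hy, riemannCirc_eq hG hy, hessian_eq_zero hG hdf hy] at this
    rw [Matrix.mul_add, Matrix.mul_sub, Matrix.mul_smul, Matrix.mul_smul, mul_one,
      Matrix.add_apply, Matrix.sub_apply, Matrix.smul_apply, Matrix.smul_apply, smul_eq_mul,
      smul_eq_mul, Matrix.zero_apply]
    linarith
  have h2 := congrArg (fun M => (G y)⁻¹ * M) h1
  simp only [← mul_assoc, hG.inv_mul hy, one_mul, mul_zero] at h2
  have h3 := congrArg Matrix.trace h2
  simp only [Matrix.trace_add, Matrix.trace_sub, Matrix.trace_smul, Matrix.trace_one,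
    Fintype.card_fin, smul_eq_mul, Matrix.trace_zero] at h3
  have h4 : T + κ • (T * T) = (T.trace + κ * (T * T).trace - (1 / 2) * s) •
      (1 : Matrix (Fin 3) (Fin 3) ℝ) := by
    have : ∀ a b c d e : Matrix (Fin 3) (Fin 3) ℝ, a - T - b + κ • (d - T * T) = 0 →
        T + κ • (T * T) = a - b + κ • d := by
      intro a b c d e h
      rw [← sub_eq_zero, ← neg_eq_zero, ← h, smul_sub]
      abel
    rw [this _ _ 0 _ 0 h2, smul_smul]
    module
  rw [h4]
  congr 1
  push_cast at h3
  linarith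

theorem dd_exp_eq_zero (hf : ∀ z ∈ U, Smooth f z)
    (hdf : ∀ z ∈ U, ∀ i, pd i f z = 0) (hy : y ∈ U) (i : Fin 3) :
    dd (ee i) (fun z => Real.exp (2 * f z)) y = 0 := by
  have h1 : HasFDerivAt (fun z => 2 * f z) ((2 : ℝ) • fderiv ℝ f y) y :=
    (hf y hy).diff.hasFDerivAt.const_mul 2
  have h2 : fderiv ℝ f y (ee i) = 0 := hdf y hy i
  rw [dd, h1.exp.fderiv]
  simp [h2]

theorem smooth_exp {X : Type*} [NormedAddCommGroup X] [NormedSpace ℝ X] {f : X → ℝ} {x : X}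
    (hf : Smooth f x) : Smooth (fun z => Real.exp (2 * f z)) x :=
  Real.contDiff_exp.contDiffAt.comp x (ContDiffAt.mul contDiffAt_const hf)

/-- The dilaton equation with constant dilaton reads `e^{2f} = κ tr T²`, which forces `κ > 0`. -/
theorem soliton_pos (hG : MetricOn G U) (hpos : ∀ z ∈ U, (G z).PosDef)
    (hdf : ∀ z ∈ U, ∀ i, pd i f z = 0)
    (hE : ∀ z ∈ U, ∀ i j, einsteinOp κ G f z i j = 0)
    (hD : ∀ z ∈ U, dilatonOp κ G f z = 0) (hy : y ∈ U) : 0 < κ := by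
  have h1 := (crv_quadratic hG hdf hE hD hy).1
  have h2 := trace_crv_sq_nonneg hG (hpos y hy) hy
  have h3 := Real.exp_pos (2 * f y)
  by_contra hk
  nlinarith [mul_nonneg (sub_nonneg.2 (not_lt.1 hk)) h2]

theorem sum_contract (N Q : Matrix (Fin 3) (Fin 3) ℝ) (R : Fin 3 → Matrix (Fin 3) (Fin 3) ℝ)
    (q a b : Fin 3) :
    ∑ m, Q a m * ∑ p, N p q * R p m b + ∑ m, Q b m * ∑ p, N p q * R p a m
      = ∑ p, N p q * (Q * R p + R p * Q.transpose) a b := by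
  simp only [Matrix.add_apply, Matrix.mul_apply, Matrix.transpose_apply, Fin.sum_univ_three]
  ring

theorem sum_lower (N g : Matrix (Fin 3) (Fin 3) ℝ) (R : Fin 3 → Matrix (Fin 3) (Fin 3) ℝ)
    (p a b : Fin 3) :
    ∑ q, g q p * ∑ r, N r q * R r a b = ∑ r, (N * g) r p * R r a b := by
  simp only [Matrix.mul_apply, Fin.sum_univ_three]
  ring

/-- A harmonic curvature operator that satisfies a quadratic equation with constant coefficients is
parallel. -/
theorem dcrv_eq_zero (hG : MetricOn G U) (hpos : ∀ z ∈ U, (G z).PosDef)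
    (hf : ∀ z ∈ U, Smooth f z) (hdf : ∀ z ∈ U, ∀ i, pd i f z = 0)
    (hE : ∀ z ∈ U, ∀ i j, einsteinOp κ G f z i j = 0)
    (hD : ∀ z ∈ U, dilatonOp κ G f z = 0)
    (hH : ∀ z ∈ U, ∀ i j k, divRiemann G z i j k = 0) (hy : y ∈ U) (p : Fin 3) :
    dcrv ee G y p = 0 := by
  have hκ := soliton_pos hG hpos hdf hE hD hy
  have hT := smooth_crv (v := ee) hG hy
  set T := crv ee G y with hTdef
  set s := Real.exp (2 * f y) with hs
  have hs0 : 0 < s := Real.exp_pos _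
  have hq := (crv_quadratic hG hdf hE hD hy).2
  -- covariant derivative of the quadratic equation
  have hanti : ∀ p, dcrv ee G y p + κ • (dcrv ee G y p * T + T * dcrv ee G y p) = 0 := by
    intro p
    have e : (fun z => crv ee G z + κ • (crv ee G z * crv ee G z)) =ᶠ[nhds y]
        fun z => (Real.exp (2 * f z) / 4) • (1 : Matrix (Fin 3) (Fin 3) ℝ) :=
      (hG.eventually hy).mono fun z hz => (crv_quadratic hG hdf hE hD hz).2
    have h := ddm_congr (v := ee p) e
    have hes := smooth_exp (hf y hy)
    have e3 : dd (ee p) (fun z => Real.exp (2 * f z) / 4) y = 0 := by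
      have : (fun z => Real.exp (2 * f z) / 4) = fun z => (1 / 4) * Real.exp (2 * f z) := by
        funext z; ring
      rw [this, dd_const_mul _ hes, dd_exp_eq_zero hf hdf hy, mul_zero]
    have hes4 : Smooth (fun z => Real.exp (2 * f z) / 4) y := ContDiffAt.div_const hes 4
    rw [ddm_add hT (SmoothMat.smul contDiffAt_const (hT.mul hT)), ddm_const_smul _ (hT.mul hT),
      ddm_mul hT hT, ddm_smul hes4 (SmoothMat.const 1), e3, ddm_const, zero_smul, smul_zero,
      add_zero] at h
    set W := gam ee G y p
    have hc : W * (T + κ • (T * T)) - (T + κ • (T * T)) * W = 0 := by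
      rw [hq]; simp
    have hsplit : dcrv ee G y p + κ • (dcrv ee G y p * T + T * dcrv ee G y p)
        = (ddm (ee p) (crv ee G) y + κ • (ddm (ee p) (crv ee G) y * T
            + T * ddm (ee p) (crv ee G) y))
          + (W * (T + κ • (T * T)) - (T + κ • (T * T)) * W) := by
      have : dcrv ee G y p = ddm (ee p) (crv ee G) y + (W * T - T * W) := rfl
      rw [this]
      simp only [Matrix.mul_smul, Matrix.smul_mul, mul_add, add_mul, smul_add, smul_sub, mul_sub,
        sub_mul, mul_assoc]
      abel
    rw [hsplit, h, hc, add_zero]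
  set N := (G y)⁻¹ with hN
  have hN0 : ∀ q a b, ∑ p, N p q * (dcrv ee G y p * N) a b = 0 := by
    have hk2 : (0:ℝ) < s / (4 * κ) + 1 / (4 * κ ^ 2) := by positivity
    -- completing the square: `(T + 1/(2κ))² = s/(4κ) + 1/(4κ²)`
    refine eq_zero_of_symm_of_anticomm (T := T + (1 / (2 * κ)) • 1) (r := s / (4 * κ)
      + 1 / (4 * κ ^ 2)) ?_ ?_ hk2.ne' ?_ ?_
    · refine symm_of_sum_eps (hG.det_ne_zero y hy) (M := fun p => dcrv ee G y p * N) fun i j k => ?_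
      rw [← divRiemann_eq hG hy]; exact hH y hy i j k
    · intro q a b
      refine Finset.sum_congr rfl fun p _ => ?_
      have := congrFun (congrFun (dcrv_mul_inv_symm hG hy p) a) b
      rw [← hN] at this
      rw [← this]; rfl
    · have : T * T = (1 / κ) • ((s / 4) • (1 : Matrix (Fin 3) (Fin 3) ℝ) - T) := by
        rw [← hq, add_sub_cancel_left, smul_smul, one_div, inv_mul_cancel₀ hκ.ne', one_smul]
      rw [add_mul, mul_add, mul_add, this]
      simp only [Matrix.smul_mul, Matrix.mul_smul, one_mul, mul_one, smul_smul, smul_sub]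
      ext a b
      simp only [Matrix.add_apply, Matrix.sub_apply, Matrix.smul_apply, smul_eq_mul]
      field_simp
      ring
    · intro q a b
      have hTs : N * T.transpose = T * N := by
        have := crv_mul_inv_symm hG hy
        rw [Matrix.transpose_mul, hG.inv_transpose] at this
        exact this
      have e1 : ∀ p, (T + (1 / (2 * κ)) • 1) * (dcrv ee G y p * N)
          + (dcrv ee G y p * N) * (T + (1 / (2 * κ)) • 1).transpose = 0 := by
        intro p
        rw [Matrix.transpose_add, Matrix.transpose_smul, Matrix.transpose_one, mul_assoc _ N,
          mul_add N, hTs]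
        have h := congrArg (fun M => (1 / κ) • (M * N)) (hanti p)
        simp only [zero_mul, smul_zero] at h
        rw [← h]
        simp only [Matrix.smul_mul, Matrix.mul_smul, one_mul, mul_one, add_mul, mul_add, smul_add,
          smul_smul, mul_assoc]
        rw [one_div_mul_cancel hκ.ne', one_smul, one_smul]
        have e2 : (1 / κ) = 1 / (2 * κ) + 1 / (2 * κ) := by field_simp; ring
        rw [e2, add_smul]
        abel
      refine (sum_contract N _ (fun p => dcrv ee G y p * N) q a b).trans ?_
      exact Finset.sum_eq_zero fun p _ => by rw [e1, Matrix.zero_apply, mul_zero]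
  have h0 : dcrv ee G y p * N = 0 := by
    ext a b
    have := sum_lower N (G y) (fun p => dcrv ee G y p * N) p a b
    rw [hG.inv_mul hy] at this
    simpa [hN0, Matrix.one_apply] using this.symm
  have h1 := congrArg (fun M => M * G y) h0
  simpa only [mul_assoc, hN, hG.inv_mul hy, mul_one, zero_mul] using h1

/-- A soliton with constant dilaton and harmonic curvature is hyperbolic. -/
theorem crv_eq_smul_one (hG : MetricOn G U) (hpos : ∀ z ∈ U, (G z).PosDef)
    (hf : ∀ z ∈ U, Smooth f z) (hdf : ∀ z ∈ U, ∀ i, pd i f z = 0)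
    (hE : ∀ z ∈ U, ∀ i j, einsteinOp κ G f z i j = 0)
    (hD : ∀ z ∈ U, dilatonOp κ G f z = 0)
    (hH : ∀ z ∈ U, ∀ i j k, divRiemann G z i j k = 0) (hy : y ∈ U) :
    crv ee G y = (-4 / κ) • 1 ∧ Real.exp (2 * f y) = 48 / κ := by
  have hκ := soliton_pos hG hpos hdf hE hD hy
  obtain ⟨htr, hq⟩ := crv_quadratic hG hdf hE hD hy
  have hcomm := Om_comm_crv hG (fun z hz => dcrv_eq_zero hG hpos hf hdf hE hD hH hz) hy
  have hTs : (crv ee G y).transpose * G y = G y * crv ee G y := by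
    have h := crv_mul_inv_symm hG hy
    rw [Matrix.transpose_mul, hG.inv_transpose] at h
    have h2 := congrArg (fun M => G y * M * G y) h
    simp only [← mul_assoc] at h2
    rw [hG.mul_inv hy, one_mul, mul_assoc (_ * _), hG.inv_mul hy, mul_one] at h2
    exact h2
  have hOm := fun i j l k => Om_eq_sum_eps (v := ee) hG hy i j l k
  have hs0 : 0 < Real.exp (2 * f y) := Real.exp_pos _
  set T := crv ee G y with hT
  set s := Real.exp (2 * f y) with hs
  have hscal : T = T 0 0 • 1 := by
    have key : T.transpose = T.transpose 0 0 • 1 := by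
      -- `V d` is the infinitesimal rotation about the `d`-th axis
      set V : Fin 3 → Matrix (Fin 3) (Fin 3) ℝ := fun d =>
        (Matrix.of fun l c => eps l c d) * G y with hV
      have h1 : ∀ a, (∑ d, T a d • V d) * T = T * ∑ d, T a d • V d := by
        intro a
        have e : Om ee G y (a + 1) (a + 2) = ∑ d, T a d • V d := by
          ext l k
          rw [hOm]
          simp only [hV, Matrix.sum_apply, Matrix.smul_apply, smul_eq_mul, Matrix.mul_apply,
            Matrix.of_apply]
          fin_cases a <;> simp [eps, Fin.sum_univ_three] <;> ring
        rw [← e]; exact hcomm _ _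
      have h2 : ∀ d, V d * T = T * V d := by
        intro d
        -- `(1 + κ T) T` is a nonzero multiple of the identity
        have e1 : ∑ a, (1 + κ • T) d a • ∑ d', T a d' • V d' = (s / 4) • V d := by
          have hq' : (1 + κ • T) * T = (s / 4) • 1 := by
            rw [← hq, add_mul, one_mul, Matrix.smul_mul]
          have : ∑ a, (1 + κ • T) d a • ∑ d', T a d' • V d'
              = ∑ d', ((1 + κ • T) * T) d d' • V d' := by
            simp only [Matrix.mul_apply, Finset.sum_smul, Finset.smul_sum, smul_smul]
            exact Finset.sum_comm
          rw [this, hq']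
          simp [Matrix.one_apply]
        have e2 : (s / 4) • (V d * T) = (s / 4) • (T * V d) := by
          have e3 : ((s / 4) • V d) * T = T * ((s / 4) • V d) := by
            rw [← e1, Finset.sum_mul, Finset.mul_sum]
            refine Finset.sum_congr rfl fun a _ => ?_
            rw [Matrix.smul_mul, h1, Matrix.mul_smul]
          rwa [Matrix.smul_mul, Matrix.mul_smul] at e3
        exact smul_right_injective _ (by positivity : s / 4 ≠ 0) e2
      refine eq_smul_one_of_comm_skew fun d l k => ?_
      have h3 := h2 d
      simp only [hV] at h3
      rw [mul_assoc, ← hTs] at h3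
      have h4 := congrArg (fun M => M * (G y)⁻¹) h3
      simp only [mul_assoc, hG.mul_inv hy, mul_one] at h4
      have h5 := congrFun (congrFun h4 l) k
      simp only [Matrix.mul_apply, Matrix.of_apply, Matrix.transpose_apply] at h5 ⊢
      exact h5.symm
    have := congrArg Matrix.transpose key
    simpa using this
  set c := T 0 0 with hc
  have e1 : T * T = (c * c) • 1 := by
    rw [hscal, Matrix.smul_mul, one_mul, smul_smul]
  have e2 : s = κ * (3 * (c * c)) := by
    rw [htr, e1, Matrix.trace_smul, Matrix.trace_one, Fintype.card_fin, smul_eq_mul]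
    push_cast
    ring
  have e3 : c + κ * (c * c) = s / 4 := by
    have := congrFun (congrFun hq 0) 0
    rw [e1] at this
    simpa only [Matrix.add_apply, Matrix.smul_apply, Matrix.one_apply_eq, smul_eq_mul, mul_one]
      using this
  have c0 : c ≠ 0 := by
    rintro h
    rw [h] at e2
    simp at e2
    linarith
  have e4 : κ * c = -4 := by
    have : c * (κ * c + 4) = 0 := by nlinarith
    rcases mul_eq_zero.1 this with h | h
    · exact absurd h c0
    · linarith
  have e5 : c = -4 / κ := by field_simp; linarith
  refine ⟨by rw [hscal, e5], ?_⟩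
  rw [e2, e5]
  field_simp
  norm_num

end SolitonConst

/-! ### Linear families of metrics -/

/-- The linear family `(t, y) ↦ G y + t H y`. -/
def fam (G H : E3 → Matrix (Fin 3) (Fin 3) ℝ) (p : ℝ × E3) : Matrix (Fin 3) (Fin 3) ℝ :=
  G p.2 + p.1 • H p.2

/-- The points of `ℝ × U` at which the family is nondegenerate. -/
def famSet (G H : E3 → Matrix (Fin 3) (Fin 3) ℝ) (U : Set E3) : Set (ℝ × E3) :=
  {p | p.2 ∈ U ∧ (fam G H p).det ≠ 0}

/-- The coordinate vectors of the chart, in the product with the parameter line. -/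
noncomputable def e4 (i : Fin 3) : ℝ × E3 := (0, ee i)

/-- The tangent vector of the parameter line. -/
def tt : ℝ × E3 := (1, 0)

section Slices

variable {f : ℝ × E3 → ℝ} {F : ℝ × E3 → Matrix (Fin 3) (Fin 3) ℝ} {t : ℝ} {y : E3}

theorem Smooth.slice (hf : Smooth f (t, y)) : Smooth (fun z => f (t, z)) y :=
  ContDiffAt.comp (g := f) (f := fun z => (t, z)) y hf (contDiffAt_const.prodMk contDiffAt_id)

theorem dd_slice (hf : Smooth f (t, y)) (w : E3) :
    dd w (fun z => f (t, z)) y = dd ((0 : ℝ), w) f (t, y) := by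
  have h1 : HasFDerivAt (fun z : E3 => (t, z)) (ContinuousLinearMap.inr ℝ ℝ E3) y :=
    (hasFDerivAt_const t y).prodMk (hasFDerivAt_id y)
  have h2 := (hf.diff.hasFDerivAt).comp y h1
  have h3 : fderiv ℝ (fun z => f (t, z)) y = _ := h2.fderiv
  rw [dd, dd, h3]
  simp

theorem ddm_slice (hF : SmoothMat F (t, y)) (w : E3) :
    ddm w (fun z => F (t, z)) y = ddm ((0 : ℝ), w) F (t, y) := by
  ext a b; exact dd_slice (hF a b) w

theorem hasDerivAt_slice (hf : Smooth f (t, y)) :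
    HasDerivAt (fun s => f (s, y)) (dd tt f (t, y)) t := by
  have h1 : HasDerivAt (fun s : ℝ => (s, y)) ((1 : ℝ), (0 : E3)) t :=
    (hasDerivAt_id t).prodMk (hasDerivAt_const t y)
  exact (hf.diff.hasFDerivAt).comp_hasDerivAt t h1

theorem smooth_snd {g : E3 → ℝ} (hg : Smooth g y) : Smooth (fun p : ℝ × E3 => g p.2) (t, y) :=
  ContDiffAt.comp (g := g) (f := Prod.snd) (t, y) hg contDiffAt_snd

end Slices

section Family

variable {G H : E3 → Matrix (Fin 3) (Fin 3) ℝ} {U : Set E3} {y : E3} {t : ℝ}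

theorem smooth_fam (hG : MetricOn G U) (hHs : ∀ z ∈ U, SmoothMat H z) (hy : y ∈ U) :
    SmoothMat (fam G H) (t, y) := by
  intro a b
  exact ContDiffAt.add (smooth_snd (hG.smooth y hy a b))
    (ContDiffAt.mul contDiffAt_fst (smooth_snd (hHs y hy a b)))

theorem metricOn_fam (hG : MetricOn G U) (hH : ∀ z, (H z).transpose = H z)
    (hHs : ∀ z ∈ U, SmoothMat H z) : MetricOn (fam G H) (famSet G H U) where
  isOpen := by
    rw [isOpen_iff_mem_nhds]
    rintro ⟨t, y⟩ ⟨hy, hd⟩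
    have h1 : ∀ᶠ p : ℝ × E3 in nhds (t, y), p.2 ∈ U :=
      continuous_snd.continuousAt.eventually (hG.isOpen.mem_nhds hy)
    filter_upwards [h1, (smooth_fam hG hHs hy).eventually_det_ne_zero hd] with p h2 h3
      using ⟨h2, h3⟩
  symm z := by simp only [fam, Matrix.transpose_add, Matrix.transpose_smul, hG.symm, hH]
  smooth := by
    rintro ⟨t, y⟩ ⟨hy, -⟩
    exact smooth_fam hG hHs hy
  det_ne_zero p hp := hp.2

theorem zero_mem_famSet (hG : MetricOn G U) (hy : y ∈ U) : ((0 : ℝ), y) ∈ famSet G H U :=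
  ⟨hy, by simpa [fam] using hG.det_ne_zero y hy⟩

theorem eventually_mem_famSet (hG : MetricOn G U) (hH : ∀ z, (H z).transpose = H z)
    (hHs : ∀ z ∈ U, SmoothMat H z) (hy : y ∈ U) : ∀ᶠ t in nhds (0 : ℝ), (t, y) ∈ famSet G H U := by
  have h := (metricOn_fam hG hH hHs).eventually (zero_mem_famSet (H := H) hG hy)
  have hc : ContinuousAt (fun t : ℝ => (t, y)) 0 := by fun_prop
  exact hc.eventually h

theorem metricOn_slice {K : ℝ × E3 → Matrix (Fin 3) (Fin 3) ℝ} {W : Set (ℝ × E3)}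
    (hK : MetricOn K W) (t : ℝ) : MetricOn (fun z => K (t, z)) {z | (t, z) ∈ W} where
  isOpen := hK.isOpen.preimage (by fun_prop)
  symm z := hK.symm _
  smooth z hz := fun a b => (hK.smooth _ hz a b).slice
  det_ne_zero z hz := hK.det_ne_zero _ hz

variable {K : ℝ × E3 → Matrix (Fin 3) (Fin 3) ℝ} {W : Set (ℝ × E3)}

theorem gam_slice (hK : MetricOn K W) (hy : (t, y) ∈ W) (p : Fin 3) :
    gam ee (fun z => K (t, z)) y p = gam e4 K (t, y) p := by
  ext l j
  have h := fun a b i => dd_slice (hK.smooth _ hy a b) (ee i)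
  simp only [gam, Matrix.of_apply, h]
  rfl

theorem Om_slice (hK : MetricOn K W) (hy : (t, y) ∈ W) (i j : Fin 3) :
    Om ee (fun z => K (t, z)) y i j = Om e4 K (t, y) i j := by
  have h : ∀ i j, ddm (ee i) (fun z => gam ee (fun z => K (t, z)) z j) y
      = ddm (e4 i) (fun p => gam e4 K p j) (t, y) := by
    intro i j
    rw [ddm_congr (K := fun z => gam e4 K (t, z) j)
      (((metricOn_slice hK t).eventually hy).mono fun z hz => gam_slice hK hz j)]
    exact ddm_slice (smooth_gam hK hy j) (ee i)
  rw [Om, Om, h, h, gam_slice hK hy, gam_slice hK hy]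

theorem crv_slice (hK : MetricOn K W) (hy : (t, y) ∈ W) :
    crv ee (fun z => K (t, z)) y = crv e4 K (t, y) := by
  have : crvA ee (fun z => K (t, z)) y = crvA e4 K (t, y) := by
    ext a b
    simp only [crvA, Rm, Matrix.of_apply, Om_slice hK hy]
  rw [crv, crv, this]

theorem dcrv_slice (hK : MetricOn K W) (hy : (t, y) ∈ W) (p : Fin 3) :
    dcrv ee (fun z => K (t, z)) y p = dcrv e4 K (t, y) p := by
  have h : ddm (ee p) (crv ee fun z => K (t, z)) y = ddm (e4 p) (crv e4 K) (t, y) := by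
    rw [ddm_congr (K := fun z => crv e4 K (t, z))
      (((metricOn_slice hK t).eventually hy).mono fun z hz => crv_slice hK hz)]
    exact ddm_slice (smooth_crv hK hy) (ee p)
  rw [dcrv, dcrv, h, gam_slice hK hy, crv_slice hK hy]

theorem smooth_dcrv (hK : MetricOn K W) (hy : (t, y) ∈ W) (p : Fin 3) :
    SmoothMat (fun q => dcrv e4 K q p) (t, y) :=
  ((smooth_crv hK hy).ddm).add (((smooth_gam hK hy p).mul (smooth_crv hK hy)).sub
    ((smooth_crv hK hy).mul (smooth_gam hK hy p)))

theorem fam_zero : (fun z => fam G H ((0 : ℝ), z)) = G := by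
  funext z; simp [fam]

theorem ddm_fam (hG : MetricOn G U) (hHs : ∀ z ∈ U, SmoothMat H z) (hy : y ∈ U) :
    ddm tt (fam G H) ((0 : ℝ), y) = H y := by
  ext a b
  have h : HasDerivAt (fun s : ℝ => G y a b + s * H y a b) (1 * H y a b) 0 :=
    ((hasDerivAt_id (0 : ℝ)).mul_const (H y a b)).const_add (G y a b)
  rw [one_mul] at h
  exact (hasDerivAt_slice (smooth_fam (t := 0) hG hHs hy a b)).unique h

/-- The first variation of the curvature operator. -/
noncomputable def tau (G H : E3 → Matrix (Fin 3) (Fin 3) ℝ) (y : E3) : Matrix (Fin 3) (Fin 3) ℝ :=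
  ddm tt (crv e4 (fam G H)) ((0 : ℝ), y)

/-- The first variation of the connection matrix. -/
noncomputable def dgam (G H : E3 → Matrix (Fin 3) (Fin 3) ℝ) (y : E3) (p : Fin 3) :
    Matrix (Fin 3) (Fin 3) ℝ :=
  ddm tt (fun q => gam e4 (fam G H) q p) ((0 : ℝ), y)

/-- If the curvature operator of `G` is a constant multiple of the identity, the first variation of
its covariant derivative is the covariant derivative of its first variation. -/
theorem ddm_dcrv (hG : MetricOn G U) (hH : ∀ z, (H z).transpose = H z)
    (hHs : ∀ z ∈ U, SmoothMat H z) {k : ℝ} (hk : ∀ z ∈ U, crv ee G z = k • 1) (hy : y ∈ U)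
    (p : Fin 3) :
    dcrv e4 (fam G H) ((0 : ℝ), y) p = 0 ∧
    ddm tt (fun q => dcrv e4 (fam G H) q p) ((0 : ℝ), y)
      = ddm (ee p) (tau G H) y + (gam ee G y p * tau G H y - tau G H y * gam ee G y p) := by
  have hK := metricOn_fam hG hH hHs
  have h0 := zero_mem_famSet (H := H) hG hy
  have hT := smooth_crv (v := e4) hK h0
  have hg := smooth_gam (v := e4) hK h0 p
  have hTk : crv e4 (fam G H) ((0 : ℝ), y) = k • 1 := by
    rw [← crv_slice hK h0, fam_zero, hk y hy]
  have hg0 : gam e4 (fam G H) ((0 : ℝ), y) p = gam ee G y p := by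
    rw [← gam_slice hK h0, fam_zero]
  constructor
  · rw [← dcrv_slice hK h0, fam_zero, dcrv, hk y hy,
      ddm_congr (K := fun _ => k • (1 : Matrix (Fin 3) (Fin 3) ℝ))
        ((hG.eventually hy).mono fun z hz => hk z hz), ddm_const]
    simp
  · have e : (fun q => dcrv e4 (fam G H) q p) = fun q => ddm (e4 p) (crv e4 (fam G H)) q
        + (gam e4 (fam G H) q p * crv e4 (fam G H) q
          - crv e4 (fam G H) q * gam e4 (fam G H) q p) := rfl
    rw [e, ddm_add hT.ddm ((hg.mul hT).sub (hT.mul hg)), ddm_sub (hg.mul hT) (hT.mul hg),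
      ddm_mul hg hT, ddm_mul hT hg, ddm_comm hT, hTk, hg0]
    have e2 : ddm (e4 p) (ddm tt (crv e4 (fam G H))) ((0 : ℝ), y) = ddm (ee p) (tau G H) y :=
      (ddm_slice hT.ddm (ee p)).symm
    rw [e2]
    simp only [Matrix.mul_smul, Matrix.smul_mul, mul_one, one_mul, tau]
    congr 1
    abel

end Family

/-! ### The linearized soliton equations -/

section Linearized

variable {G H : E3 → Matrix (Fin 3) (Fin 3) ℝ} {U : Set E3} {y : E3} {f ξ : E3 → ℝ} {κ : ℝ}

theorem hasDerivAt_mul_of_eq_zero {a b : ℝ → ℝ} {a' b' : ℝ} (ha : HasDerivAt a a' 0)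
    (hb : HasDerivAt b b' 0) (h0 : b 0 = 0) : HasDerivAt (fun t => a t * b t) (a 0 * b') 0 := by
  simpa [h0] using ha.fun_mul hb

theorem pd_dilaton_family (hf : ∀ z ∈ U, Smooth f z) (hξ : ∀ z ∈ U, Smooth ξ z)
    (hdf : ∀ z ∈ U, ∀ i, pd i f z = 0) (hy : y ∈ U) (t : ℝ) (i : Fin 3) :
    pd i (fun z => f z + t * ξ z) y = t * pd i ξ y := by
  have h := dd_add (v := ee i) (hf y hy) (ContDiffAt.mul contDiffAt_const (hξ y hy) (f := fun _ => t))
  rw [dd_const_mul _ (hξ y hy), ← pd_eq_dd, ← pd_eq_dd, hdf y hy, zero_add] at h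
  exact h

theorem hessian_dilaton_family (hG : MetricOn G U) (hf : ∀ z ∈ U, Smooth f z)
    (hξ : ∀ z ∈ U, Smooth ξ z)
    (hdf : ∀ z ∈ U, ∀ i, pd i f z = 0) (hy : y ∈ U) (g : E3 → Matrix (Fin 3) (Fin 3) ℝ) (t : ℝ)
    (i j : Fin 3) :
    hessian g (fun z => f z + t * ξ z) y i j = t * hessian g ξ y i j := by
  have h : pd i (fun z => pd j (fun z => f z + t * ξ z) z) y
      = t * pd i (fun z => pd j ξ z) y := by
    rw [pd_eq_dd, dd_congr ((hG.eventually hy).mono fun z hz =>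
      pd_dilaton_family hf hξ hdf hz t j), dd_const_mul (f := pd j ξ) _ (hξ y hy).dd]
    rfl
  rw [hessian, h, hessian, mul_sub, Finset.mul_sum]
  congr 1
  refine Finset.sum_congr rfl fun k _ => ?_
  rw [pd_dilaton_family hf hξ hdf hy]
  ring

/-- The derivative at `t = 0` of the Hessian of `f + t ξ` with respect to `g + t h`, when `f` is
constant. -/
theorem hasDerivAt_hessian (hG : MetricOn G U) (hH : ∀ z, (H z).transpose = H z)
    (hHs : ∀ z ∈ U, SmoothMat H z) (hf : ∀ z ∈ U, Smooth f z) (hξ : ∀ z ∈ U, Smooth ξ z)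
    (hdf : ∀ z ∈ U, ∀ i, pd i f z = 0) (hy : y ∈ U) (i j : Fin 3) :
    HasDerivAt (fun t : ℝ => hessian (fun z => fam G H (t, z)) (fun z => f z + t * ξ z) y i j)
      (hessian G ξ y i j) 0 := by
  have hK := metricOn_fam hG hH hHs
  have h0 := zero_mem_famSet (H := H) hG hy
  have h1 : ContinuousAt (fun t : ℝ => hessian (fun z => fam G H (t, z)) ξ y i j) 0 := by
    have h2 : ContinuousAt (fun t : ℝ => pd i (fun z => pd j ξ z) y
        - ∑ k, gam e4 (fam G H) (t, y) i k j * pd k ξ y) 0 := by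
      refine continuousAt_const.sub ?_
      exact tendsto_finsetSum _ fun k _ =>
        (hasDerivAt_slice (smooth_gam hK h0 i k j)).continuousAt.mul continuousAt_const
    refine h2.congr ?_
    filter_upwards [eventually_mem_famSet hG hH hHs hy] with t ht
    simp only [hessian, ← gam_apply, gam_slice hK ht]
  have h3 : HasDerivAt (fun t : ℝ => t * hessian (fun z => fam G H (t, z)) ξ y i j)
      (hessian (fun z => fam G H ((0 : ℝ), z)) ξ y i j) 0 := by
    rw [hasDerivAt_iff_tendsto_slope]
    refine (h1.tendsto.mono_left nhdsWithin_le_nhds).congr' ?_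
    filter_upwards [self_mem_nhdsWithin] with t ht
    rw [slope_def_field]
    have : t ≠ 0 := ht
    field_simp
    ring
  rw [fam_zero] at h3
  simp only [hessian_dilaton_family hG hf hξ hdf hy]
  exact h3

/-- The linearized Einstein equation at a hyperbolic soliton. -/
theorem linearized_einstein (hG : MetricOn G U) (hH : ∀ z, (H z).transpose = H z)
    (hHs : ∀ z ∈ U, SmoothMat H z) (hf : ∀ z ∈ U, Smooth f z) (hξ : ∀ z ∈ U, Smooth ξ z)
    (hdf : ∀ z ∈ U, ∀ i, pd i f z = 0) (hκ : 0 < κ) (hk : ∀ z ∈ U, crv ee G z = (-4 / κ) • 1)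
    (hs : ∀ z ∈ U, Real.exp (2 * f z) = 48 / κ) (hy : y ∈ U)
    (hE : ∀ i j, HasDerivAt (fun t : ℝ => einsteinOp κ (fun z => fam G H (t, z))
      (fun z => f z + t * ξ z) y i j) 0 0) :
    (-7 : ℝ) • (G y * ((tau G H y).trace • (1 : Matrix (Fin 3) (Fin 3) ℝ) - tau G H y))
      + Matrix.of (fun i j => hessian G ξ y i j) - (48 / κ * ξ y) • G y = 0 := by
  have hK := metricOn_fam hG hH hHs
  have h0 := zero_mem_famSet (H := H) hG hy
  have hT := smooth_crv (v := e4) hK h0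
  have hF := hK.smooth _ h0
  have hTk : crv e4 (fam G H) ((0 : ℝ), y) = (-4 / κ) • 1 := by
    rw [← crv_slice hK h0, fam_zero, hk y hy]
  have hF0 : fam G H ((0 : ℝ), y) = G y := congrFun (fam_zero (G := G) (H := H)) y
  set Q : ℝ × E3 → Matrix (Fin 3) (Fin 3) ℝ := fun p =>
    (crv e4 (fam G H) p).trace • (1 : Matrix (Fin 3) (Fin 3) ℝ) - crv e4 (fam G H) p
      + κ • ((crv e4 (fam G H) p * crv e4 (fam G H) p).trace • (1 : Matrix (Fin 3) (Fin 3) ℝ)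
        - crv e4 (fam G H) p * crv e4 (fam G H) p) with hQdef
  have hQ1 := (SmoothMat.smul hT.trace (SmoothMat.const 1)).sub hT
  have hQ2 := (SmoothMat.smul (hT.mul hT).trace (SmoothMat.const 1)).sub (hT.mul hT)
  have hQs : SmoothMat Q ((0 : ℝ), y) := hQ1.add (SmoothMat.smul contDiffAt_const hQ2)
  have hQd : ddm tt Q ((0 : ℝ), y) = (-7 : ℝ) • ((tau G H y).trace •
      (1 : Matrix (Fin 3) (Fin 3) ℝ) - tau G H y) := by
    rw [hQdef, ddm_add hQ1 (SmoothMat.smul contDiffAt_const hQ2), ddm_const_smul _ hQ2,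
      ddm_sub (SmoothMat.smul hT.trace (SmoothMat.const 1)) hT,
      ddm_sub (SmoothMat.smul (hT.mul hT).trace (SmoothMat.const 1)) (hT.mul hT),
      ddm_smul hT.trace (SmoothMat.const 1), ddm_smul (hT.mul hT).trace (SmoothMat.const 1),
      ddm_const, dd_trace hT, dd_trace (hT.mul hT), ddm_mul hT hT, hTk]
    change _ - tau G H y + _ = _
    have : ddm tt (crv e4 (fam G H)) ((0 : ℝ), y) = tau G H y := rfl
    rw [this]
    simp only [Matrix.mul_smul, Matrix.smul_mul, mul_one, one_mul, smul_zero, add_zero,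
      Matrix.trace_add, Matrix.trace_smul, smul_sub, smul_add, smul_smul, smul_eq_mul]
    ext a b
    simp only [Matrix.add_apply, Matrix.sub_apply, Matrix.smul_apply, smul_eq_mul]
    field_simp
    ring
  have hQ0 : Q ((0 : ℝ), y) = (24 / κ) • 1 := by
    simp only [hQdef, hTk, Matrix.mul_smul, mul_one, smul_smul,
      Matrix.trace_smul, Matrix.trace_one, Fintype.card_fin, smul_eq_mul]
    ext a b
    simp only [Matrix.add_apply, Matrix.sub_apply, Matrix.smul_apply, smul_eq_mul]
    push_cast
    field_simp
    ring
  have hGQ : ddm tt (fun p => fam G H p * Q p) ((0 : ℝ), y) = (24 / κ) • H y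
      + G y * ((-7 : ℝ) • ((tau G H y).trace • (1 : Matrix (Fin 3) (Fin 3) ℝ) - tau G H y)) := by
    rw [ddm_mul hF hQs, hQ0, hQd, ddm_fam hG hHs hy, hF0, Matrix.mul_smul, mul_one]
  ext i j
  have hd1 := hasDerivAt_slice ((hF.mul hQs) i j)
  have hd2 := hasDerivAt_hessian hG hH hHs hf hξ hdf hy i j
  have hd3 : HasDerivAt (fun t : ℝ => Real.exp (2 * (f y + t * ξ y)))
      (Real.exp (2 * (f y + 0 * ξ y)) * (2 * (1 * ξ y))) 0 :=
    ((((hasDerivAt_id (0 : ℝ)).mul_const (ξ y)).const_add (f y)).const_mul 2).exp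
  have hd4 := hasDerivAt_slice (hF i j)
  have htot := ((hd1.add hd2).sub ((hd3.const_mul (1 / 2)).fun_mul hd4))
  have heq : (fun t : ℝ => einsteinOp κ (fun z => fam G H (t, z)) (fun z => f z + t * ξ z) y i j)
      =ᶠ[nhds 0] fun t => ((fam G H (t, y) * Q (t, y)) i j
        + hessian (fun z => fam G H (t, z)) (fun z => f z + t * ξ z) y i j)
        - (1 / 2) * Real.exp (2 * (f y + t * ξ y)) * fam G H (t, y) i j := by
    filter_upwards [eventually_mem_famSet hG hH hHs hy] with t ht
    have hKt := metricOn_slice hK t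
    rw [einsteinOp, ricci_eq hKt ht, riemannCirc_eq hKt ht, crv_slice hK ht]
    simp only [hQdef]
    rw [Matrix.mul_add, Matrix.mul_smul, Matrix.add_apply, Matrix.smul_apply, smul_eq_mul]
    ring
  have hu := (hE i j).unique (htot.congr_of_eventuallyEq heq)
  have e1 : dd tt (fun z => (fam G H z * Q z) i j) ((0 : ℝ), y)
      = ddm tt (fun p => fam G H p * Q p) ((0 : ℝ), y) i j := rfl
  have e2 : dd tt (fun z => fam G H z i j) ((0 : ℝ), y) = H y i j := by
    rw [← ddm_fam hG hHs hy]; rfl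
  rw [e1, e2, hGQ, hF0] at hu
  simp only [Matrix.add_apply, Matrix.sub_apply, Matrix.smul_apply, smul_eq_mul, Matrix.of_apply,
    Matrix.zero_apply, Matrix.mul_smul, zero_mul, add_zero, hs y hy] at hu ⊢
  linear_combination -hu

/-- The linearized dilaton equation at a hyperbolic soliton. -/
theorem linearized_dilaton (hG : MetricOn G U) (hH : ∀ z, (H z).transpose = H z)
    (hHs : ∀ z ∈ U, SmoothMat H z) (hf : ∀ z ∈ U, Smooth f z) (hξ : ∀ z ∈ U, Smooth ξ z)
    (hdf : ∀ z ∈ U, ∀ i, pd i f z = 0) (hκ : 0 < κ) (hk : ∀ z ∈ U, crv ee G z = (-4 / κ) • 1)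
    (hs : ∀ z ∈ U, Real.exp (2 * f z) = 48 / κ) (hy : y ∈ U)
    (hD : HasDerivAt (fun t : ℝ => dilatonOp κ (fun z => fam G H (t, z))
      (fun z => f z + t * ξ z) y) 0 0) :
    -((G y)⁻¹ * Matrix.of (fun i j => hessian G ξ y i j)).trace - 2 * (48 / κ) * ξ y
      - 8 * (tau G H y).trace = 0 := by
  have hK := metricOn_fam hG hH hHs
  have h0 := zero_mem_famSet (H := H) hG hy
  have hT := smooth_crv (v := e4) hK h0
  have hF := hK.smooth _ h0
  have hN := hF.inv (hK.det_ne_zero _ h0)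
  have hTk : crv e4 (fam G H) ((0 : ℝ), y) = (-4 / κ) • 1 := by
    rw [← crv_slice hK h0, fam_zero, hk y hy]
  have hF0 : fam G H ((0 : ℝ), y) = G y := congrFun (fam_zero (G := G) (H := H)) y
  have hhess0 : ∀ i j, hessian (fun z => fam G H ((0 : ℝ), z)) (fun z => f z + 0 * ξ z) y i j = 0 :=
    fun i j => by rw [hessian_dilaton_family hG hf hξ hdf hy, zero_mul]
  have hd1 : HasDerivAt (fun t : ℝ => codiffGrad (fun z => fam G H (t, z))
      (fun z => f z + t * ξ z) y) (-∑ i, ∑ j, (fam G H ((0 : ℝ), y))⁻¹ i j * hessian G ξ y i j)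
      0 := by
    unfold codiffGrad
    refine HasDerivAt.neg (HasDerivAt.fun_sum fun i _ => HasDerivAt.fun_sum fun j _ => ?_)
    exact hasDerivAt_mul_of_eq_zero (hasDerivAt_slice (hN i j))
      (hasDerivAt_hessian hG hH hHs hf hξ hdf hy i j) (hhess0 i j)
  have hd2 : HasDerivAt (fun t : ℝ => normSqGrad (fun z => fam G H (t, z))
      (fun z => f z + t * ξ z) y) (∑ i, ∑ j, (fam G H ((0 : ℝ), y))⁻¹ i j * (0 * pd i ξ y)
        * (1 * pd j ξ y)) 0 := by
    unfold normSqGrad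
    refine HasDerivAt.fun_sum fun i _ => HasDerivAt.fun_sum fun j _ => ?_
    simp only [pd_dilaton_family hf hξ hdf hy]
    refine hasDerivAt_mul_of_eq_zero ((hasDerivAt_slice (hN i j)).mul
      ((hasDerivAt_id (0 : ℝ)).mul_const _)) ((hasDerivAt_id (0 : ℝ)).mul_const (pd j ξ y)) ?_
    simp
  have hd3 : HasDerivAt (fun t : ℝ => Real.exp (2 * (f y + t * ξ y)))
      (Real.exp (2 * (f y + 0 * ξ y)) * (2 * (1 * ξ y))) 0 :=
    ((((hasDerivAt_id (0 : ℝ)).mul_const (ξ y)).const_add (f y)).const_mul 2).exp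
  have hd4 := (hasDerivAt_slice (hT.mul hT).trace).const_mul κ
  have htot := ((hd1.add hd2).sub hd3).add hd4
  have heq : (fun t : ℝ => dilatonOp κ (fun z => fam G H (t, z)) (fun z => f z + t * ξ z) y)
      =ᶠ[nhds 0] fun t => codiffGrad (fun z => fam G H (t, z)) (fun z => f z + t * ξ z) y
        + normSqGrad (fun z => fam G H (t, z)) (fun z => f z + t * ξ z) y
        - Real.exp (2 * (f y + t * ξ y))
        + κ * (crv e4 (fam G H) (t, y) * crv e4 (fam G H) (t, y)).trace := by
    filter_upwards [eventually_mem_famSet hG hH hHs hy] with t ht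
    rw [dilatonOp, riemannNormSq_eq (metricOn_slice hK t) ht, crv_slice hK ht]
  have hu := hD.unique (htot.congr_of_eventuallyEq heq)
  have e2 : dd tt (fun z => (crv e4 (fam G H) z * crv e4 (fam G H) z).trace) ((0 : ℝ), y)
      = -8 / κ * (tau G H y).trace := by
    rw [dd_trace (hT.mul hT), ddm_mul hT hT, hTk]
    change (tau G H y * _ + _ * tau G H y).trace = _
    rw [Matrix.mul_smul, Matrix.smul_mul, mul_one, one_mul, Matrix.trace_add, Matrix.trace_smul,
      smul_eq_mul]
    ring
  have e3 : ((G y)⁻¹ * Matrix.of (fun i j => hessian G ξ y i j)).trace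
      = ∑ i, ∑ j, (G y)⁻¹ i j * hessian G ξ y i j := by
    simp only [Matrix.trace, Matrix.diag, Matrix.mul_apply, Matrix.of_apply]
    exact Finset.sum_congr rfl fun i _ => Finset.sum_congr rfl fun j _ => by
      rw [hessian_symm hG (hξ y hy)]
  rw [e2, hF0] at hu
  rw [e3]
  simp only [zero_mul, mul_zero, Finset.sum_const_zero, add_zero, hs y hy] at hu
  have e4' : κ * (-8 / κ * (tau G H y).trace) = -8 * (tau G H y).trace := by field_simp
  rw [e4'] at hu
  linarith

/-- The linearized Yang-Mills equation at a hyperbolic soliton. -/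
theorem linearized_yangMills (hG : MetricOn G U) (hH : ∀ z, (H z).transpose = H z)
    (hHs : ∀ z ∈ U, SmoothMat H z) (hf : ∀ z ∈ U, Smooth f z) (hξ : ∀ z ∈ U, Smooth ξ z)
    (hdf : ∀ z ∈ U, ∀ i, pd i f z = 0) {k : ℝ} (hk : ∀ z ∈ U, crv ee G z = k • 1)
    (hy : y ∈ U)
    (hY : ∀ i j k, HasDerivAt (fun t : ℝ => yangMillsOp (fun z => fam G H (t, z))
      (fun z => f z + t * ξ z) y i j k) 0 0) (q a b : Fin 3) :
    ∑ p, (G y)⁻¹ p q * ((ddm (ee p) (tau G H) y + (gam ee G y p * tau G H y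
        - tau G H y * gam ee G y p) - (k * pd p ξ y) • 1) * (G y)⁻¹) a b
      = ∑ p, (G y)⁻¹ p a * ((ddm (ee p) (tau G H) y + (gam ee G y p * tau G H y
        - tau G H y * gam ee G y p) - (k * pd p ξ y) • 1) * (G y)⁻¹) q b := by
  have hK := metricOn_fam hG hH hHs
  have h0 := zero_mem_famSet (H := H) hG hy
  have hT := smooth_crv (v := e4) hK h0
  have hF := hK.smooth _ h0
  have hN := hF.inv (hK.det_ne_zero _ h0)
  have hDc := fun p => smooth_dcrv hK h0 p
  have hTk : crv e4 (fam G H) ((0 : ℝ), y) = k • 1 := by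
    rw [← crv_slice hK h0, fam_zero, hk y hy]
  have hF0 : fam G H ((0 : ℝ), y) = G y := congrFun (fam_zero (G := G) (H := H)) y
  have hdc := fun p => ddm_dcrv hG hH hHs hk hy p
  set D : Fin 3 → Matrix (Fin 3) (Fin 3) ℝ := fun p => ddm (ee p) (tau G H) y
    + (gam ee G y p * tau G H y - tau G H y * gam ee G y p) with hDdef
  -- the bracket in the Yang-Mills operator, which vanishes at `t = 0`
  have hz : ∀ p a b, HasDerivAt (fun t : ℝ => (dcrv e4 (fam G H) (t, y) p
      * (fam G H (t, y))⁻¹) a b - t * pd p ξ y * (crv e4 (fam G H) (t, y)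
      * (fam G H (t, y))⁻¹) a b) (((D p - (k * pd p ξ y) • 1) * (G y)⁻¹) a b) 0 := by
    intro p a b
    have h1 := hasDerivAt_slice (((hDc p).mul hN) a b)
    have h2 := ((hasDerivAt_id (0 : ℝ)).mul_const (pd p ξ y)).fun_mul
      (hasDerivAt_slice ((hT.mul hN) a b))
    have e1 : dd tt (fun z => (dcrv e4 (fam G H) z p * (fam G H z)⁻¹) a b) ((0 : ℝ), y)
        = (D p * (G y)⁻¹) a b := by
      have : ddm tt (fun z => dcrv e4 (fam G H) z p * (fam G H z)⁻¹) ((0 : ℝ), y)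
          = D p * (G y)⁻¹ := by
        rw [ddm_mul (hDc p) hN, (hdc p).1, (hdc p).2, zero_mul, add_zero, hF0]
      rw [← this]; rfl
    rw [e1] at h1
    refine (h1.fun_sub h2).congr_deriv ?_
    beta_reduce
    rw [hTk, hF0, sub_mul, Matrix.sub_apply, Matrix.smul_mul, Matrix.smul_mul, one_mul,
      Matrix.smul_apply, Matrix.smul_apply, smul_eq_mul, smul_eq_mul]
    simp
    ring
  have hz0 : ∀ p a b, (dcrv e4 (fam G H) ((0 : ℝ), y) p
      * (fam G H ((0 : ℝ), y))⁻¹) a b - 0 * pd p ξ y * (crv e4 (fam G H) ((0 : ℝ), y)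
      * (fam G H ((0 : ℝ), y))⁻¹) a b = 0 := by
    intro p a b
    rw [(hdc p).1]
    simp
  refine symm_of_sum_eps (hG.det_ne_zero y hy)
    (M := fun p => (D p - (k * pd p ξ y) • 1) * (G y)⁻¹) (fun i j l => ?_) q a b
  have heq : (fun t : ℝ => yangMillsOp (fun z => fam G H (t, z)) (fun z => f z + t * ξ z) y i j l)
      =ᶠ[nhds 0] fun t => (fam G H (t, y)).det * ∑ b, eps j l b * ∑ p, ∑ q, ∑ a,
        (fam G H (t, y))⁻¹ p q * eps q i a * ((dcrv e4 (fam G H) (t, y) p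
      * (fam G H (t, y))⁻¹) a b - t * pd p ξ y * (crv e4 (fam G H) (t, y)
      * (fam G H (t, y))⁻¹) a b) := by
    filter_upwards [eventually_mem_famSet hG hH hHs hy] with t ht
    have hKt := metricOn_slice hK t
    rw [yangMillsOp, divRiemann_eq hKt ht, riemannGrad_eq hKt ht, ← sub_eq_add_neg, ← mul_sub,
      ← Finset.sum_sub_distrib]
    congr 1
    refine Finset.sum_congr rfl fun b _ => ?_
    rw [← mul_sub, ← Finset.sum_sub_distrib]
    congr 1
    refine Finset.sum_congr rfl fun p _ => ?_
    rw [← Finset.sum_sub_distrib]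
    refine Finset.sum_congr rfl fun q _ => ?_
    rw [← Finset.sum_sub_distrib]
    refine Finset.sum_congr rfl fun a _ => ?_
    rw [dcrv_slice hK ht, crv_slice hK ht, pd_dilaton_family hf hξ hdf hy, Matrix.smul_apply,
      smul_eq_mul]
    ring
  have hN' : ∀ p q i a, HasDerivAt (fun t : ℝ => (fam G H (t, y))⁻¹ p q * eps q i a) _ 0 :=
    fun p q i a => (hasDerivAt_slice (hN p q)).mul_const (eps q i a)
  have hder : HasDerivAt (fun t : ℝ => (fam G H (t, y)).det * ∑ b, eps j l b * ∑ p, ∑ q, ∑ a,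
        (fam G H (t, y))⁻¹ p q * eps q i a * ((dcrv e4 (fam G H) (t, y) p
      * (fam G H (t, y))⁻¹) a b - t * pd p ξ y * (crv e4 (fam G H) (t, y)
      * (fam G H (t, y))⁻¹) a b)) ((fam G H ((0 : ℝ), y)).det * ∑ b, eps j l b * ∑ p, ∑ q, ∑ a,
        (fam G H ((0 : ℝ), y))⁻¹ p q * eps q i a * ((D p - (k * pd p ξ y) • 1) * (G y)⁻¹) a b)
      0 := by
    refine hasDerivAt_mul_of_eq_zero (hasDerivAt_slice hF.det)
      (HasDerivAt.fun_sum fun b _ => HasDerivAt.const_mul _ (HasDerivAt.fun_sum fun p _ =>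
        HasDerivAt.fun_sum fun q _ => HasDerivAt.fun_sum fun a _ =>
          hasDerivAt_mul_of_eq_zero (hN' p q i a) (hz p a b) (hz0 p a b))) ?_
    simp only [hz0, mul_zero, Finset.sum_const_zero]
  have hu := (hY i j l).unique (hder.congr_of_eventuallyEq heq)
  rw [hF0] at hu
  exact hu.symm

end Linearized

/-! ### Rigidity of the dilaton and of the curvature under deformation -/

section Rigidity

variable {G H : E3 → Matrix (Fin 3) (Fin 3) ℝ} {U : Set E3} {y : E3} {f ξ : E3 → ℝ} {κ : ℝ}

/-- The Hessian of `ξ` as an endomorphism. -/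
noncomputable def hessMat (G : E3 → Matrix (Fin 3) (Fin 3) ℝ) (ξ : E3 → ℝ) (y : E3) :
    Matrix (Fin 3) (Fin 3) ℝ :=
  (G y)⁻¹ * Matrix.of fun i j => hessian G ξ y i j

theorem smooth_hessian (hG : MetricOn G U) (hy : y ∈ U) (hξ : Smooth ξ y) :
    SmoothMat (fun z => Matrix.of fun i j => hessian G ξ z i j) y := by
  intro i j
  have h1 : Smooth (fun z => pd i (fun z => pd j ξ z) z) y := (hξ.dd (v := ee j)).dd (v := ee i)
  have h2 : Smooth (fun z => ∑ k, christoffel G z k i j * pd k ξ z) y :=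
    Smooth.sum' fun k _ => ContDiffAt.mul (smooth_gam (v := ee) hG hy i k j) (hξ.dd (v := ee k))
  exact ContDiffAt.sub h1 h2

theorem smooth_hessMat (hG : MetricOn G U) (hy : y ∈ U) (hξ : Smooth ξ y) :
    SmoothMat (hessMat G ξ) y :=
  ((hG.smooth y hy).inv (hG.det_ne_zero y hy)).mul (smooth_hessian hG hy hξ)

/-- The covariant derivative of a field of endomorphisms. -/
noncomputable def covEnd (G S : E3 → Matrix (Fin 3) (Fin 3) ℝ) (y : E3) (p : Fin 3) :
    Matrix (Fin 3) (Fin 3) ℝ :=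
  ddm (ee p) S y + (gam ee G y p * S y - S y * gam ee G y p)

/-- The gradient of `ξ`; each column of the matrix is the gradient, so that the rules for matrices
apply. -/
noncomputable def gradMat (G : E3 → Matrix (Fin 3) (Fin 3) ℝ) (ξ : E3 → ℝ) (y : E3) :
    Matrix (Fin 3) (Fin 3) ℝ :=
  (G y)⁻¹ * Matrix.of fun n _ => pd n ξ y

theorem smooth_gradMat (hG : MetricOn G U) (hy : y ∈ U) (hξ : Smooth ξ y) :
    SmoothMat (gradMat G ξ) y :=
  ((hG.smooth y hy).inv (hG.det_ne_zero y hy)).mul fun n _ => hξ.dd (v := ee n)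

/-- The Hessian endomorphism is the covariant derivative of the gradient. -/
theorem hessMat_apply (hG : MetricOn G U) (hy : y ∈ U) (hξ : Smooth ξ y) (a b c : Fin 3) :
    hessMat G ξ y a b = (ddm (ee b) (gradMat G ξ) y + gam ee G y b * gradMat G ξ y) a c := by
  have hN := (hG.smooth y hy).inv (hG.det_ne_zero y hy)
  have hP : SmoothMat (fun z => Matrix.of fun n (_ : Fin 3) => pd n ξ z) y :=
    fun n _ => hξ.dd (v := ee n)
  have e : gradMat G ξ = fun z => (G z)⁻¹ * Matrix.of fun n (_ : Fin 3) => pd n ξ z := rfl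
  have e2 : ddm (ee b) (gradMat G ξ) y + gam ee G y b * gradMat G ξ y
      = (G y)⁻¹ * (ddm (ee b) (fun z => Matrix.of fun n (_ : Fin 3) => pd n ξ z) y
        - (gam ee G y b).transpose * Matrix.of fun n (_ : Fin 3) => pd n ξ y) := by
    rw [e, ddm_mul hN hP, ddm_inv_metric hG hy]
    noncomm_ring
  rw [e2, hessMat, Matrix.mul_apply, Matrix.mul_apply]
  refine Finset.sum_congr rfl fun n _ => ?_
  rw [Matrix.of_apply, hessian_symm hG hξ]
  rfl

/-- The Ricci identity for the gradient. -/
theorem covEnd_hessMat_curl (hG : MetricOn G U) (hξ : ∀ z ∈ U, Smooth ξ z) (hy : y ∈ U)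
    (p q a : Fin 3) :
    covEnd G (hessMat G ξ) y p a q - covEnd G (hessMat G ξ) y q a p
      = (Om ee G y p q * gradMat G ξ y) a 0 := by
  have hV := smooth_gradMat hG hy (hξ y hy)
  have hg := fun p => smooth_gam (v := ee) hG hy p
  have e1 : ∀ p q, ddm (ee p) (hessMat G ξ) y a q
      = (ddm (ee p) (ddm (ee q) (gradMat G ξ)) y
        + (ddm (ee p) (fun z => gam ee G z q) y * gradMat G ξ y
          + gam ee G y q * ddm (ee p) (gradMat G ξ) y)) a 0 := by
    intro p q
    rw [← ddm_mul (hg q) hV, ← ddm_add hV.ddm ((hg q).mul hV)]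
    exact dd_congr ((hG.eventually hy).mono fun z hz => hessMat_apply hG hz (hξ z hz) a q 0)
  have e2 : ∀ p q, (gam ee G y p * hessMat G ξ y) a q
      = (gam ee G y p * (ddm (ee q) (gradMat G ξ) y + gam ee G y q * gradMat G ξ y)) a 0 := by
    intro p q
    rw [Matrix.mul_apply, Matrix.mul_apply]
    exact Finset.sum_congr rfl fun m _ => by rw [hessMat_apply hG hy (hξ y hy) m q 0]
  have e3 : (hessMat G ξ y * gam ee G y p) a q = (hessMat G ξ y * gam ee G y q) a p := by
    rw [Matrix.mul_apply, Matrix.mul_apply]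
    exact Finset.sum_congr rfl fun m _ => by rw [gam_symm hG]
  simp only [covEnd, Matrix.add_apply _ _ a, Matrix.sub_apply _ _ a]
  rw [e1, e1, e2, e2, e3, ddm_comm hV]
  have e4 : Om ee G y p q * gradMat G ξ y = ddm (ee p) (fun z => gam ee G z q) y * gradMat G ξ y
      - ddm (ee q) (fun z => gam ee G z p) y * gradMat G ξ y
      + (gam ee G y p * (gam ee G y q * gradMat G ξ y)
        - gam ee G y q * (gam ee G y p * gradMat G ξ y)) := by
    rw [Om]; noncomm_ring
  rw [e4]
  simp only [mul_add, Matrix.add_apply, Matrix.sub_apply]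
  ring

theorem covEnd_hessMat_symm (hG : MetricOn G U) (hξ : ∀ z ∈ U, Smooth ξ z) (hy : y ∈ U)
    (p : Fin 3) : (covEnd G (hessMat G ξ) y p * (G y)⁻¹).transpose
      = covEnd G (hessMat G ξ) y p * (G y)⁻¹ := by
  have hN := (hG.smooth y hy).inv (hG.det_ne_zero y hy)
  have hX := smooth_hessMat hG hy (hξ y hy)
  have hsym : ∀ z ∈ U, (hessMat G ξ z * (G z)⁻¹).transpose = hessMat G ξ z * (G z)⁻¹ := by
    intro z hz
    have : (Matrix.of fun i j => hessian G ξ z i j).transpose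
        = Matrix.of fun i j => hessian G ξ z i j := by
      ext i j; exact hessian_symm hG (hξ z hz) j i
    rw [hessMat, Matrix.transpose_mul, Matrix.transpose_mul, hG.inv_transpose, this, mul_assoc]
  have h1 : (ddm (ee p) (fun z => hessMat G ξ z * (G z)⁻¹) y).transpose
      = ddm (ee p) (fun z => hessMat G ξ z * (G z)⁻¹) y := by
    rw [← ddm_transpose]
    exact ddm_congr ((hG.eventually hy).mono fun z hz => hsym z hz)
  have h2 : covEnd G (hessMat G ξ) y p * (G y)⁻¹
      = ddm (ee p) (fun z => hessMat G ξ z * (G z)⁻¹) y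
        + (hessMat G ξ y * (G y)⁻¹ * (gam ee G y p).transpose
          + gam ee G y p * (hessMat G ξ y * (G y)⁻¹)) := by
    rw [ddm_mul hX hN, ddm_inv_metric hG hy, covEnd]
    noncomm_ring
  rw [h2, Matrix.transpose_add, Matrix.transpose_add, h1, Matrix.transpose_mul,
    Matrix.transpose_mul (gam ee G y p), hsym y hy, Matrix.transpose_transpose]
  congr 1
  abel

/-- If `c i j k` is symmetric in its last two indices and contracting the first one with `G⁻¹`
gives an array symmetric in the first two, the fully lowered array is symmetric. -/
theorem lower_symm {N g : Matrix (Fin 3) (Fin 3) ℝ} (hNg : N * g = 1)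
    {Z : Fin 3 → Matrix (Fin 3) (Fin 3) ℝ} (hs : ∀ p, (Z p * N).transpose = Z p * N)
    (h : ∀ q a b, ∑ p, N p q * (Z p * N) a b = ∑ p, N p a * (Z p * N) q b) (m p a : Fin 3) :
    Z p m a = Z a m p := by
  have h1 : ∀ q a b, ∑ p, N p q * (Z p * N) a b = ∑ p, N p b * (Z p * N) a q := by
    have hs' : ∀ p a b, (Z p * N) a b = (Z p * N) b a := fun p a b =>
      congrFun (congrFun (hs p) b) a
    intro q a b
    calc _ = ∑ p, N p q * (Z p * N) b a := Finset.sum_congr rfl fun p _ => by rw [hs']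
      _ = ∑ p, N p b * (Z p * N) q a := h q b a
      _ = _ := Finset.sum_congr rfl fun p _ => by rw [hs']
  have h2 : ∀ p a b, (Z p * N) a b = ∑ q, g q p * ∑ r, N r b * (Z r * N) a q := by
    intro p a b
    have := sum_lower N g (fun r => Z r * N) p a b
    rw [hNg] at this
    have e : ∑ q, g q p * ∑ r, N r q * (Z r * N) a b = ∑ q, g q p * ∑ r, N r b * (Z r * N) a q :=
      Finset.sum_congr rfl fun q _ => by rw [h1 q a b]
    rw [← e, this]
    simp [Matrix.one_apply]
  have h3 : ∀ p a b, (Z p * N * g) a b = ∑ r, (N * g) r b * (Z r * N * g) a p := by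
    intro p a b
    rw [Matrix.mul_apply]
    simp only [h2 p]
    simp only [Matrix.mul_apply, Fin.sum_univ_three]
    ring
  have h4 := h3 p m a
  simp only [mul_assoc, hNg, mul_one] at h4
  rw [h4]
  simp [Matrix.one_apply]

/-- The linearized soliton equations at a hyperbolic soliton force the variation of the dilaton and
the first variation of the curvature operator to vanish. -/
theorem variation_eq_zero (hG : MetricOn G U) (hH : ∀ z, (H z).transpose = H z)
    (hHs : ∀ z ∈ U, SmoothMat H z) (hf : ∀ z ∈ U, Smooth f z) (hξ : ∀ z ∈ U, Smooth ξ z)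
    (hdf : ∀ z ∈ U, ∀ i, pd i f z = 0) (hκ : 0 < κ) (hk : ∀ z ∈ U, crv ee G z = (-4 / κ) • 1)
    (hs : ∀ z ∈ U, Real.exp (2 * f z) = 48 / κ)
    (hE : ∀ z ∈ U, ∀ i j, HasDerivAt (fun t : ℝ => einsteinOp κ (fun z => fam G H (t, z))
      (fun z => f z + t * ξ z) z i j) 0 0)
    (hY : ∀ z ∈ U, ∀ i j k, HasDerivAt (fun t : ℝ => yangMillsOp (fun z => fam G H (t, z))
      (fun z => f z + t * ξ z) z i j k) 0 0)
    (hD : ∀ z ∈ U, HasDerivAt (fun t : ℝ => dilatonOp κ (fun z => fam G H (t, z))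
      (fun z => f z + t * ξ z) z) 0 0) (hy : y ∈ U) :
    ξ y = 0 ∧ tau G H y = 0 := by
  -- the algebraic consequences of the Einstein and dilaton equations
  have halg : ∀ z ∈ U, (tau G H z).trace = -(5 / 22) * (48 / κ) * ξ z ∧
      tau G H z = (-(13 / 154) * (48 / κ) * ξ z) • 1 - (1 / 7 : ℝ) • hessMat G ξ z := by
    intro z hz
    have h1 := linearized_einstein hG hH hHs hf hξ hdf hκ hk hs hz (hE z hz)
    have h2 := linearized_dilaton hG hH hHs hf hξ hdf hκ hk hs hz (hD z hz)
    have h3 := congrArg (fun M => (G z)⁻¹ * M) h1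
    simp only [mul_add, mul_sub, Matrix.mul_smul, ← mul_assoc, hG.inv_mul hz, one_mul, mul_zero]
      at h3
    have h4 : (-7 : ℝ) • ((tau G H z).trace • (1 : Matrix (Fin 3) (Fin 3) ℝ) - tau G H z)
        + hessMat G ξ z - (48 / κ * ξ z) • (1 : Matrix (Fin 3) (Fin 3) ℝ) = 0 := h3
    have h5 := congrArg Matrix.trace h4
    simp only [Matrix.trace_add, Matrix.trace_sub, Matrix.trace_smul, Matrix.trace_one,
      Fintype.card_fin, smul_eq_mul, Matrix.trace_zero] at h5
    have h6 : -(hessMat G ξ z).trace - 2 * (48 / κ) * ξ z - 8 * (tau G H z).trace = 0 := h2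
    have h7 : (tau G H z).trace = -(5 / 22) * (48 / κ) * ξ z := by
      push_cast at h5; linarith
    refine ⟨h7, ?_⟩
    ext a b
    have h8 := congrFun (congrFun h4 a) b
    rw [h7] at h8
    simp only [Matrix.add_apply, Matrix.sub_apply, Matrix.smul_apply, smul_eq_mul,
      Matrix.zero_apply] at h8 ⊢
    linarith
  have hdξ : ∀ z ∈ U, ∀ i, pd i ξ z = 0 := by
    intro z hz
    have hX := smooth_hessMat hG hz (hξ z hz)
    set α : ℝ := -(13 / 154) * (48 / κ) + 4 / κ with hα
    set Z : Fin 3 → Matrix (Fin 3) (Fin 3) ℝ := fun p => (α * pd p ξ z) • 1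
      - (1 / 7 : ℝ) • covEnd G (hessMat G ξ) z p with hZ
    have hZeq : ∀ p, ddm (ee p) (tau G H) z + (gam ee G z p * tau G H z
        - tau G H z * gam ee G z p) - (-4 / κ * pd p ξ z) • 1 = Z p := by
      intro p
      have hsm : Smooth (fun w => -(13 / 154) * (48 / κ) * ξ w) z :=
        ContDiffAt.mul contDiffAt_const (hξ z hz)
      have e1 : ddm (ee p) (tau G H) z = (-(13 / 154) * (48 / κ) * pd p ξ z) • 1
          - (1 / 7 : ℝ) • ddm (ee p) (hessMat G ξ) z := by
        rw [ddm_congr ((hG.eventually hz).mono fun w hw => (halg w hw).2),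
          ddm_sub (SmoothMat.smul hsm (SmoothMat.const 1))
            (SmoothMat.smul contDiffAt_const hX), ddm_const_smul _ hX,
          ddm_smul hsm (SmoothMat.const 1), ddm_const, smul_zero, add_zero,
          dd_const_mul _ (hξ z hz)]
        rfl
      rw [e1, (halg z hz).2, hZ]
      simp only [covEnd, mul_sub, sub_mul, Matrix.mul_smul, Matrix.smul_mul, mul_one, one_mul,
        smul_add, smul_sub, hα, add_mul, add_smul, neg_div, neg_mul, mul_neg, neg_smul]
      abel
    have hZs : ∀ p, (Z p * (G z)⁻¹).transpose = Z p * (G z)⁻¹ := by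
      intro p
      simp only [hZ, sub_mul, Matrix.smul_mul, one_mul, Matrix.transpose_sub,
        Matrix.transpose_smul, covEnd_hessMat_symm hG hξ hz, hG.inv_transpose]
    have hYM := fun q a b => linearized_yangMills hG hH hHs hf hξ hdf hk hz (hY z hz) q a b
    simp only [hZeq] at hYM
    have hZsymm := lower_symm (hG.inv_mul hz) hZs hYM
    -- the commutator of covariant derivatives is a curvature term
    have hcurl : ∀ p q a, covEnd G (hessMat G ξ) z p a q - covEnd G (hessMat G ξ) z q a p
        = (-4 / κ) * ((1 : Matrix (Fin 3) (Fin 3) ℝ) a p * pd q ξ z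
          - (1 : Matrix (Fin 3) (Fin 3) ℝ) a q * pd p ξ z) := by
      intro p q a
      have hGv : ∀ q, ∑ m, G z q m * gradMat G ξ z m 0 = pd q ξ z := by
        intro q
        have : (G z * gradMat G ξ z) q 0 = pd q ξ z := by
          rw [gradMat, ← mul_assoc, hG.mul_inv hz, one_mul]; rfl
        rw [← this, Matrix.mul_apply]
      have e : ∀ m, Om ee G z p q a m = (-4 / κ) * ((1 : Matrix (Fin 3) (Fin 3) ℝ) a p * G z q m
          - (1 : Matrix (Fin 3) (Fin 3) ℝ) a q * G z p m) := by
        intro m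
        rw [Om_eq_sum_eps hG hz, hk z hz]
        fin_cases p <;> fin_cases q <;> fin_cases a <;>
          simp [eps, Fin.sum_univ_three, Matrix.one_apply]
      rw [covEnd_hessMat_curl hG hξ hz, Matrix.mul_apply]
      simp only [e]
      rw [← hGv, ← hGv]
      simp only [Fin.sum_univ_three]
      ring
    -- the total symmetry of `Z` determines the same commutator, with a different coefficient
    have hfin : ∀ m p a : Fin 3, α * pd p ξ z * (1 : Matrix (Fin 3) (Fin 3) ℝ) m a
        - α * pd a ξ z * (1 : Matrix (Fin 3) (Fin 3) ℝ) m p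
        = (1 / 7) * ((-4 / κ) * ((1 : Matrix (Fin 3) (Fin 3) ℝ) m p * pd a ξ z
          - (1 : Matrix (Fin 3) (Fin 3) ℝ) m a * pd p ξ z)) := by
      intro m p a
      have h1 := hZsymm m p a
      simp only [hZ, Matrix.sub_apply, Matrix.smul_apply, smul_eq_mul] at h1
      rw [← hcurl p a m]
      linarith
    have hcoef : α + (1 / 7) * (-4 / κ) ≠ 0 := by
      have : α + (1 / 7) * (-4 / κ) = (-(13 / 154) * 48 + 4 - 4 / 7) / κ := by
        rw [hα]; field_simp; ring
      rw [this]
      exact div_ne_zero (by norm_num) hκ.ne'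
    intro i
    have h1 := hfin (i + 1) i (i + 1)
    have hne : i + 1 ≠ i := by fin_cases i <;> decide
    rw [Matrix.one_apply_eq, Matrix.one_apply_ne hne] at h1
    have h2 : (α + (1 / 7) * (-4 / κ)) * pd i ξ z = 0 := by linarith
    exact (mul_eq_zero.1 h2).resolve_left hcoef
  have hH0 : hessMat G ξ y = 0 := by
    have : (Matrix.of fun i j => hessian G ξ y i j) = (0 : Matrix (Fin 3) (Fin 3) ℝ) := by
      ext i j
      exact hessian_eq_zero hG hdξ hy i j
    rw [hessMat, this, mul_zero]
  obtain ⟨h1, h2⟩ := halg y hy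
  rw [hH0, smul_zero, sub_zero] at h2
  have h3 := congrArg Matrix.trace h2
  rw [h1, Matrix.trace_smul, Matrix.trace_one, Fintype.card_fin, smul_eq_mul] at h3
  have h4 : 48 / κ * ξ y = 0 := by push_cast at h3; linarith
  have h5 : ξ y = 0 := (mul_eq_zero.1 h4).resolve_left (by positivity)
  exact ⟨h5, by rw [h2, h5, mul_zero, zero_smul]⟩

end Rigidity

/-! ### The first variation of the connection -/

section Connection

variable {G H : E3 → Matrix (Fin 3) (Fin 3) ℝ} {U : Set E3} {y : E3} {k : ℝ}

theorem smooth_dgam (hG : MetricOn G U) (hH : ∀ z, (H z).transpose = H z)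
    (hHs : ∀ z ∈ U, SmoothMat H z) (hy : y ∈ U) (p : Fin 3) :
    SmoothMat (fun z => dgam G H z p) y := fun a b =>
  Smooth.slice (f := fun q => ddm tt (fun q => gam e4 (fam G H) q p) q a b)
    ((smooth_gam (metricOn_fam hG hH hHs) (zero_mem_famSet hG hy) p).ddm a b)

theorem dgam_symm (hG : MetricOn G U) (hH : ∀ z, (H z).transpose = H z)
    (hHs : ∀ z ∈ U, SmoothMat H z) (y : E3) (p l j : Fin 3) :
    dgam G H y p l j = dgam G H y j l p := by
  have : (fun q => gam e4 (fam G H) q p l j) = fun q => gam e4 (fam G H) q j l p :=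
    funext fun q => gam_symm (metricOn_fam hG hH hHs) q p l j
  simp only [dgam, ddm_apply, this]

/-- The covariant derivative of a field of bilinear forms. -/
noncomputable def covLow (G H : E3 → Matrix (Fin 3) (Fin 3) ℝ) (y : E3) (p : Fin 3) :
    Matrix (Fin 3) (Fin 3) ℝ :=
  ddm (ee p) H y - ((gam ee G y p).transpose * H y + H y * gam ee G y p)

theorem covBilin_eq (p i j : Fin 3) : covBilin G H y p i j = covLow G H y p i j := by
  simp only [covBilin, covLow, Matrix.sub_apply, Matrix.add_apply, Matrix.mul_apply,
    Matrix.transpose_apply, ← Finset.sum_add_distrib, ← gam_apply]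
  congr 1
  exact Finset.sum_congr rfl fun m _ => by ring

theorem covLow_transpose (hH : ∀ z, (H z).transpose = H z) (p : Fin 3) :
    (covLow G H y p).transpose = covLow G H y p := by
  have h1 : (ddm (ee p) H y).transpose = ddm (ee p) H y := by
    ext a b; exact ddm_symm hH (ee p) b a
  rw [covLow, Matrix.transpose_sub, h1, Matrix.transpose_add, Matrix.transpose_mul,
    Matrix.transpose_mul, Matrix.transpose_transpose, hH]
  congr 1
  abel

theorem covLow_eq_dgam (hG : MetricOn G U) (hH : ∀ z, (H z).transpose = H z)
    (hHs : ∀ z ∈ U, SmoothMat H z) (hy : y ∈ U) (p : Fin 3) :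
    covLow G H y p = (dgam G H y p).transpose * G y + G y * dgam G H y p := by
  have hK := metricOn_fam hG hH hHs
  have h0 := zero_mem_famSet (H := H) hG hy
  have hF := hK.smooth _ h0
  have hg := smooth_gam (v := e4) hK h0 p
  have hF0 : fam G H ((0 : ℝ), y) = G y := congrFun (fam_zero (G := G) (H := H)) y
  have hg0 : gam e4 (fam G H) ((0 : ℝ), y) p = gam ee G y p := by
    rw [← gam_slice hK h0, fam_zero]
  have e : ddm (e4 p) (fam G H) =ᶠ[nhds ((0 : ℝ), y)] fun q =>
      (gam e4 (fam G H) q p).transpose * fam G H q + fam G H q * gam e4 (fam G H) q p :=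
    (hK.eventually h0).mono fun q hq => ddm_metric hK hq p
  have h1 := ddm_congr (v := tt) e
  rw [ddm_comm hF, ddm_add (hg.transpose.mul hF) (hF.mul hg), ddm_mul hg.transpose hF,
    ddm_mul hF hg, ddm_transpose, ddm_fam hG hHs hy, hF0, hg0] at h1
  have h2 : ddm (e4 p) (ddm tt (fam G H)) ((0 : ℝ), y) = ddm (ee p) H y := by
    have := ddm_slice (F := ddm tt (fam G H)) hF.ddm (ee p)
    refine Eq.trans this.symm ?_
    exact ddm_congr ((hG.eventually hy).mono fun z hz => ddm_fam hG hHs hz)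
  rw [h2] at h1
  rw [covLow, h1]
  change (dgam G H y p).transpose * G y + _ + (_ + G y * dgam G H y p) - _ = _
  abel

/-- If the first variation of the curvature operator vanishes, the exterior covariant derivative of
the variation of the connection is the variation of a tensor of constant curvature. -/
theorem dgam_curl (hG : MetricOn G U) (hH : ∀ z, (H z).transpose = H z)
    (hHs : ∀ z ∈ U, SmoothMat H z) (hk : ∀ z ∈ U, crv ee G z = k • 1) (hy : y ∈ U)
    (hτ : tau G H y = 0) (i j l q : Fin 3) :
    (ddm (ee i) (fun z => dgam G H z j) y - ddm (ee j) (fun z => dgam G H z i) y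
      + (gam ee G y i * dgam G H y j - dgam G H y j * gam ee G y i)
      - (gam ee G y j * dgam G H y i - dgam G H y i * gam ee G y j)) l q
    = k * ((1 : Matrix (Fin 3) (Fin 3) ℝ) l i * H y j q
      - (1 : Matrix (Fin 3) (Fin 3) ℝ) l j * H y i q) := by
  have hK := metricOn_fam hG hH hHs
  have h0 := zero_mem_famSet (H := H) hG hy
  have hF := hK.smooth _ h0
  have hg := fun p => smooth_gam (v := e4) hK h0 p
  have hT := smooth_crv (v := e4) hK h0
  have hF0 : fam G H ((0 : ℝ), y) = G y := congrFun (fam_zero (G := G) (H := H)) y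
  have hg0 : ∀ p, gam e4 (fam G H) ((0 : ℝ), y) p = gam ee G y p := fun p => by
    rw [← gam_slice hK h0, fam_zero]
  have hTk : crv e4 (fam G H) ((0 : ℝ), y) = k • 1 := by
    rw [← crv_slice hK h0, fam_zero, hk y hy]
  have hmix : ∀ i j, ddm tt (ddm (e4 i) (fun q => gam e4 (fam G H) q j)) ((0 : ℝ), y)
      = ddm (ee i) (fun z => dgam G H z j) y := by
    intro i j
    rw [ddm_comm (hg j)]
    exact (ddm_slice (F := ddm tt (fun q => gam e4 (fam G H) q j)) (hg j).ddm (ee i)).symm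
  have h1 : ddm tt (fun q => Om e4 (fam G H) q i j) ((0 : ℝ), y)
      = ddm (ee i) (fun z => dgam G H z j) y - ddm (ee j) (fun z => dgam G H z i) y
      + (gam ee G y i * dgam G H y j - dgam G H y j * gam ee G y i)
      - (gam ee G y j * dgam G H y i - dgam G H y i * gam ee G y j) := by
    have e : (fun q => Om e4 (fam G H) q i j) = fun q =>
        ddm (e4 i) (fun q => gam e4 (fam G H) q j) q
        - ddm (e4 j) (fun q => gam e4 (fam G H) q i) q
        + (gam e4 (fam G H) q i * gam e4 (fam G H) q j
          - gam e4 (fam G H) q j * gam e4 (fam G H) q i) := rfl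
    rw [e, ddm_add (((hg j).ddm).sub ((hg i).ddm)) (((hg i).mul (hg j)).sub ((hg j).mul (hg i))),
      ddm_sub (hg j).ddm (hg i).ddm, ddm_sub ((hg i).mul (hg j)) ((hg j).mul (hg i)),
      ddm_mul (hg i) (hg j), ddm_mul (hg j) (hg i), hmix, hmix, hg0, hg0]
    change _ + (dgam G H y i * _ + _ * dgam G H y j - (dgam G H y j * _ + _ * dgam G H y i)) = _
    abel
  rw [← h1, ddm_apply]
  have e : (fun q' => Om e4 (fam G H) q' i j l q) =ᶠ[nhds ((0 : ℝ), y)] fun q' =>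
      ∑ a, ∑ c, ∑ d, eps i j a * eps l c d * (crv e4 (fam G H) q' a d * fam G H q' c q) :=
    (hK.eventually h0).mono fun q' hq => by
      have := Om_eq_sum_eps (v := e4) hK hq i j l q
      simp only [mul_assoc] at this ⊢
      exact this
  have hprod : ∀ a c d, Smooth (fun q' => crv e4 (fam G H) q' a d * fam G H q' c q) ((0 : ℝ), y) :=
    fun a c d => ContDiffAt.mul (hT a d) (hF c q)
  have hprod' : ∀ a c d, Smooth (fun q' => eps i j a * eps l c d *
      (crv e4 (fam G H) q' a d * fam G H q' c q)) ((0 : ℝ), y) :=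
    fun a c d => ContDiffAt.mul contDiffAt_const (hprod a c d)
  have hterm : ∀ a c d, dd tt (fun q' => eps i j a * eps l c d *
      (crv e4 (fam G H) q' a d * fam G H q' c q)) ((0 : ℝ), y)
      = eps i j a * eps l c d * ((k • (1 : Matrix (Fin 3) (Fin 3) ℝ)) a d * H y c q) := by
    intro a c d
    rw [dd_const_mul _ (hprod a c d), dd_mul (hT a d) (hF c q), hTk]
    have e1 : dd tt (fun z => crv e4 (fam G H) z a d) ((0 : ℝ), y) = tau G H y a d := rfl
    have e2 : dd tt (fun z => fam G H z c q) ((0 : ℝ), y) = H y c q := by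
      rw [← ddm_fam hG hHs hy]; rfl
    rw [e1, e2, hτ, Matrix.zero_apply, zero_mul, zero_add]
  rw [dd_congr e, dd_sum fun a _ => Smooth.sum' fun c _ => Smooth.sum' fun d _ => hprod' a c d]
  have hsum : ∀ a, dd tt (fun q' => ∑ c, ∑ d, eps i j a * eps l c d *
      (crv e4 (fam G H) q' a d * fam G H q' c q)) ((0 : ℝ), y)
      = ∑ c, ∑ d, eps i j a * eps l c d * ((k • (1 : Matrix (Fin 3) (Fin 3) ℝ)) a d * H y c q) := by
    intro a
    rw [dd_sum fun c _ => Smooth.sum' fun d _ => hprod' a c d]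
    refine Finset.sum_congr rfl fun c _ => ?_
    rw [dd_sum fun d _ => hprod' a c d]
    exact Finset.sum_congr rfl fun d _ => hterm a c d
  simp only [hsum]
  fin_cases i <;> fin_cases j <;> fin_cases l <;>
    simp [eps, Fin.sum_univ_three, Matrix.one_apply]

/-- The Riemannian divergence of a vector field, in coordinates. -/
noncomputable def divg (G : E3 → Matrix (Fin 3) (Fin 3) ℝ) (V : E3 → Fin 3 → ℝ) (y : E3) : ℝ :=
  ∑ i, (pd i (fun z => V z i) y + (gam ee G y i).trace * V y i)

/-- The metric trace of a field of bilinear forms. -/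
noncomputable def trg (G H : E3 → Matrix (Fin 3) (Fin 3) ℝ) (y : E3) : ℝ := ((G y)⁻¹ * H y).trace

theorem smooth_trg (hG : MetricOn G U) (hHs : ∀ z ∈ U, SmoothMat H z) (hy : y ∈ U) :
    Smooth (trg G H) y :=
  (((hG.smooth y hy).inv (hG.det_ne_zero y hy)).mul (hHs y hy)).trace

theorem pd_trg (hG : MetricOn G U) (hHs : ∀ z ∈ U, SmoothMat H z) (hy : y ∈ U) (p : Fin 3) :
    pd p (trg G H) y = ((G y)⁻¹ * covLow G H y p).trace := by
  have hN := (hG.smooth y hy).inv (hG.det_ne_zero y hy)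
  have h1 : pd p (trg G H) y = (ddm (ee p) (fun z => (G z)⁻¹ * H z) y).trace :=
    dd_trace (hN.mul (hHs y hy))
  rw [h1, ddm_mul hN (hHs y hy), ddm_inv_metric hG hy, covLow]
  have e : (gam ee G y p * ((G y)⁻¹ * H y)).trace = ((G y)⁻¹ * (H y * gam ee G y p)).trace := by
    rw [Matrix.trace_mul_comm, mul_assoc]
  simp only [mul_sub, mul_add, neg_mul, add_mul, Matrix.trace_add, Matrix.trace_sub,
    Matrix.trace_neg, mul_assoc]
  rw [e]
  ring

theorem trace_dgam (hG : MetricOn G U) (hH : ∀ z, (H z).transpose = H z)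
    (hHs : ∀ z ∈ U, SmoothMat H z) (hy : y ∈ U) (p : Fin 3) :
    (dgam G H y p).trace = (1 / 2) * pd p (trg G H) y := by
  rw [pd_trg hG hHs hy, covLow_eq_dgam hG hH hHs hy, mul_add, Matrix.trace_add, ← mul_assoc _ (G y),
    hG.inv_mul hy, one_mul, Matrix.trace_mul_comm, mul_assoc, hG.mul_inv hy, mul_one,
    Matrix.trace_transpose]
  ring

/-- The contraction of the variation of the connection, for a variation of the metric without
divergence. -/
theorem contract_dgam (hG : MetricOn G U) (hH : ∀ z, (H z).transpose = H z)
    (hHs : ∀ z ∈ U, SmoothMat H z) (hdiv : ∀ z ∈ U, ∀ j, divBilin G H z j = 0) (hy : y ∈ U)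
    (i : Fin 3) :
    ∑ j, ∑ q, (G y)⁻¹ j q * dgam G H y j i q = -((1 / 2) * ∑ q, (G y)⁻¹ i q * pd q (trg G H) y) := by
  have hdv : ∀ l, ∑ j, ∑ q, (G y)⁻¹ j q * covLow G H y j q l = 0 := by
    intro l
    have := hdiv y hy l
    simp only [divBilin, covBilin_eq, neg_eq_zero] at this
    exact this
  have hNs : ∀ a b, (G y)⁻¹ a b = (G y)⁻¹ b a := fun a b =>
    congrFun (congrFun (hG.inv_transpose y) b) a
  have hDs : ∀ p a b, covLow G H y p a b = covLow G H y p b a := fun p a b =>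
    congrFun (congrFun (covLow_transpose hH p) b) a
  have hlow : ∀ l, ∑ j, ∑ q, (G y)⁻¹ j q * (G y * dgam G H y j) l q
      = -((1 / 2) * pd l (trg G H) y) := by
    intro l
    have h1 := hdv l
    rw [pd_trg hG hHs hy]
    simp only [koszul (hG.symm y) (dgam_symm hG hH hHs y) (covLow_eq_dgam hG hH hHs hy)]
    simp only [Matrix.trace, Matrix.diag, Matrix.mul_apply, Fin.sum_univ_three, hNs 1 0, hNs 2 0,
      hNs 2 1, hDs _ 1 0, hDs _ 2 0, hDs _ 2 1] at h1 ⊢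
    linear_combination h1
  have h2 : ∑ l, (G y)⁻¹ i l * ∑ j, ∑ q, (G y)⁻¹ j q * (G y * dgam G H y j) l q
      = ∑ j, ∑ q, (G y)⁻¹ j q * ((G y)⁻¹ * (G y * dgam G H y j)) i q := by
    generalize hR : (fun j => G y * dgam G H y j) = R
    have hR' : ∀ j, G y * dgam G H y j = R j := fun j => congrFun hR j
    simp only [hR']
    simp only [Matrix.mul_apply, Fin.sum_univ_three]
    ring
  simp only [← mul_assoc, hG.inv_mul hy, one_mul] at h2
  rw [← h2, Finset.sum_congr rfl fun l _ => congrArg ((G y)⁻¹ i l * ·) (hlow l)]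
  simp only [Fin.sum_univ_three]
  ring

/-- For a connection `W` that is metric for the inverse metric `N`, the contracted covariant curl of a
variation `C` of the connection is the difference of the divergences of the two vector fields
`N^{jq} C_j^i_q` and `N^{iq} tr C_q`. -/
theorem trace_curl_identity {N : Matrix (Fin 3) (Fin 3) ℝ} (hN : ∀ a b, N a b = N b a)
    {W C : Fin 3 → Matrix (Fin 3) (Fin 3) ℝ} (hW : ∀ p l j, W p l j = W j l p)
    (hC : ∀ p l j, C p l j = C j l p) {dC : Fin 3 → Fin 3 → Matrix (Fin 3) (Fin 3) ℝ}
    (hdC : ∀ i p l j, dC i p l j = dC i j l p) :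
    ∑ i, ∑ j, ∑ q, N j q * (dC i j - dC j i + (W i * C j - C j * W i)
        - (W j * C i - C i * W j)) i q
      = ∑ i, (∑ j, ∑ q, (-(N * (W i).transpose + W i * N) j q * C j i q + N j q * dC i j i q)
          + (W i).trace * ∑ j, ∑ q, N j q * C j i q)
        - ∑ i, (∑ q, (-(N * (W i).transpose + W i * N) i q * (C q).trace
            + N i q * (dC i q).trace) + (W i).trace * ∑ q, N i q * (C q).trace) := by
  simp only [Matrix.trace, Matrix.diag, Matrix.add_apply, Matrix.sub_apply, Matrix.mul_apply,
    Matrix.transpose_apply, Fin.sum_univ_three, hN 1 0, hN 2 0, hN 2 1,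
    hW 1 _ 0, hW 2 _ 0, hW 2 _ 1, hC 1 _ 0, hC 2 _ 0, hC 2 _ 1, hdC _ 1 _ 0, hdC _ 2 _ 0,
    hdC _ 2 _ 1]
  ring

/-- Half the gradient of the metric trace of `H`. -/
noncomputable def gradTr (G H : E3 → Matrix (Fin 3) (Fin 3) ℝ) (y : E3) (i : Fin 3) : ℝ :=
  (1 / 2) * ∑ q, (G y)⁻¹ i q * pd q (trg G H) y

theorem smooth_gradTr (hG : MetricOn G U) (hHs : ∀ z ∈ U, SmoothMat H z) (hy : y ∈ U) (i : Fin 3) :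
    Smooth (fun z => gradTr G H z i) y := by
  have hN := (hG.smooth y hy).inv (hG.det_ne_zero y hy)
  exact ContDiffAt.mul contDiffAt_const (Smooth.sum' fun q _ =>
    ContDiffAt.mul (hN i q) ((smooth_trg hG hHs hy).dd (v := ee q)))

/-- The contracted variation of the curvature: the trace of the variation is an eigenfunction of
the Laplacian. -/
theorem divg_gradTr (hG : MetricOn G U) (hH : ∀ z, (H z).transpose = H z)
    (hHs : ∀ z ∈ U, SmoothMat H z) (hdiv : ∀ z ∈ U, ∀ j, divBilin G H z j = 0)
    (hk : ∀ z ∈ U, crv ee G z = k • 1) (hτ : ∀ z ∈ U, tau G H z = 0) (hy : y ∈ U) :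
    divg G (gradTr G H) y = -k * trg G H y := by
  have hN := (hG.smooth y hy).inv (hG.det_ne_zero y hy)
  have hC := fun p => smooth_dgam hG hH hHs hy p
  have hNs : ∀ a b, (G y)⁻¹ a b = (G y)⁻¹ b a := fun a b =>
    congrFun (congrFun (hG.inv_transpose y) b) a
  have hid := trace_curl_identity hNs (gam_symm (v := ee) hG y) (dgam_symm hG hH hHs y)
    (dC := fun i j => ddm (ee i) (fun z => dgam G H z j) y) (fun i p l j => by
      simp only [ddm_apply, dgam_symm hG hH hHs _ p l j])
  have hlhs : ∑ i, ∑ j, ∑ q, (G y)⁻¹ j q * (ddm (ee i) (fun z => dgam G H z j) y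
      - ddm (ee j) (fun z => dgam G H z i) y
      + (gam ee G y i * dgam G H y j - dgam G H y j * gam ee G y i)
      - (gam ee G y j * dgam G H y i - dgam G H y i * gam ee G y j)) i q = 2 * k * trg G H y := by
    simp only [dgam_curl hG hH hHs hk hy (hτ y hy)]
    simp only [trg, Matrix.trace, Matrix.diag, Matrix.mul_apply, Matrix.one_apply,
      Fin.sum_univ_three]
    have hHs' : ∀ a b, H y a b = H y b a := fun a b => congrFun (congrFun (hH y) b) a
    simp [hHs' 1 0, hHs' 2 0, hHs' 2 1]
    ring
  have hd1 : ∀ i, dd (ee i) (fun z => ∑ j, ∑ q, (G z)⁻¹ j q * dgam G H z j i q) y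
      = ∑ j, ∑ q, (-((G y)⁻¹ * (gam ee G y i).transpose + gam ee G y i * (G y)⁻¹) j q
        * dgam G H y j i q + (G y)⁻¹ j q * ddm (ee i) (fun z => dgam G H z j) y i q) := by
    intro i
    have hs : ∀ j q, Smooth (fun z => (G z)⁻¹ j q * dgam G H z j i q) y := fun j q =>
      ContDiffAt.mul (hN j q) (hC j i q)
    rw [dd_sum fun j _ => Smooth.sum' fun q _ => hs j q]
    refine Finset.sum_congr rfl fun j _ => ?_
    rw [dd_sum fun q _ => hs j q]
    refine Finset.sum_congr rfl fun q _ => ?_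
    rw [dd_mul (hN j q) (hC j i q), ← ddm_apply (F := fun z => (G z)⁻¹), ddm_inv_metric hG hy]
    rfl
  have hd2 : ∀ i, dd (ee i) (fun z => ∑ q, (G z)⁻¹ i q * (dgam G H z q).trace) y
      = ∑ q, (-((G y)⁻¹ * (gam ee G y i).transpose + gam ee G y i * (G y)⁻¹) i q
        * (dgam G H y q).trace
        + (G y)⁻¹ i q * (ddm (ee i) (fun z => dgam G H z q) y).trace) := by
    intro i
    have hs : ∀ q, Smooth (fun z => (G z)⁻¹ i q * (dgam G H z q).trace) y := fun q =>
      ContDiffAt.mul (hN i q) (hC q).trace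
    rw [dd_sum fun q _ => hs q]
    refine Finset.sum_congr rfl fun q _ => ?_
    rw [dd_mul (hN i q) (hC q).trace, ← ddm_apply (F := fun z => (G z)⁻¹), ddm_inv_metric hG hy,
      dd_trace (hC q)]
    rfl
  simp only [← hd1, ← hd2] at hid
  have e1 : ∀ i, (fun z => ∑ j, ∑ q, (G z)⁻¹ j q * dgam G H z j i q) =ᶠ[nhds y]
      fun z => -gradTr G H z i := fun i =>
    (hG.eventually hy).mono fun z hz => contract_dgam hG hH hHs hdiv hz i
  have e2' : ∀ z ∈ U, ∀ i, ∑ q, (G z)⁻¹ i q * (dgam G H z q).trace = gradTr G H z i := by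
    intro z hz i
    simp only [trace_dgam hG hH hHs hz, gradTr, Finset.mul_sum]
    exact Finset.sum_congr rfl fun q _ => by ring
  have e2 : ∀ i, (fun z => ∑ q, (G z)⁻¹ i q * (dgam G H z q).trace) =ᶠ[nhds y]
      fun z => gradTr G H z i := fun i => (hG.eventually hy).mono fun z hz => e2' z hz i
  have e1' : ∀ i, ∑ j, ∑ q, (G y)⁻¹ j q * dgam G H y j i q = -gradTr G H y i := fun i =>
    contract_dgam hG hH hHs hdiv hy i
  simp only [fun i => dd_congr (v := ee i) (e1 i), fun i => dd_congr (v := ee i) (e2 i), e1',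
    e2' y hy, dd_neg] at hid
  rw [hlhs] at hid
  simp only [divg, pd_eq_dd, Fin.sum_univ_three] at hid ⊢
  linarith

end Connection

/-! ### Two vector fields with nonnegative divergence -/

section VectorFields

variable {G H : E3 → Matrix (Fin 3) (Fin 3) ℝ} {U : Set E3} {y : E3} {k : ℝ}

theorem divg_mul {u : E3 → ℝ} {V : E3 → Fin 3 → ℝ} (hu : Smooth u y)
    (hV : ∀ i, Smooth (fun z => V z i) y) :
    divg G (fun z i => u z * V z i) y = ∑ i, pd i u y * V y i + u y * divg G V y := by
  have e : ∀ i, pd i (fun z => u z * V z i) y = pd i u y * V y i + u y * pd i (fun z => V z i) y :=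
    fun i => dd_mul hu (hV i)
  simp only [divg, e, Fin.sum_univ_three]
  ring

theorem sum_mul_nonneg {N : Matrix (Fin 3) (Fin 3) ℝ} (hN : N.PosDef) (p : Fin 3 → ℝ) :
    0 ≤ ∑ i, ∑ q, N i q * p i * p q := by
  obtain ⟨L, rfl⟩ := exists_eq_transpose_mul_self hN
  have e : ∑ i, ∑ q, (L.transpose * L) i q * p i * p q = ∑ a, (∑ i, L a i * p i) ^ 2 := by
    simp only [Matrix.mul_apply, Matrix.transpose_apply, Fin.sum_univ_three]
    ring
  rw [e]
  positivity

/-- The vector field `½ u grad u` for the metric trace `u` of `H`. -/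
noncomputable def trField (G H : E3 → Matrix (Fin 3) (Fin 3) ℝ) (y : E3) (i : Fin 3) : ℝ :=
  trg G H y * gradTr G H y i

theorem smooth_trField (hG : MetricOn G U) (hHs : ∀ z ∈ U, SmoothMat H z) (hy : y ∈ U)
    (i : Fin 3) : Smooth (fun z => trField G H z i) y :=
  ContDiffAt.mul (smooth_trg hG hHs hy) (smooth_gradTr hG hHs hy i)

/-- Half the squared norm of the gradient of the trace is dropped from the divergence. -/
theorem le_divg_trField (hG : MetricOn G U) (hpos : ∀ z ∈ U, (G z).PosDef)
    (hH : ∀ z, (H z).transpose = H z)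
    (hHs : ∀ z ∈ U, SmoothMat H z) (hdiv : ∀ z ∈ U, ∀ j, divBilin G H z j = 0)
    (hk : ∀ z ∈ U, crv ee G z = k • 1) (hτ : ∀ z ∈ U, tau G H z = 0) (hy : y ∈ U) :
    -k * trg G H y ^ 2 ≤ divg G (trField G H) y := by
  have h1 : divg G (trField G H) y = _ :=
    divg_mul (smooth_trg hG hHs hy) (smooth_gradTr hG hHs hy)
  have h2 := sum_mul_nonneg (hpos y hy).inv fun i => pd i (trg G H) y
  have h3 : ∑ i, pd i (trg G H) y * gradTr G H y i
      = (1 / 2) * ∑ i, ∑ q, (G y)⁻¹ i q * pd i (trg G H) y * pd q (trg G H) y := by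
    simp only [gradTr, Fin.sum_univ_three]
    ring
  rw [h1, h3, divg_gradTr hG hH hHs hdiv hk hτ hy]
  nlinarith

/-- The adjoint of the variation `dgam G H y k` of the connection minus the variation itself: twice
the skew part, up to sign. It is the exterior covariant derivative of `H` with one index raised. -/
noncomputable def skewVar (G H : E3 → Matrix (Fin 3) (Fin 3) ℝ) (k : Fin 3) (y : E3) :
    Matrix (Fin 3) (Fin 3) ℝ :=
  (G y)⁻¹ * (dgam G H y k).transpose * G y - dgam G H y k

/-- The components `H^{jk}` of `H` with raised indices. -/
noncomputable def raise (G H : E3 → Matrix (Fin 3) (Fin 3) ℝ) (y : E3) :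
    Matrix (Fin 3) (Fin 3) ℝ :=
  (G y)⁻¹ * H y * (G y)⁻¹

/-- The vector field `X^i = H^{jk} (∇^i H_jk - ∇_j H^i_k)`. -/
noncomputable def curlField (G H : E3 → Matrix (Fin 3) (Fin 3) ℝ) (y : E3) (i : Fin 3) : ℝ :=
  ∑ k, (skewVar G H k y * raise G H y) i k

/-- Product rule for the divergence of the contraction of a family `B k` of endomorphisms with a
contravariant tensor `S`. -/
theorem divg_contract {B : Fin 3 → E3 → Matrix (Fin 3) (Fin 3) ℝ}
    {S : E3 → Matrix (Fin 3) (Fin 3) ℝ} (hG : MetricOn G U) (hy : y ∈ U)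
    (hB : ∀ k, SmoothMat (B k) y) (hS : SmoothMat S y)
    (htr : ∀ z ∈ U, ∀ j, ∑ i, B i z i j = 0) :
    divg G (fun z i => ∑ k, (B k z * S z) i k) y
      = ∑ i, ∑ k, (B k y * (ddm (ee i) S y + gam ee G y i * S y
          + S y * (gam ee G y i).transpose)) i k
        + ∑ i, ∑ k, ((ddm (ee i) (B k) y + (gam ee G y i * B k y - B k y * gam ee G y i)
          - (ddm (ee k) (B i) y + (gam ee G y k * B i y - B i y * gam ee G y k))) * S y) i k := by
  have h1 : ∀ i, pd i (fun z => ∑ k, (B k z * S z) i k) y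
      = ∑ k, (ddm (ee i) (B k) y * S y + B k y * ddm (ee i) S y) i k := by
    intro i
    refine (dd_sum fun k _ => (hB k).mul hS i k).trans (Finset.sum_congr rfl fun k _ => ?_)
    rw [← ddm_mul (hB k) hS]
    rfl
  have h2 : ∀ k j, ∑ i, ddm (ee k) (B i) y i j = 0 := by
    intro k j
    have : dd (ee k) (fun z => ∑ i, B i z i j) y = 0 :=
      (dd_congr ((hG.eventually hy).mono fun z hz => htr z hz j)).trans (dd_const 0)
    rw [← this]
    exact (dd_sum fun i _ => hB i i j).symm
  have h0 := htr y hy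
  have hW := gam_symm (v := ee) hG y
  simp only [divg, h1]
  generalize S y = S₀
  generalize gam ee G y = W at hW ⊢
  generalize hE : (fun i => ddm (ee i) S y) = E
  have hE' : ∀ i, ddm (ee i) S y = E i := fun i => congrFun hE i
  generalize hD : (fun i k => ddm (ee i) (B k) y) = D
  have hD' : ∀ i k, ddm (ee i) (B k) y = D i k := fun i k => congrFun (congrFun hD i) k
  generalize hb : (fun k => B k y) = b
  have hb' : ∀ k, B k y = b k := fun k => congrFun hb k
  simp only [hE', hD', hb'] at h0 h2 ⊢
  have t1 : ∑ i, ∑ k, (D k i * S₀) i k = 0 := by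
    have : ∑ i, ∑ k, (D k i * S₀) i k = ∑ k, ∑ j, (∑ i, D k i i j) * S₀ j k := by
      simp only [Matrix.mul_apply, Fin.sum_univ_three]; ring
    simp [this, h2]
  have t2 : ∑ i, ∑ k, (b i * W k * S₀) i k = 0 := by
    have : ∑ i, ∑ k, (b i * W k * S₀) i k = ∑ k, ∑ j, (∑ i, b i i j) * (W k * S₀) j k := by
      simp only [mul_assoc]
      simp only [Matrix.mul_apply (M := b _), Fin.sum_univ_three]; ring
    simp [this, h0]
  have t3 : ∑ i, ∑ k, (b k * S₀ * (W i).transpose) i k = ∑ i, ∑ k, (W k * b i * S₀) i k := by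
    simp only [mul_assoc (W _)]
    generalize hP : (fun i => b i * S₀) = P
    have hP' : ∀ i, b i * S₀ = P i := fun i => congrFun hP i
    simp only [hP']
    simp only [Matrix.mul_apply, Matrix.transpose_apply, Fin.sum_univ_three, hW 1 _ 0,
      hW 2 _ 0, hW 2 _ 1]
    ring
  have t4 : ∑ i, ∑ k, (W i * b k * S₀) i k = ∑ i, (W i).trace * ∑ k, (b k * S₀) i k := by
    simp only [mul_assoc]
    generalize hP : (fun i => b i * S₀) = P
    have hP' : ∀ i, b i * S₀ = P i := fun i => congrFun hP i
    simp only [hP']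
    simp only [Matrix.mul_apply, Matrix.trace, Matrix.diag, Fin.sum_univ_three, hW 1 _ 0,
      hW 2 _ 0, hW 2 _ 1]
    ring
  simp only [mul_add, add_mul, sub_mul, Matrix.add_apply, Matrix.sub_apply,
    Finset.sum_add_distrib, Finset.sum_sub_distrib, ← mul_assoc] at t1 t2 t3 t4 ⊢
  linarith

theorem smooth_skewVar (hG : MetricOn G U) (hH : ∀ z, (H z).transpose = H z)
    (hHs : ∀ z ∈ U, SmoothMat H z) (hy : y ∈ U) (k : Fin 3) : SmoothMat (skewVar G H k) y := by
  have hN := (hG.smooth y hy).inv (hG.det_ne_zero y hy)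
  have hC := smooth_dgam hG hH hHs hy k
  exact ((hN.mul hC.transpose).mul (hG.smooth y hy)).sub hC

theorem smooth_raise (hG : MetricOn G U) (hHs : ∀ z ∈ U, SmoothMat H z) (hy : y ∈ U) :
    SmoothMat (raise G H) y :=
  have hN := (hG.smooth y hy).inv (hG.det_ne_zero y hy)
  (hN.mul (hHs y hy)).mul hN

theorem smooth_curlField (hG : MetricOn G U) (hH : ∀ z, (H z).transpose = H z)
    (hHs : ∀ z ∈ U, SmoothMat H z) (hy : y ∈ U) (i : Fin 3) :
    Smooth (fun z => curlField G H z i) y :=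
  Smooth.sum' fun k _ => (smooth_skewVar hG hH hHs hy k).mul (smooth_raise hG hHs hy) i k

theorem cov_raise (hG : MetricOn G U) (hHs : ∀ z ∈ U, SmoothMat H z) (hy : y ∈ U) (i : Fin 3) :
    ddm (ee i) (raise G H) y + gam ee G y i * raise G H y
      + raise G H y * (gam ee G y i).transpose = (G y)⁻¹ * covLow G H y i * (G y)⁻¹ := by
  have hN := (hG.smooth y hy).inv (hG.det_ne_zero y hy)
  have e : raise G H = fun z => (G z)⁻¹ * H z * (G z)⁻¹ := rfl
  rw [e, ddm_mul (hN.mul (hHs y hy)) hN, ddm_mul hN (hHs y hy), ddm_inv_metric hG hy, covLow]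
  noncomm_ring

theorem cov_skewVar (hG : MetricOn G U) (hH : ∀ z, (H z).transpose = H z)
    (hHs : ∀ z ∈ U, SmoothMat H z) (hy : y ∈ U) (i k : Fin 3) :
    ddm (ee i) (skewVar G H k) y
      + (gam ee G y i * skewVar G H k y - skewVar G H k y * gam ee G y i)
    = (G y)⁻¹ * (ddm (ee i) (fun z => dgam G H z k) y + (gam ee G y i * dgam G H y k
        - dgam G H y k * gam ee G y i)).transpose * G y
      - (ddm (ee i) (fun z => dgam G H z k) y + (gam ee G y i * dgam G H y k
        - dgam G H y k * gam ee G y i)) := by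
  have hN := (hG.smooth y hy).inv (hG.det_ne_zero y hy)
  have hC := smooth_dgam hG hH hHs hy k
  have e : skewVar G H k = fun z => (G z)⁻¹ * (dgam G H z k).transpose * G z - dgam G H z k := rfl
  rw [e, ddm_sub ((hN.mul hC.transpose).mul (hG.smooth y hy)) hC,
    ddm_mul (hN.mul hC.transpose) (hG.smooth y hy), ddm_mul hN hC.transpose, ddm_inv_metric hG hy,
    ddm_transpose, ddm_metric hG hy]
  simp only [Matrix.transpose_add, Matrix.transpose_sub, Matrix.transpose_mul]
  noncomm_ring

end VectorFields

section CurlField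

variable {G H : E3 → Matrix (Fin 3) (Fin 3) ℝ} {U : Set E3} {y : E3} {k : ℝ}

/-- The squared norm of a covariant three-tensor is a sum of squares in an orthonormal frame. -/
theorem sum_trace_nonneg {N : Matrix (Fin 3) (Fin 3) ℝ} (hN : N.PosDef)
    (A : Fin 3 → Matrix (Fin 3) (Fin 3) ℝ) :
    0 ≤ ∑ k, ∑ l, N k l * (N * A k * N * (A l).transpose).trace := by
  obtain ⟨L, rfl⟩ := exists_eq_transpose_mul_self hN
  have e1 : ∀ k l, (L.transpose * L * A k * (L.transpose * L) * (A l).transpose).trace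
      = ((L * A k * L.transpose) * (L * A l * L.transpose).transpose).trace := by
    intro k l
    rw [Matrix.transpose_mul, Matrix.transpose_mul, Matrix.transpose_transpose, mul_assoc,
      mul_assoc, mul_assoc, Matrix.trace_mul_comm]
    simp only [mul_assoc]
  generalize hB : (fun k => L * A k * L.transpose) = B
  have hB' : ∀ k, L * A k * L.transpose = B k := fun k => congrFun hB k
  have e2 : ∑ k, ∑ l, (L.transpose * L) k l
        * (L.transpose * L * A k * (L.transpose * L) * (A l).transpose).trace
      = ∑ a, ∑ i, ∑ j, (∑ k, L a k * B k i j) ^ 2 := by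
    simp only [e1, hB']
    simp only [Matrix.trace, Matrix.diag, Matrix.mul_apply, Matrix.transpose_apply]
    simp only [sq, Finset.mul_sum, Finset.sum_mul]
    simp only [Fin.sum_univ_three]
    ring
  rw [e2]
  positivity

/-- The exterior covariant derivative of `H`, up to the order of the indices. -/
noncomputable def extCov (G H : E3 → Matrix (Fin 3) (Fin 3) ℝ) (y : E3) (k : Fin 3) :
    Matrix (Fin 3) (Fin 3) ℝ :=
  (dgam G H y k).transpose * G y - G y * dgam G H y k

theorem skewVar_eq (hG : MetricOn G U) (hy : y ∈ U) (k : Fin 3) :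
    skewVar G H k y = (G y)⁻¹ * extCov G H y k := by
  rw [extCov, skewVar, mul_sub, ← mul_assoc, ← mul_assoc, hG.inv_mul hy, one_mul]

theorem extCov_apply (hG : MetricOn G U) (hH : ∀ z, (H z).transpose = H z)
    (hHs : ∀ z ∈ U, SmoothMat H z) (hy : y ∈ U) (k l j : Fin 3) :
    extCov G H y k l j = covLow G H y l j k - covLow G H y j l k := by
  have hDs : ∀ p a b, covLow G H y p a b = covLow G H y p b a := fun p a b =>
    congrFun (congrFun (covLow_transpose hH p) b) a
  have e1 : ((dgam G H y k).transpose * G y) l j = (G y * dgam G H y k) j l := by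
    rw [← Matrix.transpose_apply (G y * dgam G H y k), Matrix.transpose_mul, hG.symm]
  rw [extCov, Matrix.sub_apply, e1,
    koszul (hG.symm y) (dgam_symm hG hH hHs y) (covLow_eq_dgam hG hH hHs hy),
    koszul (hG.symm y) (dgam_symm hG hH hHs y) (covLow_eq_dgam hG hH hHs hy),
    hDs k j l, hDs l k j, hDs j k l]
  ring

/-- The first term of the divergence of `curlField` is half the squared norm of the exterior
covariant derivative of `H`. -/
theorem sum_curl_cov (hG : MetricOn G U) (hH : ∀ z, (H z).transpose = H z)
    (hHs : ∀ z ∈ U, SmoothMat H z) (hy : y ∈ U) :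
    ∑ i, ∑ k, (skewVar G H k y * ((G y)⁻¹ * covLow G H y i * (G y)⁻¹)) i k
      = (1 / 2) * ∑ k, ∑ l, (G y)⁻¹ k l
        * ((G y)⁻¹ * extCov G H y k * (G y)⁻¹ * (extCov G H y l).transpose).trace := by
  have hDs : ∀ p a b, covLow G H y p a b = covLow G H y p b a := fun p a b =>
    congrFun (congrFun (covLow_transpose hH p) b) a
  have hNs : ∀ a b, (G y)⁻¹ a b = (G y)⁻¹ b a := fun a b =>
    congrFun (congrFun (hG.inv_transpose y) b) a
  have hAs : ∀ k, (extCov G H y k).transpose = -extCov G H y k := by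
    intro k
    rw [extCov, Matrix.transpose_sub, Matrix.transpose_mul, Matrix.transpose_mul, hG.symm,
      Matrix.transpose_transpose, neg_sub]
  have hA := extCov_apply hG hH hHs hy
  have hR : ∀ k, ((G y)⁻¹ * extCov G H y k * (G y)⁻¹).transpose
      = -((G y)⁻¹ * extCov G H y k * (G y)⁻¹) := by
    intro k
    rw [Matrix.transpose_mul, Matrix.transpose_mul, hG.inv_transpose, hAs]
    noncomm_ring
  have e : ∀ i k, (skewVar G H k y * ((G y)⁻¹ * covLow G H y i * (G y)⁻¹)) i k
      = ((G y)⁻¹ * extCov G H y k * (G y)⁻¹ * (covLow G H y i * (G y)⁻¹)) i k := by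
    intro i k
    rw [skewVar_eq hG hy]
    simp only [mul_assoc]
  simp only [e]
  generalize hP : (fun k => (G y)⁻¹ * extCov G H y k * (G y)⁻¹) = P at *
  have hP' : ∀ k, (G y)⁻¹ * extCov G H y k * (G y)⁻¹ = P k := fun k => congrFun hP k
  simp only [hP'] at hR ⊢
  have hRs : ∀ k a b, P k a b = -P k b a := fun k a b => congrFun (congrFun (hR k) b) a
  have hR0 : ∀ k a, P k a a = 0 := fun k a => by linarith [hRs k a a]
  simp only [Matrix.trace, Matrix.diag, Matrix.mul_apply, Matrix.transpose_apply, hA]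
  simp only [Fin.sum_univ_three, hR0, hRs _ 1 0, hRs _ 2 0, hRs _ 2 1, hNs 1 0, hNs 2 0, hNs 2 1]
  ring

/-- If the metric `G` has constant curvature `k` and the variation `H` has vanishing trace and
divergence and does not change the curvature operator, then
`div X = ½ |d^∇ H|² - k |H|²` for `X = curlField G H`. -/
theorem divg_curlField (hG : MetricOn G U) (hH : ∀ z, (H z).transpose = H z)
    (hHs : ∀ z ∈ U, SmoothMat H z) (hdiv : ∀ z ∈ U, ∀ j, divBilin G H z j = 0)
    (hk : ∀ z ∈ U, crv ee G z = k • 1) (hτ : ∀ z ∈ U, tau G H z = 0)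
    (htr : ∀ z ∈ U, trg G H z = 0) (hy : y ∈ U) :
    divg G (curlField G H) y
      = (1 / 2) * (∑ k, ∑ l, (G y)⁻¹ k l
        * ((G y)⁻¹ * extCov G H y k * (G y)⁻¹ * (extCov G H y l).transpose).trace)
        - k * ((G y)⁻¹ * H y * ((G y)⁻¹ * H y)).trace := by
  have hpd : ∀ z ∈ U, ∀ p, pd p (trg G H) z = 0 := fun z hz p =>
    (dd_congr ((hG.eventually hz).mono fun w hw => htr w hw)).trans (dd_const 0)
  have hNs : ∀ z a b, (G z)⁻¹ a b = (G z)⁻¹ b a := fun z a b =>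
    congrFun (congrFun (hG.inv_transpose z) b) a
  have htf : ∀ z ∈ U, ∀ j, ∑ i, skewVar G H i z i j = 0 := by
    intro z hz j
    have h1 : ∑ i, dgam G H z i i j = 0 := by
      have := trace_dgam hG hH hHs hz j
      rw [hpd z hz, mul_zero] at this
      rw [← this, Matrix.trace]
      exact Finset.sum_congr rfl fun i _ => dgam_symm hG hH hHs z i i j
    have h2 : ∀ l, ∑ i, ∑ q, (G z)⁻¹ i q * dgam G H z i l q = 0 := by
      intro l
      rw [contract_dgam hG hH hHs hdiv hz l]
      simp only [hpd z hz, mul_zero, Finset.sum_const_zero, neg_zero]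
    have h3 : ∑ i, skewVar G H i z i j
        = ∑ l, (∑ i, ∑ q, (G z)⁻¹ i q * dgam G H z i l q) * G z l j - ∑ i, dgam G H z i i j := by
      simp only [skewVar, Matrix.sub_apply, Finset.sum_sub_distrib]
      simp only [Matrix.mul_apply, Matrix.transpose_apply, Fin.sum_univ_three]
      ring
    simp [h3, h1, h2]
  have h1 := divg_contract hG hy (fun k => smooth_skewVar hG hH hHs hy k)
    (smooth_raise hG hHs hy) htf
  have h2 : divg G (curlField G H) y = _ := h1
  rw [h2]
  simp only [cov_raise hG hHs hy, cov_skewVar hG hH hHs hy]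
  rw [sum_curl_cov hG hH hHs hy, sub_eq_add_neg]
  congr 1
  -- `Q i k` is the exterior covariant derivative of `dgam`, given by `dgam_curl`
  set Q : Fin 3 → Fin 3 → Matrix (Fin 3) (Fin 3) ℝ := fun i k =>
    (ddm (ee i) (fun z => dgam G H z k) y + (gam ee G y i * dgam G H y k
        - dgam G H y k * gam ee G y i))
    - (ddm (ee k) (fun z => dgam G H z i) y + (gam ee G y k * dgam G H y i
        - dgam G H y i * gam ee G y k)) with hQdef
  have hQ : ∀ i k l q, Q i k l q = _ := fun i j l q => by
    refine Eq.trans (congrFun (congrFun ?_ l) q) (dgam_curl hG hH hHs hk hy (hτ y hy) i j l q)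
    simp only [hQdef]
    abel
  have e : ∀ i k, ((G y)⁻¹ * (ddm (ee i) (fun z => dgam G H z k) y + (gam ee G y i * dgam G H y k
        - dgam G H y k * gam ee G y i)).transpose * G y
      - (ddm (ee i) (fun z => dgam G H z k) y + (gam ee G y i * dgam G H y k
        - dgam G H y k * gam ee G y i))
      - ((G y)⁻¹ * (ddm (ee k) (fun z => dgam G H z i) y + (gam ee G y k * dgam G H y i
        - dgam G H y i * gam ee G y k)).transpose * G y
      - (ddm (ee k) (fun z => dgam G H z i) y + (gam ee G y k * dgam G H y i
        - dgam G H y i * gam ee G y k)))) * raise G H y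
      = (G y)⁻¹ * ((Q i k).transpose * (H y * (G y)⁻¹)) - Q i k * raise G H y := by
    intro i k
    have : G y * raise G H y = H y * (G y)⁻¹ := by
      rw [raise, ← mul_assoc, ← mul_assoc, hG.mul_inv hy, one_mul]
    rw [← this]
    simp only [hQdef, Matrix.transpose_sub]
    noncomm_ring
  simp only [e]
  have hHsy : ∀ a b, H y a b = H y b a := fun a b => congrFun (congrFun (hH y) b) a
  have hu : ((G y)⁻¹ * H y).trace = 0 := htr y hy
  have hu' : (H y * (G y)⁻¹).trace = 0 := by rw [Matrix.trace_mul_comm]; exact hu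
  have s1 : ∑ i, ∑ k, (Q i k * raise G H y) i k = 2 * k * (H y * raise G H y).trace := by
    generalize raise G H y = S
    simp only [Matrix.mul_apply, hQ, Matrix.trace, Matrix.diag, Matrix.one_apply,
      Fin.sum_univ_three]
    simp
    ring
  have s2 : ∑ i, ∑ k, ((G y)⁻¹ * ((Q i k).transpose * (H y * (G y)⁻¹))) i k
      = k * (((G y)⁻¹ * H y * (H y * (G y)⁻¹).transpose).trace
        - ((G y)⁻¹ * H y).trace * (H y * (G y)⁻¹).trace) := by
    generalize H y * (G y)⁻¹ = S
    simp only [Matrix.mul_apply, Matrix.transpose_apply, hQ, Matrix.trace, Matrix.diag,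
      Matrix.one_apply, Fin.sum_univ_three]
    simp [hHsy 1 0, hHsy 2 0, hHsy 2 1, hNs y 1 0, hNs y 2 0, hNs y 2 1]
    ring
  have s3 : (H y * raise G H y).trace = ((G y)⁻¹ * H y * ((G y)⁻¹ * H y)).trace := by
    rw [raise, Matrix.trace_mul_comm, mul_assoc]
  have s4 : (H y * (G y)⁻¹).transpose = (G y)⁻¹ * H y := by
    rw [Matrix.transpose_mul, hH, hG.inv_transpose]
  simp only [Matrix.sub_apply, Finset.sum_sub_distrib, s1, s2, s3, s4, hu]
  ring

/-- A bilinear form whose endomorphism has `tr h² = 0` vanishes. -/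
theorem eq_zero_of_trace_sq {S g : Matrix (Fin 3) (Fin 3) ℝ} (hg : g.PosDef)
    (hS : S.transpose = S) (h : (g⁻¹ * S * (g⁻¹ * S)).trace = 0) : S = 0 := by
  obtain ⟨L, hL⟩ := exists_eq_transpose_mul_self hg.inv
  have hdet : IsUnit L := by
    rw [Matrix.isUnit_iff_isUnit_det, isUnit_iff_ne_zero]
    intro h0
    have := hg.inv.det_pos
    rw [hL, Matrix.det_mul, h0, mul_zero] at this
    exact lt_irrefl _ this
  have e : (g⁻¹ * S * (g⁻¹ * S)).trace
      = ((L * S * L.transpose).transpose * (L * S * L.transpose)).trace := by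
    rw [hL, Matrix.transpose_mul, Matrix.transpose_mul, Matrix.transpose_transpose, hS]
    rw [mul_assoc, mul_assoc, Matrix.trace_mul_comm]
    simp only [mul_assoc]
  have h0 : L * S * L.transpose = 0 := by
    rw [e] at h
    exact Matrix.trace_conjTranspose_mul_self_eq_zero_iff.mp h
  have hdet' : IsUnit L.transpose := (Matrix.isUnit_transpose L).mpr hdet
  have h1 : L * S = 0 := hdet'.mul_left_eq_zero.mp h0
  exact hdet.mul_right_eq_zero.mp h1

/-- Half the squared norm of the exterior covariant derivative of `H` is dropped from the divergence. -/
theorem le_divg_curlField (hG : MetricOn G U) (hpos : ∀ z ∈ U, (G z).PosDef)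
    (hH : ∀ z, (H z).transpose = H z)
    (hHs : ∀ z ∈ U, SmoothMat H z) (hdiv : ∀ z ∈ U, ∀ j, divBilin G H z j = 0)
    (hk : ∀ z ∈ U, crv ee G z = k • 1) (hτ : ∀ z ∈ U, tau G H z = 0)
    (htr : ∀ z ∈ U, trg G H z = 0) (hy : y ∈ U) :
    -k * ((G y)⁻¹ * H y * ((G y)⁻¹ * H y)).trace ≤ divg G (curlField G H) y := by
  rw [divg_curlField hG hH hHs hdiv hk hτ htr hy]
  have := sum_trace_nonneg (hpos y hy).inv (extCov G H y)
  linarith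

theorem trace_raise_nonneg (hG : MetricOn G U) (hpos : ∀ z ∈ U, (G z).PosDef)
    (hH : ∀ z, (H z).transpose = H z) (hy : y ∈ U) :
    0 ≤ ((G y)⁻¹ * H y * ((G y)⁻¹ * H y)).trace := by
  refine trace_mul_self_nonneg (B := raise G H y) (hpos y hy) ?_ ?_
  · rw [raise, Matrix.transpose_mul, Matrix.transpose_mul, hG.inv_transpose, hH, mul_assoc]
  · rw [raise, mul_assoc, hG.inv_mul hy, mul_one]

end CurlField

/-! ### Change of coordinates -/

section ChangeOfCoordinates

/-- The Jacobian matrix of a map between coordinate domains. -/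
noncomputable def jac (ψ : E3 → E3) (y : E3) : Matrix (Fin 3) (Fin 3) ℝ :=
  Matrix.of fun a i => pd i (fun z => ψ z a) y

variable {ψ : E3 → E3} {G G' H H' : E3 → Matrix (Fin 3) (Fin 3) ℝ} {U V : Set E3} {y : E3}

theorem smooth_coord (hψ : ContDiffAt ℝ ∞ ψ y) (a : Fin 3) : Smooth (fun z => ψ z a) y :=
  (contDiffAt_piLp 2).mp hψ a

theorem smooth_jac (hψ : ContDiffAt ℝ ∞ ψ y) : SmoothMat (jac ψ) y :=
  fun a _ => (smooth_coord hψ a).dd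

theorem fderiv_ee (hψ : ContDiffAt ℝ ∞ ψ y) (i : Fin 3) :
    fderiv ℝ ψ y (ee i) = ∑ a, jac ψ y a i • ee a := by
  have hd : DifferentiableAt ℝ ψ y := hψ.differentiableAt (by simp)
  have h : ∀ a, fderiv ℝ ψ y (ee i) a = jac ψ y a i := by
    intro a
    change _ = fderiv ℝ ((EuclideanSpace.proj (𝕜 := ℝ) a : E3 →L[ℝ] ℝ) ∘ ψ) y (ee i)
    rw [((EuclideanSpace.proj (𝕜 := ℝ) a : E3 →L[ℝ] ℝ).hasFDerivAt.comp y hd.hasFDerivAt).fderiv]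
    rfl
  ext b
  rw [h]
  simp [ee, Pi.single_apply]

theorem dd_comp {f : E3 → ℝ} (hψ : ContDiffAt ℝ ∞ ψ y) (hf : Smooth f (ψ y)) (i : Fin 3) :
    dd (ee i) (fun z => f (ψ z)) y = ∑ a, jac ψ y a i * dd (ee a) f (ψ y) := by
  have hd : DifferentiableAt ℝ ψ y := hψ.differentiableAt (by simp)
  have : fderiv ℝ (fun z => f (ψ z)) y = (fderiv ℝ f (ψ y)).comp (fderiv ℝ ψ y) :=
    fderiv_comp y hf.diff hd
  simp only [dd, this, ContinuousLinearMap.comp_apply, fderiv_ee hψ, map_sum, map_smul, smul_eq_mul]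

theorem ddm_comp {F : E3 → Matrix (Fin 3) (Fin 3) ℝ} (hψ : ContDiffAt ℝ ∞ ψ y)
    (hF : SmoothMat F (ψ y)) (i : Fin 3) :
    ddm (ee i) (fun z => F (ψ z)) y = ∑ a, jac ψ y a i • ddm (ee a) F (ψ y) := by
  ext b c
  simp only [ddm_apply, Matrix.sum_apply, Matrix.smul_apply, smul_eq_mul]
  exact dd_comp hψ (hF b c) i

theorem SmoothMat.comp' {F : E3 → Matrix (Fin 3) (Fin 3) ℝ} (hψ : ContDiffAt ℝ ∞ ψ y)
    (hF : SmoothMat F (ψ y)) : SmoothMat (fun z => F (ψ z)) y :=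
  fun a b => ContDiffAt.comp y (hF a b) hψ

theorem ddm_jac_symm (hψ : ContDiffAt ℝ ∞ ψ y) (p m j : Fin 3) :
    ddm (ee p) (jac ψ) y m j = ddm (ee j) (jac ψ) y m p :=
  dd_comm (smooth_coord hψ m)

theorem det_fderiv (hψ : ContDiffAt ℝ ∞ ψ y) : (fderiv ℝ ψ y).det = (jac ψ y).det := by
  have e : LinearMap.toMatrix (EuclideanSpace.basisFun (Fin 3) ℝ).toBasis
      (EuclideanSpace.basisFun (Fin 3) ℝ).toBasis (fderiv ℝ ψ y : E3 →ₗ[ℝ] E3) = jac ψ y := by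
    ext a i
    rw [LinearMap.toMatrix_apply]
    have : fderiv ℝ ψ y (EuclideanSpace.single i 1) = ∑ a, jac ψ y a i • ee a := fderiv_ee hψ i
    simp [this, ee]
  rw [ContinuousLinearMap.det, ← e, LinearMap.det_toMatrix]

/-- On `U`, the field `F` of bilinear forms is the pullback of `F'` by `ψ`. -/
def IsPullback (ψ : E3 → E3) (U : Set E3) (F F' : E3 → Matrix (Fin 3) (Fin 3) ℝ) : Prop :=
  ∀ z ∈ U, F z = (jac ψ z).transpose * F' (ψ z) * jac ψ z

theorem ddm_pullback (hU : IsOpen U) (hP : IsPullback ψ U H H') (hy : y ∈ U)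
    (hψ : ContDiffAt ℝ ∞ ψ y) (hs : SmoothMat H' (ψ y)) (p : Fin 3) :
    ddm (ee p) H y = (ddm (ee p) (jac ψ) y).transpose * H' (ψ y) * jac ψ y
      + (jac ψ y).transpose * (∑ a, jac ψ y a p • ddm (ee a) H' (ψ y)) * jac ψ y
      + (jac ψ y).transpose * H' (ψ y) * ddm (ee p) (jac ψ) y := by
  have hJ := smooth_jac hψ
  have hc := SmoothMat.comp' hψ hs
  have e : H =ᶠ[nhds y] fun z => (jac ψ z).transpose * H' (ψ z) * jac ψ z :=
    Filter.eventuallyEq_iff_exists_mem.mpr ⟨U, hU.mem_nhds hy, fun z hz => hP z hz⟩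
  rw [ddm_congr e, ddm_mul (hJ.transpose.mul hc) hJ, ddm_mul hJ.transpose hc, ddm_transpose,
    ddm_comp hψ hs, add_mul]

theorem det_jac_ne_zero (hG : MetricOn G U) (hP : IsPullback ψ U G G') (hy : y ∈ U) :
    (jac ψ y).det ≠ 0 := by
  intro h
  apply hG.det_ne_zero y hy
  rw [hP y hy, Matrix.det_mul, h, mul_zero]

/-- The transformation law of the Christoffel symbols. -/
theorem jac_mul_gam (hG : MetricOn G U) (hG' : MetricOn G' V) (hP : IsPullback ψ U G G')
    (hy : y ∈ U) (hψ : ContDiffAt ℝ ∞ ψ y) (hV : ψ y ∈ V) (p : Fin 3) :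
    jac ψ y * gam ee G y p
      = (∑ a, jac ψ y a p • gam ee G' (ψ y) a) * jac ψ y + ddm (ee p) (jac ψ) y := by
  have hJu : IsUnit (jac ψ y).det := (det_jac_ne_zero hG hP hy).isUnit
  set B : Fin 3 → Matrix (Fin 3) (Fin 3) ℝ := fun p =>
    (∑ a, jac ψ y a p • gam ee G' (ψ y) a) * jac ψ y + ddm (ee p) (jac ψ) y with hB
  have hBs : ∀ p l j, B p l j = B j l p := by
    intro p l j
    have hg := gam_symm (v := ee) hG' (ψ y)
    simp only [hB, Matrix.add_apply, ddm_jac_symm hψ p l j]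
    congr 1
    simp only [Matrix.mul_apply, Matrix.sum_apply, Matrix.smul_apply, smul_eq_mul]
    simp only [Fin.sum_univ_three, hg 1 l 0, hg 2 l 0, hg 2 l 1]
    ring
  have hJB : ∀ p, jac ψ y * ((jac ψ y)⁻¹ * B p) = B p := fun p => by
    rw [← mul_assoc, Matrix.mul_nonsing_inv _ hJu, one_mul]
  have hGB : ∀ p, G y * ((jac ψ y)⁻¹ * B p) = (jac ψ y).transpose * G' (ψ y) * B p := fun p => by
    rw [hP y hy, mul_assoc, hJB]
  have key := eq_gam (v := ee) hG hy (Λ := fun p => (jac ψ y)⁻¹ * B p) (fun p l j => by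
      simp only [Matrix.mul_apply]
      exact Finset.sum_congr rfl fun m _ => by rw [hBs p m j]) (fun p => by
      have hT : ((jac ψ y)⁻¹ * B p).transpose * G y
          = (G y * ((jac ψ y)⁻¹ * B p)).transpose := by
        rw [Matrix.transpose_mul (G y), hG.symm]
      have hg : ∑ a, jac ψ y a p • ddm (ee a) G' (ψ y)
          = (∑ a, jac ψ y a p • gam ee G' (ψ y) a).transpose * G' (ψ y)
            + G' (ψ y) * ∑ a, jac ψ y a p • gam ee G' (ψ y) a := by
        simp only [ddm_metric hG' hV, Matrix.transpose_sum, Matrix.transpose_smul, Finset.sum_mul,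
          Finset.mul_sum, smul_add, Finset.sum_add_distrib, Matrix.smul_mul, Matrix.mul_smul]
      rw [hT, hGB, ddm_pullback hG.isOpen hP hy hψ (hG'.smooth _ hV), hg]
      simp only [hB, Matrix.transpose_mul, Matrix.transpose_add, Matrix.transpose_transpose,
        hG'.symm]
      noncomm_ring) p
  rw [← key, hJB]

theorem covLow_pullback (hG : MetricOn G U) (hG' : MetricOn G' V) (hP : IsPullback ψ U G G')
    (hPH : IsPullback ψ U H H') (hs : SmoothMat H' (ψ y))
    (hy : y ∈ U) (hψ : ContDiffAt ℝ ∞ ψ y) (hV : ψ y ∈ V) (p : Fin 3) :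
    covLow G H y p = (jac ψ y).transpose * (∑ a, jac ψ y a p • covLow G' H' (ψ y) a)
      * jac ψ y := by
  have h1 : H y * gam ee G y p = (jac ψ y).transpose * H' (ψ y)
      * ((∑ a, jac ψ y a p • gam ee G' (ψ y) a) * jac ψ y + ddm (ee p) (jac ψ) y) := by
    rw [← jac_mul_gam hG hG' hP hy hψ hV, hPH y hy]
    simp only [mul_assoc]
  have h2 : (gam ee G y p).transpose * H y = ((∑ a, jac ψ y a p • gam ee G' (ψ y) a) * jac ψ y
      + ddm (ee p) (jac ψ) y).transpose * (H' (ψ y) * jac ψ y) := by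
    rw [← jac_mul_gam hG hG' hP hy hψ hV, hPH y hy, Matrix.transpose_mul]
    simp only [mul_assoc]
  have h3 : ∑ a, jac ψ y a p • covLow G' H' (ψ y) a
      = ∑ a, jac ψ y a p • ddm (ee a) H' (ψ y)
        - ((∑ a, jac ψ y a p • gam ee G' (ψ y) a).transpose * H' (ψ y)
          + H' (ψ y) * ∑ a, jac ψ y a p • gam ee G' (ψ y) a) := by
    simp only [covLow, Matrix.transpose_sum, Matrix.transpose_smul, Finset.sum_mul,
      Finset.mul_sum, smul_sub, smul_add, Finset.sum_add_distrib, Finset.sum_sub_distrib,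
      Matrix.smul_mul, Matrix.mul_smul]
  rw [covLow, h1, h2, h3, ddm_pullback hG.isOpen hPH hy hψ hs]
  simp only [Matrix.transpose_mul, Matrix.transpose_add]
  noncomm_ring

theorem inv_pullback (hG : MetricOn G U) (hP : IsPullback ψ U G G') (hy : y ∈ U) :
    jac ψ y * (G y)⁻¹ * (jac ψ y).transpose = (G' (ψ y))⁻¹ := by
  have hJu : IsUnit (jac ψ y).det := (det_jac_ne_zero hG hP hy).isUnit
  have hJt : IsUnit (jac ψ y).transpose.det := by rwa [Matrix.det_transpose]
  rw [hP y hy, Matrix.mul_inv_rev, Matrix.mul_inv_rev, ← mul_assoc, Matrix.mul_nonsing_inv _ hJu,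
    one_mul, mul_assoc, Matrix.nonsing_inv_mul _ hJt, mul_one]

theorem trg_pullback (hG : MetricOn G U) (hP : IsPullback ψ U G G') (hPH : IsPullback ψ U H H')
    (hy : y ∈ U) : trg G H y = trg G' H' (ψ y) := by
  rw [trg, trg, ← inv_pullback hG hP hy, hPH y hy, ← mul_assoc, ← mul_assoc, Matrix.trace_mul_comm]
  simp only [mul_assoc]

theorem gradTr_pullback (hG : MetricOn G U) (hG' : MetricOn G' V) (hP : IsPullback ψ U G G')
    (hPH : IsPullback ψ U H H') (hs : ∀ z ∈ V, SmoothMat H' z)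
    (hy : y ∈ U) (hψ : ContDiffAt ℝ ∞ ψ y) (hV : ψ y ∈ V) (a : Fin 3) :
    gradTr G' H' (ψ y) a = ∑ i, jac ψ y a i * gradTr G H y i := by
  have e : trg G H =ᶠ[nhds y] fun z => trg G' H' (ψ z) :=
    (hG.eventually hy).mono fun z hz => trg_pullback hG hP hPH hz
  have hp : ∀ q, pd q (trg G H) y = ∑ b, jac ψ y b q * pd b (trg G' H') (ψ y) := fun q =>
    (dd_congr e).trans (dd_comp hψ (smooth_trg hG' hs hV) q)
  simp only [gradTr, ← inv_pullback hG hP hy, hp]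
  simp only [Matrix.mul_apply, Matrix.transpose_apply, Fin.sum_univ_three]
  ring

theorem trField_pullback (hG : MetricOn G U) (hG' : MetricOn G' V) (hP : IsPullback ψ U G G')
    (hPH : IsPullback ψ U H H') (hs : ∀ z ∈ V, SmoothMat H' z)
    (hy : y ∈ U) (hψ : ContDiffAt ℝ ∞ ψ y) (hV : ψ y ∈ V) (a : Fin 3) :
    trField G' H' (ψ y) a = ∑ i, jac ψ y a i * trField G H y i := by
  simp only [trField, gradTr_pullback hG hG' hP hPH hs hy hψ hV, ← trg_pullback hG hP hPH hy,
    Finset.mul_sum]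
  exact Finset.sum_congr rfl fun i _ => by ring

theorem extCov_pullback (hG : MetricOn G U) (hG' : MetricOn G' V) (hP : IsPullback ψ U G G')
    (hPH : IsPullback ψ U H H') (hH : ∀ z, (H z).transpose = H z)
    (hH' : ∀ z, (H' z).transpose = H' z) (hs : ∀ z ∈ U, SmoothMat H z)
    (hs' : ∀ z ∈ V, SmoothMat H' z)
    (hy : y ∈ U) (hψ : ContDiffAt ℝ ∞ ψ y) (hV : ψ y ∈ V) (k : Fin 3) :
    extCov G H y k = (jac ψ y).transpose * (∑ c, jac ψ y c k • extCov G' H' (ψ y) c)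
      * jac ψ y := by
  ext l j
  rw [extCov_apply hG hH hs hy, covLow_pullback hG hG' hP hPH (hs' _ hV) hy hψ hV,
    covLow_pullback hG hG' hP hPH (hs' _ hV) hy hψ hV]
  simp only [Matrix.mul_apply, Matrix.transpose_apply, Matrix.sum_apply, Matrix.smul_apply,
    smul_eq_mul, extCov_apply hG' hH' hs' hV]
  simp only [Fin.sum_univ_three]
  ring

theorem curlField_pullback (hG : MetricOn G U) (hG' : MetricOn G' V) (hP : IsPullback ψ U G G')
    (hPH : IsPullback ψ U H H') (hH : ∀ z, (H z).transpose = H z)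
    (hH' : ∀ z, (H' z).transpose = H' z) (hs : ∀ z ∈ U, SmoothMat H z)
    (hs' : ∀ z ∈ V, SmoothMat H' z)
    (hy : y ∈ U) (hψ : ContDiffAt ℝ ∞ ψ y) (hV : ψ y ∈ V) (a : Fin 3) :
    curlField G' H' (ψ y) a = ∑ i, jac ψ y a i * curlField G H y i := by
  have hJu : IsUnit (jac ψ y).det := (det_jac_ne_zero hG hP hy).isUnit
  have hR : raise G' H' (ψ y) = jac ψ y * raise G H y * (jac ψ y).transpose := by
    rw [raise, raise, ← inv_pullback hG hP hy, hPH y hy]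
    simp only [mul_assoc]
  have hE : ∀ k, jac ψ y * (skewVar G H k y * raise G H y) * (jac ψ y).transpose
      = ∑ c, jac ψ y c k • (skewVar G' H' c (ψ y) * raise G' H' (ψ y)) := by
    intro k
    have : ∑ c, jac ψ y c k • (skewVar G' H' c (ψ y) * raise G' H' (ψ y))
        = (G' (ψ y))⁻¹ * (∑ c, jac ψ y c k • extCov G' H' (ψ y) c) * raise G' H' (ψ y) := by
      simp only [skewVar_eq hG' hV, Finset.mul_sum, Finset.sum_mul, Matrix.smul_mul,
        Matrix.mul_smul]
    rw [this, skewVar_eq hG hy, extCov_pullback hG hG' hP hPH hH hH' hs hs' hy hψ hV, hR,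
      ← inv_pullback hG hP hy]
    simp only [mul_assoc]
  have h1 : ∀ k, jac ψ y * (skewVar G H k y * raise G H y) = (∑ c, jac ψ y c k •
      (skewVar G' H' c (ψ y) * raise G' H' (ψ y))) * (jac ψ y)⁻¹.transpose := by
    intro k
    rw [← hE, mul_assoc, ← Matrix.transpose_mul, Matrix.nonsing_inv_mul _ hJu,
      Matrix.transpose_one, mul_one]
  have h2 : ∑ i, jac ψ y a i * curlField G H y i
      = ∑ k, (jac ψ y * (skewVar G H k y * raise G H y)) a k := by
    generalize hP : (fun k => skewVar G H k y * raise G H y) = P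
    have hP' : ∀ k, skewVar G H k y * raise G H y = P k := fun k => congrFun hP k
    simp only [curlField, hP']
    simp only [Matrix.mul_apply, Fin.sum_univ_three]
    ring
  have h3 := Matrix.mul_nonsing_inv _ hJu
  rw [h2]
  simp only [h1, curlField]
  generalize hP : (fun c => skewVar G' H' c (ψ y) * raise G' H' (ψ y)) = P
  have hP' : ∀ c, skewVar G' H' c (ψ y) * raise G' H' (ψ y) = P c := fun c => congrFun hP c
  simp only [hP']
  have h4 : ∑ k, ((∑ c, jac ψ y c k • P c) * (jac ψ y)⁻¹.transpose) a k
      = ∑ c, ∑ m, (jac ψ y * (jac ψ y)⁻¹) c m * P c a m := by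
    generalize (jac ψ y)⁻¹ = K
    simp only [Matrix.mul_apply, Matrix.transpose_apply, Matrix.sum_apply, Matrix.smul_apply,
      smul_eq_mul]
    simp only [Fin.sum_univ_three]
    ring
  rw [h4, h3]
  simp [Matrix.one_apply]

end ChangeOfCoordinates

/-! ### Integration in a chart -/

section Integration

open MeasureTheory

variable {G : E3 → Matrix (Fin 3) (Fin 3) ℝ} {U K : Set E3} {w : E3 → ℝ}

theorem indicator_eventuallyEq (hU : IsOpen U) {z : E3} (hz : z ∈ U) :
    U.indicator w =ᶠ[nhds z] w :=
  Filter.eventuallyEq_iff_exists_mem.mpr ⟨U, hU.mem_nhds hz, fun _ h => Set.indicator_of_mem h w⟩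

theorem indicator_eventuallyEq_zero (hK : IsCompact K)
    (h0 : ∀ z ∈ U, z ∉ K → w z = 0) {z : E3} (hz : z ∉ K) :
    U.indicator w =ᶠ[nhds z] fun _ => 0 := by
  refine Filter.eventuallyEq_iff_exists_mem.mpr ⟨Kᶜ, hK.isClosed.isOpen_compl.mem_nhds hz, ?_⟩
  intro x hx
  by_cases hxU : x ∈ U
  · rw [Set.indicator_of_mem hxU, h0 x hxU hx]
  · exact Set.indicator_of_notMem hxU w

/-- A function that is smooth on `U` and vanishes off a compact subset of `U` extends by zero to a
smooth function. -/
theorem smooth_indicator (hU : IsOpen U) (hw : ∀ z ∈ U, Smooth w z) (hK : IsCompact K)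
    (hKU : K ⊆ U) (h0 : ∀ z ∈ U, z ∉ K → w z = 0) (z : E3) : Smooth (U.indicator w) z := by
  by_cases hz : z ∈ K
  · exact (hw z (hKU hz)).congr_of_eventuallyEq (indicator_eventuallyEq hU (hKU hz))
  · exact contDiffAt_const.congr_of_eventuallyEq (indicator_eventuallyEq_zero hK h0 hz)

theorem hasCompactSupport_indicator (hK : IsCompact K) (h0 : ∀ z ∈ U, z ∉ K → w z = 0) :
    HasCompactSupport (U.indicator w) :=
  HasCompactSupport.intro hK fun _ hz => (indicator_eventuallyEq_zero hK h0 hz).self_of_nhds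

theorem continuous_indicator' (hU : IsOpen U) (hw : ∀ z ∈ U, Smooth w z) (hK : IsCompact K)
    (hKU : K ⊆ U) (h0 : ∀ z ∈ U, z ∉ K → w z = 0) : Continuous (U.indicator w) :=
  continuous_iff_continuousAt.mpr fun z => (smooth_indicator hU hw hK hKU h0 z).continuousAt

theorem integrableOn_of_smooth (hU : IsOpen U) (hw : ∀ z ∈ U, Smooth w z) (hK : IsCompact K)
    (hKU : K ⊆ U) (h0 : ∀ z ∈ U, z ∉ K → w z = 0) : IntegrableOn w U :=
  (integrable_indicator_iff hU.measurableSet).mp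
    ((continuous_indicator' hU hw hK hKU h0).integrable_of_hasCompactSupport
      (hasCompactSupport_indicator hK h0))

theorem eq_zero_of_setIntegral_eq_zero (hU : IsOpen U) (hw : ∀ z ∈ U, Smooth w z)
    (hK : IsCompact K) (hKU : K ⊆ U) (h0 : ∀ z ∈ U, z ∉ K → w z = 0) (hpos : ∀ z ∈ U, 0 ≤ w z)
    (hint : ∫ z in U, w z = 0) : ∀ z ∈ U, w z = 0 := by
  by_contra! hne
  obtain ⟨z, hz, hwz⟩ := hne
  have := (continuous_indicator' hU hw hK hKU h0).integral_pos_of_hasCompactSupport_nonneg_nonzero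
    (μ := volume) (hasCompactSupport_indicator hK h0) (Set.indicator_nonneg hpos) (x := z)
    (by rwa [Set.indicator_of_mem hz])
  rw [integral_indicator hU.measurableSet, hint] at this
  exact lt_irrefl _ this

theorem integral_fderiv_eq_zero {f : E3 → ℝ} (hf : ∀ z, Smooth f z) (hc : HasCompactSupport f)
    (v : E3) : ∫ z, dd v f z = 0 := by
  have hcd : ContDiff ℝ ∞ f := contDiff_iff_contDiffAt.mpr hf
  have hcont : Continuous fun z => fderiv ℝ f z v :=
    (hcd.continuous_fderiv (by simp)).clm_apply continuous_const
  have hsupp : HasCompactSupport fun z => fderiv ℝ f z v := hc.fderiv_apply (𝕜 := ℝ) v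
  have := integral_mul_fderiv_eq_neg_fderiv_mul_of_integrable (μ := (volume : Measure E3))
    (f := fun _ => (1 : ℝ)) (g := f) (v := v) (by simp)
    (by simpa using hcont.integrable_of_hasCompactSupport hsupp)
    (by simpa using hcd.continuous.integrable_of_hasCompactSupport hc)
    (fun _ _ => differentiableAt_const _) (fun z _ => (hf z).diff)
  simpa [dd] using this

theorem smooth_sqrt_det (hG : MetricOn G U) {y : E3} (hy : y ∈ U) :
    Smooth (fun z => Real.sqrt (G z).det) y :=
  ContDiffAt.sqrt (hG.smooth y hy).det (hG.det_ne_zero y hy)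

theorem dd_sqrt_det (hG : MetricOn G U) (hpos : ∀ z ∈ U, (G z).PosDef) {y : E3} (hy : y ∈ U)
    (i : Fin 3) : dd (ee i) (fun z => Real.sqrt (G z).det) y
      = (gam ee G y i).trace * Real.sqrt (G y).det := by
  have hd := (hG.smooth y hy).det
  have h0 := (hpos y hy).det_pos
  have h1 : dd (ee i) (fun z => Real.sqrt (G z).det) y
      = (1 / (2 * Real.sqrt (G y).det)) * dd (ee i) (fun z => (G z).det) y := by
    unfold dd
    rw [fderiv_sqrt hd.diff h0.ne']
    simp
  rw [h1, dd_det_metric hG hy]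
  have hs := Real.sqrt_pos.mpr h0
  have hsq := Real.mul_self_sqrt h0.le
  field_simp
  linear_combination -(gam ee G y i).trace * hsq

/-- The divergence theorem in a chart, for vector fields of compact support. -/
theorem integral_divg (hG : MetricOn G U) (hpos : ∀ z ∈ U, (G z).PosDef) {V : E3 → Fin 3 → ℝ}
    (hV : ∀ z ∈ U, ∀ i, Smooth (fun z => V z i) z) (hK : IsCompact K) (hKU : K ⊆ U)
    (h0 : ∀ z ∈ U, z ∉ K → ∀ i, V z i = 0) :
    ∫ z in U, divg G V z * Real.sqrt (G z).det = 0 := by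
  set Y : Fin 3 → E3 → ℝ := fun i z => V z i * Real.sqrt (G z).det with hY
  have hYs : ∀ i, ∀ z ∈ U, Smooth (Y i) z := fun i z hz =>
    ContDiffAt.mul (hV z hz i) (smooth_sqrt_det hG hz)
  have hY0 : ∀ i, ∀ z ∈ U, z ∉ K → Y i z = 0 := fun i z hz hzK => by
    simp only [hY, h0 z hz hzK i, zero_mul]
  have hYi : ∀ i z, Smooth (U.indicator (Y i)) z := fun i =>
    smooth_indicator hG.isOpen (hYs i) hK hKU (hY0 i)
  have hYc : ∀ i, HasCompactSupport (U.indicator (Y i)) := fun i =>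
    hasCompactSupport_indicator hK (hY0 i)
  have hint : ∀ i, Integrable (dd (ee i) (U.indicator (Y i))) := fun i => by
    have hcd : ContDiff ℝ ∞ (U.indicator (Y i)) := contDiff_iff_contDiffAt.mpr (hYi i)
    exact ((hcd.continuous_fderiv (by simp)).clm_apply
      continuous_const).integrable_of_hasCompactSupport ((hYc i).fderiv_apply (𝕜 := ℝ) (ee i))
  have key : U.indicator (fun z => divg G V z * Real.sqrt (G z).det)
      = fun z => ∑ i, dd (ee i) (U.indicator (Y i)) z := by
    funext z
    by_cases hz : z ∈ U
    · rw [Set.indicator_of_mem hz, divg, Finset.sum_mul]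
      refine Finset.sum_congr rfl fun i _ => ?_
      rw [dd_congr (indicator_eventuallyEq hG.isOpen hz),
        dd_mul (hV z hz i) (smooth_sqrt_det hG hz), dd_sqrt_det hG hpos hz, pd_eq_dd]
      ring
    · rw [Set.indicator_of_notMem hz]
      refine (Finset.sum_eq_zero fun i _ => ?_).symm
      rw [dd_congr (indicator_eventuallyEq_zero hK (hY0 i) fun h => hz (hKU h)), dd_const]
  rw [← integral_indicator hG.isOpen.measurableSet, key, integral_finsetSum _ fun i _ => hint i]
  exact Finset.sum_eq_zero fun i _ => integral_fderiv_eq_zero (hYi i) (hYc i) (ee i)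

/-- The change of variables formula for the Riemannian volume. -/
theorem integral_pullback {G' : E3 → Matrix (Fin 3) (Fin 3) ℝ} {ψ : E3 → E3} (hU : IsOpen U)
    (hψ : ∀ z ∈ U, ContDiffAt ℝ ∞ ψ z) (hinj : Set.InjOn ψ U) (hP : IsPullback ψ U G G')
    (w' : E3 → ℝ) :
    ∫ z in ψ '' U, w' z * Real.sqrt (G' z).det
      = ∫ z in U, w' (ψ z) * Real.sqrt (G z).det := by
  rw [integral_image_eq_integral_abs_det_fderiv_smul volume hU.measurableSet
    (fun z hz => ((hψ z hz).differentiableAt (by simp)).hasFDerivAt.hasFDerivWithinAt) hinj]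
  refine setIntegral_congr_fun hU.measurableSet fun z hz => ?_
  simp only [smul_eq_mul]
  rw [det_fderiv (hψ z hz), hP z hz, Matrix.det_mul, Matrix.det_mul, Matrix.det_transpose]
  have : (jac ψ z).det * (G' (ψ z)).det * (jac ψ z).det
      = (jac ψ z).det ^ 2 * (G' (ψ z)).det := by ring
  rw [this, Real.sqrt_mul (sq_nonneg _), Real.sqrt_sq_eq_abs]
  ring

end Integration

/-! ### Components of tensors in the charts of a manifold -/

section Charts

theorem map_sum_ee (L : E3 →L[ℝ] E3) (c : Fin 3 → ℝ) :
    L (∑ a, c a • ee a) = ∑ a, c a • L (ee a) := by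
  rw [map_sum]
  exact Finset.sum_congr rfl fun a _ => map_smul _ _ _

theorem bilin_sum_sum (b : E3 →L[ℝ] E3 →L[ℝ] ℝ) (c d : Fin 3 → ℝ) (v : Fin 3 → E3) :
    b (∑ a, c a • v a) (∑ a, d a • v a) = ∑ a, ∑ a', c a * d a' * b (v a) (v a') := by
  simp only [Fin.sum_univ_three]
  simp
  ring

variable {M : Type*} [TopologicalSpace M]
variable {e e' : OpenPartialHomeomorph M E3} {y : E3}

/-- The transition map from the chart `e` to the chart `e'`. -/
def transition (e e' : OpenPartialHomeomorph M E3) (z : E3) : E3 := e' (e.symm z)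

/-- The overlap of two charts, in the coordinates of the first. -/
def overlap (e e' : OpenPartialHomeomorph M E3) : Set E3 := e.target ∩ e.symm ⁻¹' e'.source

theorem isOpen_overlap : IsOpen (overlap e e') :=
  e.symm.isOpen_inter_preimage e'.open_source

theorem transition_mem (hy : y ∈ overlap e e') : transition e e' y ∈ overlap e' e :=
  ⟨e'.map_source hy.2, by
    simp only [Set.mem_preimage, transition, e'.left_inv hy.2]; exact e.map_target hy.1⟩

theorem symm_transition (hy : y ∈ overlap e e') : e'.symm (transition e e' y) = e.symm y :=
  e'.left_inv hy.2

theorem transition_transition (hy : y ∈ overlap e e') :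
    transition e' e (transition e e' y) = y := by
  rw [transition, symm_transition hy, e.right_inv hy.1]

theorem image_transition : transition e e' '' overlap e e' = overlap e' e := by
  ext z
  constructor
  · rintro ⟨y, hy, rfl⟩
    exact transition_mem hy
  · intro hz
    exact ⟨transition e' e z, transition_mem hz, transition_transition hz⟩

theorem injOn_transition : Set.InjOn (transition e e') (overlap e e') := fun y hy z hz h => by
  rw [← transition_transition hy, h, transition_transition hz]

variable [ChartedSpace E3 M]

theorem chartBilin_transpose
    {B : (x : M) → TangentSpace (𝓡 3) x →L[ℝ] TangentSpace (𝓡 3) x →L[ℝ] ℝ}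
    (hB : ∀ (x : M) (v w : TangentSpace (𝓡 3) x), B x v w = B x w v) (z : E3) :
    (chartBilin e B z).transpose = chartBilin e B z := by
  ext i j
  exact hB _ _ _

variable [IsManifold (𝓡 3) ∞ M]

theorem contMDiffAt_symm (he : e ∈ atlas E3 M) (hy : y ∈ e.target) :
    ContMDiffAt 𝓘(ℝ, E3) (𝓡 3) ∞ e.symm y :=
  contMDiffAt_symm_of_mem_maximalAtlas (IsManifold.subset_maximalAtlas he) hy

theorem contMDiffAt_chart (he : e ∈ atlas E3 M) {x : M} (hx : x ∈ e.source) :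
    ContMDiffAt (𝓡 3) 𝓘(ℝ, E3) ∞ e x :=
  contMDiffAt_of_mem_maximalAtlas (IsManifold.subset_maximalAtlas he) hx

theorem contMDiffAt_coordVec (he : e ∈ atlas E3 M) (hy : y ∈ e.target) (i : Fin 3) :
    ContMDiffAt 𝓘(ℝ, E3) ((𝓡 3).prod 𝓘(ℝ, E3)) ∞
      (fun z => TotalSpace.mk' E3 (E := fun x : M => TangentSpace (𝓡 3) x) (e.symm z)
        (coordVec e z i)) y := by
  have hs := contMDiffAt_symm he hy
  have hϕ := ContMDiffAt.mfderiv_const (m := ∞) hs (by simp)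
  have hv : ContMDiffAt 𝓘(ℝ, E3) (𝓘(ℝ, E3).prod 𝓘(ℝ, E3)) ∞
      (fun z : E3 => TotalSpace.mk' E3 (E := fun x : E3 => TangentSpace 𝓘(ℝ, E3) x) z
        (EuclideanSpace.single i (1 : ℝ) : E3)) y :=
    contMDiffAt_vectorSpace_iff_contDiffAt.mpr contDiffAt_const
  exact ContMDiffAt.clm_apply_of_inCoordinates hϕ hv hs

theorem smooth_chartFun (he : e ∈ atlas E3 M) (hy : y ∈ e.target) (f : C^∞⟮𝓡 3, M; 𝓘(ℝ, ℝ), ℝ⟯) :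
    Smooth (chartFun e f) y :=
  (f.contMDiff.contMDiffAt.comp y (contMDiffAt_symm he hy)).contDiffAt

theorem smooth_chartBilin (he : e ∈ atlas E3 M)
    {B : (x : M) → TangentSpace (𝓡 3) x →L[ℝ] TangentSpace (𝓡 3) x →L[ℝ] ℝ}
    (hB : ContMDiff (𝓡 3) ((𝓡 3).prod 𝓘(ℝ, E3 →L[ℝ] E3 →L[ℝ] ℝ)) ∞
      (fun x => TotalSpace.mk' (E3 →L[ℝ] E3 →L[ℝ] ℝ)
        (E := fun x : M => TangentSpace (𝓡 3) x →L[ℝ] TangentSpace (𝓡 3) x →L[ℝ] ℝ) x (B x)))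
    (hy : y ∈ e.target) : SmoothMat (chartBilin e B) y := by
  intro i j
  have hs := contMDiffAt_symm he hy
  have : ContMDiffAt 𝓘(ℝ, E3) ((𝓡 3).prod 𝓘(ℝ)) ∞
      (fun z => TotalSpace.mk' ℝ (E := Bundle.Trivial M ℝ) (e.symm z)
        (B (e.symm z) (coordVec e z i) (coordVec e z j))) y := by
    apply ContMDiffAt.clm_bundle_apply₂ (F₁ := E3) (F₂ := E3)
    · exact hB.contMDiffAt.comp y hs
    · exact contMDiffAt_coordVec he hy i
    · exact contMDiffAt_coordVec he hy j
  rw [contMDiffAt_totalSpace] at this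
  exact this.2.contDiffAt

theorem smooth_transition (he : e ∈ atlas E3 M) (he' : e' ∈ atlas E3 M) (hy : y ∈ overlap e e') :
    ContDiffAt ℝ ∞ (transition e e') y :=
  ((contMDiffAt_chart he' hy.2).comp y (contMDiffAt_symm he hy.1)).contDiffAt

/-- The chain rule for the coordinate vector fields. -/
theorem coordVec_transition (he : e ∈ atlas E3 M) (he' : e' ∈ atlas E3 M)
    (hy : y ∈ overlap e e') (i : Fin 3) :
    (coordVec e y i : E3) = ∑ a, jac (transition e e') y a i •
      (coordVec e' (transition e e' y) a : E3) := by
  have hψ := smooth_transition he he' hy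
  have hs := contMDiffAt_symm he' (transition_mem hy).1
  have heq : e.symm =ᶠ[nhds y] e'.symm ∘ transition e e' :=
    Filter.eventuallyEq_iff_exists_mem.mpr ⟨overlap e e', isOpen_overlap.mem_nhds hy,
      fun z hz => (symm_transition hz).symm⟩
  have h1 : mfderiv 𝓘(ℝ, E3) (𝓡 3) (e'.symm ∘ transition e e') y
      = (mfderiv 𝓘(ℝ, E3) (𝓡 3) e'.symm (transition e e' y)).comp
        (mfderiv 𝓘(ℝ, E3) 𝓘(ℝ, E3) (transition e e') y) :=
    mfderiv_comp y (hs.mdifferentiableAt (by simp))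
      (hψ.contMDiffAt.mdifferentiableAt (by simp))
  have h2 : (coordVec e y i : E3) = mfderiv 𝓘(ℝ, E3) (𝓡 3) (e'.symm ∘ transition e e') y
      (EuclideanSpace.single i (1 : ℝ) : E3) := by
    rw [← heq.mfderiv_eq]; rfl
  rw [h2, h1, mfderiv_eq_fderiv]
  have h3 : fderiv ℝ (transition e e') y (EuclideanSpace.single i (1 : ℝ))
      = ∑ a, jac (transition e e') y a i • ee a := fderiv_ee hψ i
  change (mfderiv 𝓘(ℝ, E3) (𝓡 3) e'.symm (transition e e' y) : E3 →L[ℝ] E3)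
    (fderiv ℝ (transition e e') y (EuclideanSpace.single i (1 : ℝ))) = _
  rw [h3]
  exact map_sum_ee _ _

theorem chartBilin_transition (he : e ∈ atlas E3 M) (he' : e' ∈ atlas E3 M)
    (B : (x : M) → TangentSpace (𝓡 3) x →L[ℝ] TangentSpace (𝓡 3) x →L[ℝ] ℝ) :
    IsPullback (transition e e') (overlap e e') (chartBilin e B) (chartBilin e' B) := by
  intro y hy
  have key : ∀ (x x' : M) (_ : x' = x) (v w : E3),
      (B x : E3 →L[ℝ] E3 →L[ℝ] ℝ) v w = (B x' : E3 →L[ℝ] E3 →L[ℝ] ℝ) v w := by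
    rintro x _ rfl v w; rfl
  ext i j
  have hJ : ∀ J P : Matrix (Fin 3) (Fin 3) ℝ,
      (J.transpose * P * J) i j = ∑ a, ∑ a', J a i * J a' j * P a a' := by
    intro J P
    simp only [Matrix.mul_apply, Matrix.transpose_apply, Fin.sum_univ_three]
    ring
  rw [hJ]
  refine (key _ _ (symm_transition hy) _ _).trans ((congrArg₂ (fun v w : E3 =>
    (B (e'.symm (transition e e' y)) : E3 →L[ℝ] E3 →L[ℝ] ℝ) v w)
    (coordVec_transition he he' hy i) (coordVec_transition he he' hy j)).trans ?_)
  exact bilin_sum_sum _ _ _ _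

/-- The coordinate vectors are linearly independent, since `e ∘ e.symm` is the identity. -/
theorem eq_zero_of_sum_coordVec (he : e ∈ atlas E3 M) (hy : y ∈ e.target) {c : E3}
    (h : (mfderiv 𝓘(ℝ, E3) (𝓡 3) e.symm y : E3 →L[ℝ] E3) c = 0) : c = 0 := by
  have hs := contMDiffAt_symm he hy
  have hc := contMDiffAt_chart he (e.map_target hy)
  have heq : e ∘ e.symm =ᶠ[nhds y] id :=
    Filter.eventuallyEq_iff_exists_mem.mpr ⟨e.target, e.open_target.mem_nhds hy,
      fun z hz => e.right_inv hz⟩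
  have h1 : mfderiv 𝓘(ℝ, E3) 𝓘(ℝ, E3) (e ∘ e.symm) y
      = (mfderiv (𝓡 3) 𝓘(ℝ, E3) e (e.symm y)).comp (mfderiv 𝓘(ℝ, E3) (𝓡 3) e.symm y) :=
    mfderiv_comp y (hc.mdifferentiableAt (by simp)) (hs.mdifferentiableAt (by simp))
  rw [heq.mfderiv_eq, mfderiv_id] at h1
  have h2 : c = (mfderiv (𝓡 3) 𝓘(ℝ, E3) e (e.symm y) : E3 →L[ℝ] E3)
      ((mfderiv 𝓘(ℝ, E3) (𝓡 3) e.symm y : E3 →L[ℝ] E3) c) :=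
    congrArg (fun L : E3 →L[ℝ] E3 => L c) h1
  rw [h2, h]
  exact map_zero _

theorem chartBilin_posDef (he : e ∈ atlas E3 M) (g : Metric M) (hy : y ∈ e.target) :
    (chartBilin e g.inner y).PosDef := by
  refine Matrix.PosDef.of_dotProduct_mulVec_pos ?_ ?_
  · exact chartBilin_transpose g.symm y
  · intro x hx
    set c : E3 := WithLp.toLp 2 x with hc
    have hv : (mfderiv 𝓘(ℝ, E3) (𝓡 3) e.symm y : E3 →L[ℝ] E3) c ≠ 0 := fun h => by
      have := eq_zero_of_sum_coordVec he hy h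
      exact hx (by simpa [hc] using this)
    have hp := g.pos (e.symm y) ((mfderiv 𝓘(ℝ, E3) (𝓡 3) e.symm y : E3 →L[ℝ] E3) c) hv
    have hcs : c = ∑ i, x i • ee i := by
      ext b
      simp [hc, ee, Pi.single_apply]
    have hL : (mfderiv 𝓘(ℝ, E3) (𝓡 3) e.symm y : E3 →L[ℝ] E3) c
        = ∑ i, x i • (coordVec e y i : E3) := by
      rw [hcs]
      exact map_sum_ee _ _
    have hJ : ∀ P : Matrix (Fin 3) (Fin 3) ℝ,
        star x ⬝ᵥ (P.mulVec x) = ∑ a, ∑ a', x a * x a' * P a a' := by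
      intro P
      simp only [dotProduct, Matrix.mulVec, Fin.sum_univ_three, star_trivial]
      ring
    rw [hJ]
    refine lt_of_lt_of_eq hp ?_
    exact (congrArg₂ (fun v w : E3 => (g.inner (e.symm y) : E3 →L[ℝ] E3 →L[ℝ] ℝ) v w) hL hL).trans
      (bilin_sum_sum _ _ _ _)

theorem metricOn_chartBilin (he : e ∈ atlas E3 M) (g : Metric M) :
    MetricOn (chartBilin e g.inner) e.target where
  isOpen := e.open_target
  symm := chartBilin_transpose g.symm
  smooth _ hz := smooth_chartBilin he g.contMDiff hz
  det_ne_zero _ hz := (chartBilin_posDef he g hz).det_pos.ne'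

/-- A field of bilinear forms is determined by its components. -/
theorem eq_zero_of_chartBilin_eq_zero (he : e ∈ atlas E3 M)
    {B : (x : M) → TangentSpace (𝓡 3) x →L[ℝ] TangentSpace (𝓡 3) x →L[ℝ] ℝ} {x : M}
    (hx : x ∈ e.source) (h : chartBilin e B (e x) = 0) : B x = 0 := by
  set L : E3 →L[ℝ] E3 := mfderiv 𝓘(ℝ, E3) (𝓡 3) e.symm (e x) with hL
  have hinj : Function.Injective (L : E3 →ₗ[ℝ] E3) :=
    (injective_iff_map_eq_zero _).mpr fun c hc =>
      eq_zero_of_sum_coordVec he (e.map_source hx) hc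
  have hsurj := LinearMap.surjective_of_injective hinj
  have key : ∀ (x' : M) (_ : x' = x) (v w : E3),
      (B x : E3 →L[ℝ] E3 →L[ℝ] ℝ) v w = (B x' : E3 →L[ℝ] E3 →L[ℝ] ℝ) v w := by
    rintro _ rfl v w; rfl
  have hexp : ∀ c : E3, L c = ∑ i, c i • (coordVec e (e x) i : E3) := fun c => by
    have hc : c = ∑ i, c i • ee i := by
      ext b
      simp [ee, Pi.single_apply]
    exact (congrArg L hc).trans (map_sum_ee L _)
  have hzero : ∀ v w : E3, (B x : E3 →L[ℝ] E3 →L[ℝ] ℝ) v w = 0 := by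
    intro v w
    obtain ⟨c, rfl⟩ := hsurj v
    obtain ⟨d, rfl⟩ := hsurj w
    refine (key _ (e.left_inv hx) _ _).trans ((congrArg₂ (fun v w : E3 =>
      (B (e.symm (e x)) : E3 →L[ℝ] E3 →L[ℝ] ℝ) v w) (hexp c) (hexp d)).trans
      ((bilin_sum_sum _ _ _ _).trans ?_))
    refine Finset.sum_eq_zero fun a _ => Finset.sum_eq_zero fun a' _ => ?_
    have : (B (e.symm (e x)) : E3 →L[ℝ] E3 →L[ℝ] ℝ) (coordVec e (e x) a : E3)
        (coordVec e (e x) a' : E3) = 0 := congrFun (congrFun h a) a'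
    exact (congrArg (c a * d a' * ·) this).trans (mul_zero _)
  exact ContinuousLinearMap.ext fun v => ContinuousLinearMap.ext fun w => hzero v w

end Charts

/-! ### The divergence theorem on a compact manifold -/

section Divergence

open MeasureTheory

theorem smooth_divg {G : E3 → Matrix (Fin 3) (Fin 3) ℝ} {U : Set E3} {y : E3}
    {V : E3 → Fin 3 → ℝ} (hG : MetricOn G U) (hy : y ∈ U) (hV : ∀ i, Smooth (fun z => V z i) y) :
    Smooth (divg G V) y :=
  Smooth.sum' fun i _ => ContDiffAt.add ((hV i).dd (v := ee i))
    (ContDiffAt.mul (smooth_gam (v := ee) hG hy i).trace (hV i))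

/-- The expression in a chart of a function vanishes near points outside the support of the
function. -/
theorem chartFun_eventuallyEq_zero {M : Type*} [TopologicalSpace M]
    {e : OpenPartialHomeomorph M E3} {f : M → ℝ} {y : E3} (hy : y ∈ e.target)
    (h : e.symm y ∉ tsupport f) : chartFun e f =ᶠ[nhds y] fun _ => 0 := by
  have h1 : f =ᶠ[nhds (e.symm y)] fun _ => 0 := notMem_tsupport_iff_eventuallyEq.mp h
  exact (e.continuousAt_symm hy).eventually h1

variable {M : Type*} [TopologicalSpace M] [ChartedSpace E3 M] [IsManifold (𝓡 3) ∞ M]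

/-- The derivative `X f` of a function along a vector field, in coordinates. -/
noncomputable def along (X : E3 → Fin 3 → ℝ) (f : E3 → ℝ) (y : E3) : ℝ :=
  ∑ i, pd i f y * X y i

theorem smooth_along {X : E3 → Fin 3 → ℝ} {f : E3 → ℝ} {y : E3} (hf : Smooth f y)
    (hX : ∀ i, Smooth (fun z => X z i) y) : Smooth (along X f) y :=
  Smooth.sum' fun i _ => ContDiffAt.mul (hf.dd (v := ee i)) (hX i)

theorem along_eq_zero {X : E3 → Fin 3 → ℝ} {f : E3 → ℝ} {y : E3} {a : ℝ}
    (h : f =ᶠ[nhds y] fun _ => a) : along X f y = 0 :=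
  Finset.sum_eq_zero fun i _ => by rw [pd_eq_dd, dd_congr h, dd_const, zero_mul]

/-- A vector field on a compact Riemannian manifold whose divergence is nonnegative is
divergence-free. The vector field is given by its components `X e` in all charts `e`. -/
theorem exists_divg_eq_zero [T2Space M] [CompactSpace M] (g : Metric M)
    (X : OpenPartialHomeomorph M E3 → E3 → Fin 3 → ℝ)
    (hX : ∀ e ∈ atlas E3 M, ∀ y ∈ e.target, ∀ i, Smooth (fun z => X e z i) y)
    (htr : ∀ e ∈ atlas E3 M, ∀ e' ∈ atlas E3 M, ∀ y ∈ overlap e e', ∀ a,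
      X e' (transition e e' y) a = ∑ i, jac (transition e e') y a i * X e y i)
    (hnn : ∀ e ∈ atlas E3 M, ∀ y ∈ e.target, 0 ≤ divg (chartBilin e g.inner) (X e) y) (x : M) :
    ∃ e ∈ atlas E3 M, x ∈ e.source ∧ divg (chartBilin e g.inner) (X e) (e x) = 0 := by
  obtain ⟨t, -, ht⟩ := isCompact_univ.elim_nhds_subcover
    (fun p : M => (chartAt E3 p).source) fun p _ => chart_source_mem_nhds E3 p
  have hcov : (Set.univ : Set M) ⊆ ⋃ p : t, (chartAt E3 (p : M)).source := by
    intro z hz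
    obtain ⟨p, hp, hz⟩ := Set.mem_iUnion₂.mp (ht hz)
    exact Set.mem_iUnion.mpr ⟨⟨p, hp⟩, hz⟩
  obtain ⟨ρ, hρ⟩ := SmoothPartitionOfUnity.exists_isSubordinate (𝓡 3) isClosed_univ
    (fun p : t => (chartAt E3 (p : M)).source) (fun p => (chartAt E3 (p : M)).open_source) hcov
  set c : t → OpenPartialHomeomorph M E3 := fun p => chartAt E3 (p : M) with hc
  have hca : ∀ p, c p ∈ atlas E3 M := fun p => chart_mem_atlas E3 _
  set G : t → E3 → Matrix (Fin 3) (Fin 3) ℝ := fun p => chartBilin (c p) g.inner with hGdef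
  have hG : ∀ p, MetricOn (G p) (c p).target := fun p => metricOn_chartBilin (hca p) g
  have hpos : ∀ p, ∀ z ∈ (c p).target, (G p z).PosDef := fun p z hz =>
    chartBilin_posDef (hca p) g hz
  set s : t → E3 → ℝ := fun p z => Real.sqrt (G p z).det with hs
  have hss : ∀ p, ∀ z ∈ (c p).target, Smooth (s p) z := fun p z hz => smooth_sqrt_det (hG p) hz
  set r : t → t → E3 → ℝ := fun p q => chartFun (c p) (ρ q) with hr
  have hrs : ∀ p q, ∀ z ∈ (c p).target, Smooth (r p q) z := fun p q z hz =>
    smooth_chartFun (hca p) hz (ρ q)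
  have hXs : ∀ p, ∀ z ∈ (c p).target, ∀ i, Smooth (fun z => X (c p) z i) z := fun p =>
    hX _ (hca p)
  have hr1 : ∀ p z, ∑ q, r p q z = 1 := fun p z => by
    have := ρ.sum_eq_one (Set.mem_univ ((c p).symm z))
    rw [finsum_eq_sum_of_fintype] at this
    exact this
  set K : t → Set E3 := fun p => c p '' tsupport (ρ p) with hKdef
  have hK : ∀ p, IsCompact (K p) := fun p =>
    ((isClosed_tsupport _).isCompact).image_of_continuousOn ((c p).continuousOn.mono (hρ p))
  have hKt : ∀ p, K p ⊆ (c p).target := by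
    rintro p _ ⟨z, hz, rfl⟩
    exact (c p).map_source (hρ p hz)
  have hrK : ∀ p, ∀ z ∈ (c p).target, z ∉ K p → r p p =ᶠ[nhds z] fun _ => 0 := by
    intro p z hz hzK
    exact chartFun_eventuallyEq_zero hz fun h => hzK ⟨_, h, (c p).right_inv hz⟩
  set D : t → t → E3 → ℝ := fun p q => along (X (c p)) (r p q) with hD
  have hDs : ∀ p q, ∀ z ∈ (c p).target, Smooth (D p q) z := fun p q z hz =>
    smooth_along (hrs p q z hz) (hXs p z hz)
  have hDK : ∀ p, ∀ z ∈ (c p).target, z ∉ K p → D p p z = 0 := fun p z hz hzK =>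
    along_eq_zero (hrK p z hz hzK)
  set dv : t → E3 → ℝ := fun p => divg (G p) (X (c p)) with hdv
  have hdvs : ∀ p, ∀ z ∈ (c p).target, Smooth (dv p) z := fun p z hz =>
    smooth_divg (hG p) hz (hXs p z hz)
  -- integration by parts in each chart
  have hparts : ∀ p, ∫ z in (c p).target, r p p z * dv p z * s p z
      = -∫ z in (c p).target, D p p z * s p z := by
    intro p
    have h1 := integral_divg (hG p) (hpos p) (V := fun z i => r p p z * X (c p) z i)
      (fun z hz i => ContDiffAt.mul (hrs p p z hz) (hXs p z hz i)) (hK p) (hKt p)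
      (fun z hz hzK i => by rw [(hrK p z hz hzK).self_of_nhds, zero_mul])
    have i1 : IntegrableOn (fun z => D p p z * s p z) (c p).target :=
      integrableOn_of_smooth (hG p).isOpen
        (fun z hz => ContDiffAt.mul (hDs p p z hz) (hss p z hz)) (hK p) (hKt p)
        (fun z hz hzK => by rw [hDK p z hz hzK, zero_mul])
    have i2 : IntegrableOn (fun z => r p p z * dv p z * s p z) (c p).target :=
      integrableOn_of_smooth (hG p).isOpen
        (fun z hz => ContDiffAt.mul (ContDiffAt.mul (hrs p p z hz) (hdvs p z hz)) (hss p z hz))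
        (hK p) (hKt p)
        (fun z hz hzK => by rw [(hrK p z hz hzK).self_of_nhds, zero_mul, zero_mul])
    have h2 : ∫ z in (c p).target, (D p p z * s p z + r p p z * dv p z * s p z) = 0 := by
      rw [← h1]
      refine setIntegral_congr_fun (hG p).isOpen.measurableSet fun z hz => ?_
      have := divg_mul (G := G p) (hrs p p z hz) (hXs p z hz)
      rw [this, add_mul]
      rfl
    rw [integral_add i1 i2] at h2
    linarith
  -- splitting with the partition of unity
  have hsplit : ∀ p, ∫ z in (c p).target, D p p z * s p z
      = ∑ q, ∫ z in (c p).target, r p q z * D p p z * s p z := by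
    intro p
    rw [← integral_finsetSum]
    · refine setIntegral_congr_fun (hG p).isOpen.measurableSet fun z hz => ?_
      rw [← Finset.sum_mul, ← Finset.sum_mul, hr1, one_mul]
    · intro q _
      exact integrableOn_of_smooth (hG p).isOpen
        (fun z hz => ContDiffAt.mul (ContDiffAt.mul (hrs p q z hz) (hDs p p z hz)) (hss p z hz))
        (hK p) (hKt p) (fun z hz hzK => by rw [hDK p z hz hzK, mul_zero, zero_mul])
  -- change of charts
  have hchange : ∀ p q, ∫ z in (c p).target, r p q z * D p p z * s p z
      = ∫ z in (c q).target, r q q z * D q p z * s q z := by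
    intro p q
    have hov : ∀ p q, MeasurableSet (overlap (c p) (c q)) := fun p q =>
      isOpen_overlap.measurableSet
    rw [setIntegral_eq_of_subset_of_forall_sdiff_eq_zero (hG p).isOpen.measurableSet
        (s := overlap (c p) (c q)) Set.inter_subset_left ?_,
      setIntegral_eq_of_subset_of_forall_sdiff_eq_zero (hG q).isOpen.measurableSet
        (s := overlap (c q) (c p)) Set.inter_subset_left ?_]
    · rw [← image_transition (e := c p) (e' := c q),
        integral_pullback (G := G p) isOpen_overlap
          (fun z hz => smooth_transition (hca p) (hca q) hz) injOn_transition
          (chartBilin_transition (hca p) (hca q) g.inner)]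
      refine setIntegral_congr_fun (hov p q) fun z hz => ?_
      have e1 : r q q (transition (c p) (c q) z) = r p q z := by
        simp only [hr, chartFun, symm_transition hz]
      have e2 : r p p =ᶠ[nhds z] fun w => r q p (transition (c p) (c q) w) :=
        Filter.eventuallyEq_iff_exists_mem.mpr ⟨_, isOpen_overlap.mem_nhds hz, fun w hw => by
          simp only [hr, chartFun, symm_transition hw]⟩
      have e3 : D p p z = D q p (transition (c p) (c q) z) := by
        have e4 : ∀ i, pd i (r p p) z = _ := fun i => (dd_congr e2).trans
          (dd_comp (smooth_transition (hca p) (hca q) hz)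
            (hrs q p _ (transition_mem hz).1) i)
        simp only [hD, along, e4, htr _ (hca p) _ (hca q) z hz, pd_eq_dd, Fin.sum_univ_three]
        ring
      rw [e1, e3]
    · rintro z ⟨hz, hzn⟩
      have : (c q).symm z ∉ tsupport (ρ p) := fun h => hzn ⟨hz, hρ p h⟩
      have h0 : D q p z = 0 := along_eq_zero (chartFun_eventuallyEq_zero hz this)
      rw [h0, mul_zero, zero_mul]
    · rintro z ⟨hz, hzn⟩
      have : (c p).symm z ∉ tsupport (ρ q) := fun h => hzn ⟨hz, hρ q h⟩
      have h0 : r p q z = 0 := (chartFun_eventuallyEq_zero hz this).self_of_nhds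
      rw [h0, zero_mul, zero_mul]
  have hzero : ∀ q, ∑ p, ∫ z in (c q).target, r q q z * D q p z * s q z = 0 := by
    intro q
    rw [← integral_finsetSum]
    · refine (setIntegral_congr_fun (hG q).isOpen.measurableSet fun z hz => ?_).trans
        (integral_zero _ _)
      have h0 : ∑ p, D q p z = 0 := by
        have h1 : along (X (c q)) (fun z => ∑ p, r q p z) z = 0 :=
          along_eq_zero (Filter.Eventually.of_forall fun w => hr1 q w)
        rw [← h1]
        have h2 : ∀ i, pd i (fun z => ∑ p, r q p z) z = ∑ p, pd i (r q p) z := fun i =>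
          dd_sum fun p _ => hrs q p z hz
        simp only [hD, along, h2, Finset.sum_mul]
        exact Finset.sum_comm
      rw [← Finset.sum_mul, ← Finset.mul_sum, h0, mul_zero, zero_mul]
    · intro p _
      exact integrableOn_of_smooth (hG q).isOpen
        (fun z hz => ContDiffAt.mul (ContDiffAt.mul (hrs q q z hz) (hDs q p z hz)) (hss q z hz))
        (hK q) (hKt q) (fun z hz hzK => by
          rw [(hrK q z hz hzK).self_of_nhds, zero_mul, zero_mul])
  have htotal : ∑ p, ∫ z in (c p).target, r p p z * dv p z * s p z = 0 := by
    simp only [hparts, hsplit, Finset.sum_neg_distrib]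
    rw [Finset.sum_comm, Finset.sum_eq_zero fun q _ =>
      (Finset.sum_congr rfl fun p _ => hchange p q).trans (hzero q), neg_zero]
  have hnonneg : ∀ p, ∀ z ∈ (c p).target, 0 ≤ r p p z * dv p z * s p z := fun p z hz =>
    mul_nonneg (mul_nonneg (ρ.nonneg p _) (hnn _ (hca p) z hz)) (Real.sqrt_nonneg _)
  have heach : ∀ p, ∫ z in (c p).target, r p p z * dv p z * s p z = 0 := fun p =>
    (Finset.sum_eq_zero_iff_of_nonneg fun p _ =>
      setIntegral_nonneg (hG p).isOpen.measurableSet (hnonneg p)).mp htotal p (Finset.mem_univ p)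
  obtain ⟨p, hp⟩ := ρ.exists_pos_of_mem (Set.mem_univ x)
  have hxp : x ∈ (c p).source := hρ p (subset_tsupport _ hp.ne')
  have hz := (c p).map_source hxp
  refine ⟨c p, hca p, hxp, ?_⟩
  have h0 := eq_zero_of_setIntegral_eq_zero (hG p).isOpen
    (fun z hz => ContDiffAt.mul (ContDiffAt.mul (hrs p p z hz) (hdvs p z hz)) (hss p z hz))
    (hK p) (hKt p) (fun z hz hzK => by rw [(hrK p z hz hzK).self_of_nhds, zero_mul, zero_mul])
    (hnonneg p) (heach p) _ hz
  have hrp : r p p (c p x) = ρ p x := by simp only [hr, chartFun, (c p).left_inv hxp]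
  have hsp : 0 < s p (c p x) := Real.sqrt_pos.mpr (hpos p _ hz).det_pos
  rw [hrp] at h0
  rcases mul_eq_zero.mp h0 with h1 | h1
  · exact (mul_eq_zero.mp h1).resolve_left hp.ne'
  · exact absurd h1 hsp.ne'

end Divergence

/-! ### The dilaton is locally constant -/

section Dilaton

theorem fderiv_eq_zero_of_pd {f : E3 → ℝ} {y : E3} (h : ∀ i, pd i f y = 0) : fderiv ℝ f y = 0 := by
  ext v
  have hv : v = ∑ i, v i • ee i := by
    ext b
    simp [ee, Pi.single_apply]
  rw [hv, map_sum]
  refine Finset.sum_eq_zero fun i _ => ?_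
  rw [map_smul]
  exact (congrArg (v i • ·) (h i)).trans (smul_zero _)

theorem smooth_energy {G : E3 → Matrix (Fin 3) (Fin 3) ℝ} {f : E3 → ℝ} {U : Set E3} {y : E3}
    (hG : MetricOn G U) (hy : y ∈ U) (hf : Smooth f y) :
    Smooth (fun z => normSqGrad G f z - (1 / 2) * Real.exp (2 * f z)) y := by
  have hN := (hG.smooth y hy).inv (hG.det_ne_zero y hy)
  refine ContDiffAt.sub (Smooth.sum' fun i _ => Smooth.sum' fun j _ => ContDiffAt.mul
    (ContDiffAt.mul (hN i j) (hf.dd (v := ee i))) (hf.dd (v := ee j))) ?_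
  exact ContDiffAt.mul contDiffAt_const (ContDiffAt.exp (ContDiffAt.mul contDiffAt_const hf))

/-- Near a point where it is maximal on the domain, the dilaton is constant: the energy
`|df|² - ½ e^{2f}` is constant, and equals `-½ e^{2m}` at the maximum `m`. -/
theorem eq_max_of_energy {κ : ℝ} {G : E3 → Matrix (Fin 3) (Fin 3) ℝ} {f : E3 → ℝ} {U : Set E3}
    (hG : MetricOn G U) (hU : IsPreconnected U) (hpos : ∀ z ∈ U, (G z).PosDef)
    (hf : ∀ z ∈ U, Smooth f z) (hE : ∀ z ∈ U, ∀ i j, einsteinOp κ G f z i j = 0)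
    (hR : ∀ z ∈ U, ∀ i j k, riemannGrad G f z i j k = 0) {y z : E3} (hy : y ∈ U)
    (hmax : ∀ w ∈ U, f w ≤ f y) (hz : z ∈ U) : f z = f y := by
  have hconst := hG.isOpen.is_const_of_fderiv_eq_zero (𝕜 := ℝ) hU
    (fun w hw => (smooth_energy hG hw (hf w hw)).diff.differentiableWithinAt)
    (fun w hw => fderiv_eq_zero_of_pd (pd_energy_eq_zero hG hf hE hR hw)) hz hy
  have hloc : IsLocalMax f y := by
    filter_upwards [hG.isOpen.mem_nhds hy] with w hw using hmax w hw
  have h0 : normSqGrad G f y = 0 := by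
    have : ∀ i, pd i f y = 0 := fun i => by rw [pd, hloc.fderiv_eq_zero]; rfl
    simp [normSqGrad, this]
  have h1 : 0 ≤ normSqGrad G f z := sum_mul_nonneg (hpos z hz).inv fun i => pd i f z
  rw [h0] at hconst
  have h2 : Real.exp (2 * f y) ≤ Real.exp (2 * f z) := by linarith
  have h3 := Real.exp_le_exp.mp h2
  linarith [hmax z hz]

variable {M : Type*} [TopologicalSpace M] [ChartedSpace E3 M] [IsManifold (𝓡 3) ∞ M]
  {κ : ℝ} {g : Metric M} {φ : C^∞⟮𝓡 3, M; 𝓘(ℝ, ℝ), ℝ⟯}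

theorem IsTorsionlessSoliton.riemannGrad_eq_zero (hsol : IsTorsionlessSoliton κ g φ)
    (hharm : HasHarmonicCurvature g) {e : OpenPartialHomeomorph M E3} (he : e ∈ atlas E3 M) :
    ∀ y ∈ e.target, ∀ i j k, riemannGrad (chartBilin e g.inner) (chartFun e φ) y i j k = 0 := by
  intro y hy i j k
  have := hsol.yangMills e he y hy i j k
  rwa [yangMillsOp, hharm e he y hy, zero_add] at this

theorem MetricOn.mono {G : E3 → Matrix (Fin 3) (Fin 3) ℝ} {U V : Set E3} (hG : MetricOn G U)
    (hV : IsOpen V) (hVU : V ⊆ U) : MetricOn G V where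
  isOpen := hV
  symm := hG.symm
  smooth z hz := hG.smooth z (hVU hz)
  det_ne_zero z hz := hG.det_ne_zero z (hVU hz)

/-- The set where the dilaton attains its maximum over a connected component is closed and open. -/
theorem IsTorsionlessSoliton.eventually_eq [T2Space M] [CompactSpace M]
    (hsol : IsTorsionlessSoliton κ g φ) (hharm : HasHarmonicCurvature g) (x : M) :
    ∀ᶠ z in nhds x, φ z = φ x := by
  have : LocallyConnectedSpace M := ChartedSpace.locallyConnectedSpace E3 M
  have hCo : IsOpen (connectedComponent x) := isOpen_connectedComponent
  have hCc : IsClosed (connectedComponent x) := isClosed_connectedComponent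
  have hφ : Continuous φ := φ.contMDiff.continuous
  obtain ⟨x₁, hx₁, hmax⟩ := hCc.isCompact.exists_isMaxOn ⟨x, mem_connectedComponent⟩
    hφ.continuousOn
  have hmax' : ∀ z ∈ connectedComponent x, φ z ≤ φ x₁ := fun z hz => hmax hz
  have hSo : IsOpen (connectedComponent x ∩ φ ⁻¹' {φ x₁}) := by
    rw [isOpen_iff_mem_nhds]
    rintro z ⟨hzC, hz⟩
    set e := chartAt E3 z with he
    have hea : e ∈ atlas E3 M := chart_mem_atlas E3 z
    have hze : z ∈ e.source := mem_chart_source E3 z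
    have hW : IsOpen (e.target ∩ e.symm ⁻¹' connectedComponent x) :=
      e.symm.isOpen_inter_preimage hCo
    obtain ⟨ε, hε, hball⟩ := Metric.isOpen_iff.mp hW (e z)
      ⟨e.map_source hze, by simpa only [Set.mem_preimage, e.left_inv hze] using hzC⟩
    have hbt : Metric.ball (e z) ε ⊆ e.target := fun w hw => (hball hw).1
    have hcz : chartFun e φ (e z) = φ x₁ := by
      rw [chartFun, e.left_inv hze]; exact hz
    have hev : ∀ᶠ w in nhds z, e w ∈ Metric.ball (e z) ε :=
      (e.continuousAt hze).eventually_mem (Metric.ball_mem_nhds _ hε)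
    filter_upwards [hev, e.open_source.mem_nhds hze, hCo.mem_nhds hzC] with w hw hws hwC
    refine ⟨hwC, ?_⟩
    have h1 := eq_max_of_energy ((metricOn_chartBilin hea g).mono Metric.isOpen_ball hbt)
      (convex_ball _ _).isPreconnected (fun y hy => chartBilin_posDef hea g (hbt hy))
      (fun y hy => smooth_chartFun hea (hbt hy) φ)
      (fun y hy => hsol.einstein e hea y (hbt hy))
      (fun y hy => hsol.riemannGrad_eq_zero hharm hea y (hbt hy)) (Metric.mem_ball_self hε)
      (fun y hy => by rw [hcz]; exact hmax' _ (hball hy).2) hw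
    rw [hcz, chartFun, e.left_inv hws] at h1
    exact h1
  have hS : IsClopen (connectedComponent x ∩ φ ⁻¹' {φ x₁}) :=
    ⟨hCc.inter (isClosed_singleton.preimage hφ), hSo⟩
  have hsub := isPreconnected_connectedComponent.subset_isClopen hS ⟨x₁, hx₁, hx₁, rfl⟩
  filter_upwards [hCo.mem_nhds mem_connectedComponent] with z hz
  exact (hsub hz).2.trans (hsub mem_connectedComponent).2.symm

theorem IsTorsionlessSoliton.pd_eq_zero [T2Space M] [CompactSpace M]
    (hsol : IsTorsionlessSoliton κ g φ) (hharm : HasHarmonicCurvature g)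
    {e : OpenPartialHomeomorph M E3} (y : E3) (hy : y ∈ e.target) (i : Fin 3) :
    pd i (chartFun e φ) y = 0 := by
  have h : chartFun e φ =ᶠ[nhds y] fun _ => φ (e.symm y) :=
    (e.continuousAt_symm hy).eventually (hsol.eventually_eq hharm (e.symm y))
  rw [pd_eq_dd, dd_congr h, dd_const]

end Dilaton

/-! ### Vanishing of essential deformations -/

section Deformation

variable {M : Type*} [TopologicalSpace M] [ChartedSpace E3 M] [IsManifold (𝓡 3) ∞ M]
  {κ : ℝ} {g : Metric M} {φ : C^∞⟮𝓡 3, M; 𝓘(ℝ, ℝ), ℝ⟯} {e : OpenPartialHomeomorph M E3}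

theorem IsTorsionlessSoliton.crv_eq [T2Space M] [CompactSpace M]
    (hsol : IsTorsionlessSoliton κ g φ) (hharm : HasHarmonicCurvature g) (he : e ∈ atlas E3 M)
    (y : E3) (hy : y ∈ e.target) :
    crv ee (chartBilin e g.inner) y = (-4 / κ) • 1 ∧ Real.exp (2 * chartFun e φ y) = 48 / κ :=
  crv_eq_smul_one (metricOn_chartBilin he g) (fun _ hz => chartBilin_posDef he g hz)
    (fun _ hz => smooth_chartFun he hz φ) (fun _ hz => hsol.pd_eq_zero hharm _ hz)
    (hsol.einstein e he) (hsol.dilaton e he) (hharm e he) hy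

theorem IsTorsionlessSoliton.pos [T2Space M] [CompactSpace M]
    (hsol : IsTorsionlessSoliton κ g φ) (hharm : HasHarmonicCurvature g) (he : e ∈ atlas E3 M)
    {y : E3} (hy : y ∈ e.target) : 0 < κ :=
  soliton_pos (metricOn_chartBilin he g) (fun _ hz => chartBilin_posDef he g hz)
    (fun _ hz => hsol.pd_eq_zero hharm _ hz) (hsol.einstein e he) (hsol.dilaton e he) hy

variable {h : BilinField M} {ξ : C^∞⟮𝓡 3, M; 𝓘(ℝ, ℝ), ℝ⟯}

theorem IsInfinitesimalDeformation.variation_eq_zero [T2Space M] [CompactSpace M]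
    (hsol : IsTorsionlessSoliton κ g φ) (hharm : HasHarmonicCurvature g)
    (hdef : IsInfinitesimalDeformation κ g φ h ξ) (he : e ∈ atlas E3 M) (y : E3)
    (hy : y ∈ e.target) :
    chartFun e ξ y = 0 ∧ tau (chartBilin e g.inner) (chartBilin e h) y = 0 :=
  HeteroticSoliton.variation_eq_zero (f := chartFun e φ) (metricOn_chartBilin he g)
    (chartBilin_transpose hdef.symm)
    (fun _ hz => smooth_chartBilin he h.contMDiff hz) (fun _ hz => smooth_chartFun he hz φ)
    (fun _ hz => smooth_chartFun he hz ξ) (fun _ hz => hsol.pd_eq_zero hharm _ hz)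
    (hsol.pos hharm he hy) (fun z hz => (hsol.crv_eq hharm he z hz).1)
    (fun z hz => (hsol.crv_eq hharm he z hz).2) (hdef.einstein e he) (hdef.yangMills e he)
    (hdef.dilaton e he) hy

theorem IsOrthogonalToOrbit.divBilin_eq_zero [T2Space M] [CompactSpace M]
    (hsol : IsTorsionlessSoliton κ g φ) (hharm : HasHarmonicCurvature g)
    (horth : IsOrthogonalToOrbit g φ h ξ) (he : e ∈ atlas E3 M) (y : E3) (hy : y ∈ e.target)
    (j : Fin 3) : divBilin (chartBilin e g.inner) (chartBilin e h) y j = 0 := by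
  have := horth e he y hy j
  rw [hsol.pd_eq_zero hharm y hy, mul_zero, add_zero] at this
  linarith

theorem trg_eq_zero [T2Space M] [CompactSpace M]
    (hsol : IsTorsionlessSoliton κ g φ) (hharm : HasHarmonicCurvature g)
    (hdef : IsInfinitesimalDeformation κ g φ h ξ) (horth : IsOrthogonalToOrbit g φ h ξ)
    (he : e ∈ atlas E3 M) (y : E3) (hy : y ∈ e.target) :
    trg (chartBilin e g.inner) (chartBilin e h) y = 0 := by
  have hκ := hsol.pos hharm he hy
  have hHs : ∀ e ∈ atlas E3 M, ∀ z ∈ e.target, SmoothMat (chartBilin e h) z := fun _ he _ hz =>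
    smooth_chartBilin he h.contMDiff hz
  have hle : ∀ e ∈ atlas E3 M, ∀ z ∈ e.target,
      -(-4 / κ) * trg (chartBilin e g.inner) (chartBilin e h) z ^ 2
        ≤ divg (chartBilin e g.inner) (trField (chartBilin e g.inner) (chartBilin e h)) z :=
    fun e he z hz => le_divg_trField (metricOn_chartBilin he g)
      (fun _ hz => chartBilin_posDef he g hz) (chartBilin_transpose hdef.symm) (hHs e he)
      (horth.divBilin_eq_zero hsol hharm he) (fun z hz => (hsol.crv_eq hharm he z hz).1)
      (fun z hz => (hdef.variation_eq_zero hsol hharm he z hz).2) hz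
  have hk : 0 < -(-4 / κ) := by rw [neg_div, neg_neg]; positivity
  obtain ⟨b, hb, hxb, h0⟩ := exists_divg_eq_zero g
    (fun e => trField (chartBilin e g.inner) (chartBilin e h))
    (fun e he y hy i => smooth_trField (metricOn_chartBilin he g) (hHs e he) hy i)
    (fun e he e' he' y hy a => trField_pullback
      ((metricOn_chartBilin he g).mono isOpen_overlap Set.inter_subset_left)
      (metricOn_chartBilin he' g) (chartBilin_transition he he' _) (chartBilin_transition he he' _)
      (hHs e' he') hy (smooth_transition he he' hy) (transition_mem hy).1 a)
    (fun e he y hy => le_trans (mul_nonneg hk.le (sq_nonneg _)) (hle e he y hy)) (e.symm y)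
  have h1 := hle b hb _ (b.map_source hxb)
  rw [h0] at h1
  have h2 : trg (chartBilin b g.inner) (chartBilin b h) (b (e.symm y)) = 0 := by
    by_contra hne
    have : 0 < trg (chartBilin b g.inner) (chartBilin b h) (b (e.symm y)) ^ 2 := by positivity
    nlinarith
  have hov : y ∈ overlap e b := ⟨hy, hxb⟩
  rw [trg_pullback ((metricOn_chartBilin he g).mono isOpen_overlap Set.inter_subset_left)
    (chartBilin_transition he hb _) (chartBilin_transition he hb _) hov]
  exact h2

theorem deformation_eq_zero [T2Space M] [CompactSpace M]
    (hsol : IsTorsionlessSoliton κ g φ) (hharm : HasHarmonicCurvature g)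
    (hdef : IsInfinitesimalDeformation κ g φ h ξ) (horth : IsOrthogonalToOrbit g φ h ξ) (x : M) :
    h x = 0 ∧ ξ x = 0 := by
  have hec := chart_mem_atlas E3 x
  have hxc := mem_chart_source E3 x
  have hyc := (chartAt E3 x).map_source hxc
  have hκ := hsol.pos hharm hec hyc
  have hHs : ∀ e ∈ atlas E3 M, ∀ z ∈ e.target, SmoothMat (chartBilin e h) z := fun _ he _ hz =>
    smooth_chartBilin he h.contMDiff hz
  have hH := fun e : OpenPartialHomeomorph M E3 => chartBilin_transpose (e := e) hdef.symm
  have hk : 0 < -(-4 / κ) := by rw [neg_div, neg_neg]; positivity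
  have hle : ∀ e ∈ atlas E3 M, ∀ z ∈ e.target,
      -(-4 / κ) * ((chartBilin e g.inner z)⁻¹ * chartBilin e h z
        * ((chartBilin e g.inner z)⁻¹ * chartBilin e h z)).trace
        ≤ divg (chartBilin e g.inner) (curlField (chartBilin e g.inner) (chartBilin e h)) z :=
    fun e he z hz => le_divg_curlField (metricOn_chartBilin he g)
      (fun _ hz => chartBilin_posDef he g hz) (hH e) (hHs e he)
      (horth.divBilin_eq_zero hsol hharm he) (fun z hz => (hsol.crv_eq hharm he z hz).1)
      (fun z hz => (hdef.variation_eq_zero hsol hharm he z hz).2)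
      (trg_eq_zero hsol hharm hdef horth he) hz
  have hnn : ∀ e ∈ atlas E3 M, ∀ z ∈ e.target, 0 ≤ ((chartBilin e g.inner z)⁻¹ * chartBilin e h z
      * ((chartBilin e g.inner z)⁻¹ * chartBilin e h z)).trace := fun e he z hz =>
    trace_raise_nonneg (metricOn_chartBilin he g) (fun _ hz => chartBilin_posDef he g hz) (hH e) hz
  obtain ⟨b, hb, hxb, h0⟩ := exists_divg_eq_zero g
    (fun e => curlField (chartBilin e g.inner) (chartBilin e h))
    (fun e he y hy i => smooth_curlField (metricOn_chartBilin he g) (hH e) (hHs e he) hy i)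
    (fun e he e' he' y hy a => curlField_pullback
      ((metricOn_chartBilin he g).mono isOpen_overlap Set.inter_subset_left)
      (metricOn_chartBilin he' g) (chartBilin_transition he he' _) (chartBilin_transition he he' _)
      (hH e) (hH e') (fun z hz => hHs e he z hz.1)
      (hHs e' he') hy (smooth_transition he he' hy) (transition_mem hy).1 a)
    (fun e he y hy => le_trans (mul_nonneg hk.le (hnn e he y hy)) (hle e he y hy)) x
  have hyb := b.map_source hxb
  have h1 := hle b hb _ hyb
  rw [h0] at h1
  refine ⟨eq_zero_of_chartBilin_eq_zero hb hxb (eq_zero_of_trace_sq (chartBilin_posDef hb g hyb)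
    (hH b _) ?_), ?_⟩
  · have h2 := hnn b hb _ hyb
    by_contra hne
    have := mul_pos hk (lt_of_le_of_ne h2 (Ne.symm hne))
    linarith
  · have := (hdef.variation_eq_zero hsol hharm hec _ hyc).1
    rwa [chartFun, (chartAt E3 x).left_inv hxc] at this

/-- The zero pair is an essential deformation. -/
theorem zero_mem_essentialDeformations :
    (0 : BilinField M × C^∞⟮𝓡 3, M; 𝓘(ℝ, ℝ), ℝ⟯) ∈ essentialDeformations κ g φ := by
  have hg : ∀ t : ℝ, (fun x => g.inner x + t • (0 : BilinField M) x) = g.inner := fun t => by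
    funext x
    have key : ∀ b : E3 →L[ℝ] E3 →L[ℝ] ℝ, b + t • (0 : E3 →L[ℝ] E3 →L[ℝ] ℝ) = b := fun b =>
      ContinuousLinearMap.ext fun v => ContinuousLinearMap.ext fun w => by
        change b v w + t * 0 = b v w
        rw [mul_zero, add_zero]
    exact key (g.inner x)
  have hφ : ∀ t : ℝ, (fun x => φ x + t * (0 : C^∞⟮𝓡 3, M; 𝓘(ℝ, ℝ), ℝ⟯) x) = φ := fun t => by
    funext x
    simp
  have hb : ∀ e : OpenPartialHomeomorph M E3, chartBilin e (0 : BilinField M) = fun _ => 0 :=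
    fun e => rfl
  refine ⟨⟨fun x v w => ?_, fun e he y hy i j => ?_, fun e he y hy i j k => ?_,
    fun e he y hy => ?_⟩, fun e he y hy j => ?_⟩
  · rfl
  · simp only [Prod.fst_zero, Prod.snd_zero, hg, hφ]
    exact hasDerivAt_const _ _
  · simp only [Prod.fst_zero, Prod.snd_zero, hg, hφ]
    exact hasDerivAt_const _ _
  · simp only [Prod.fst_zero, Prod.snd_zero, hg, hφ]
    exact hasDerivAt_const _ _
  · have h1 : divBilin (chartBilin e g.inner) (fun _ => 0) y j = 0 := by
      simp [divBilin, covBilin, pd]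
    have h2 : chartFun e (0 : C^∞⟮𝓡 3, M; 𝓘(ℝ, ℝ), ℝ⟯) y = 0 := rfl
    simp only [Prod.fst_zero, Prod.snd_zero, hb, h1, h2]
    ring

end Deformation

end HeteroticSoliton

open HeteroticSoliton in
theorem theorem1 {M : Type*} [TopologicalSpace M] [ChartedSpace (EuclideanSpace ℝ (Fin 3)) M]
    [IsManifold (𝓡 3) ∞ M] [T2Space M] [CompactSpace M]
    (κ : ℝ) (g : Metric M) (φ : C^∞⟮𝓡 3, M; 𝓘(ℝ, ℝ), ℝ⟯)
    (hsol : IsTorsionlessSoliton κ g φ) (hflat : ¬ IsFlat g) (hharm : HasHarmonicCurvature g) :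
    essentialDeformations κ g φ = {0} := by
  refine Set.Subset.antisymm ?_ (Set.singleton_subset_iff.mpr zero_mem_essentialDeformations)
  rintro ⟨h, ξ⟩ ⟨hdef, horth⟩
  have key := deformation_eq_zero hsol hharm hdef horth
  refine Prod.ext ?_ ?_
  · exact ContMDiffSection.ext fun x => (key x).1
  · exact ContMDiffMap.ext fun x => (key x).2
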